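/- **Notation.** Let ${}_1F_1(a;b;x)=\sum_{j\ge 0}\frac{a(a+1)\cdots(a+j-1)}{b(b+1)\cdots(b+j-1)}\frac{x^j}{j!}$, let $H_k(x)=(-1)^k e^{x^2}\frac{d^k}{dx^k}e^{-x^2}$ be the Hermite polynomials (evaluated also at complex arguments), and $\phi_k(x)=(2^k k!\sqrt{\pi})^{-1/2}H_k(x)e^{-x^2/2}$ the Hermite functions. For an integer $n\ge 1$ put $$\tau_n(x)=\sqrt{\tfrac n2}\,\phi_{n-1}(x)\,\tfrac12\int_{\mathbb R}\operatorname{sign}(x-t)\phi_n(t)\,dt,\qquad \alpha_n(x)=\begin{cases}\phi_{n-1}(x)\big(\int_{\mathbb R}\phi_{n-1}(t)\,dt\big)^{-1},& n\text{ odd},\\ 0,& n\text{ even},\end{cases}$$ and for $\sigma>0$ let the GUE and GOE densities (of total mass $n$) be $$p_{GUE,n,\sigma^2}(x)=\frac1{\sigma\sqrt2}\sum_{k=0}^{n-1}\phi_k\Big(\frac x{\sigma\sqrt2}\Big)^2,\qquad p_{GOE,n,\sigma^2}(x)=p_{GUE,n,\sigma^2}(x)+\frac1{\sigma\sqrt2}\Big(\tau_n\Big(\frac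 x{\sigma\sqrt2}\Big)+\alpha_n\Big(\frac x{\sigma\sqrt2}\Big)\Big).$$ The moment generating function of a density $p$ is $(\mathcal Lp)(s)=\int_{\mathbb R}e^{sx}p(x)\,dx$. A GOE random matrix $A_n$ of order $n$ with variance $\sigma^2$ is a random real symmetric $n\times n$ matrix whose entries on and above the diagonal are independent, with $N(0,\sigma^2)$ entries above the diagonal and $N(0,2\sigma^2)$ entries on the diagonal. **Theorem.** Let $n\ge 1$, $\sigma>0$, let $A_n$ be a GOE random matrix of order $n$ with variance $\sigma^2$, and let $s\in\mathbb R$. Then $e^{sx}p_{GUE,n,\sigma^2}(x)$ and $e^{sx}p_{GOE,n,\sigma^2}(x)$ are integrable over $\mathbb R$, $\operatorname{Tr}(e^{sA_n})$ is integrable, and $$\begin{aligned}(\mathcal Lp_{GOE,n,\sigma^2})(s)&=\mathbb E\,\operatorname{Tr}(e^{sA_n})\\ &=(\mathcal Lp_{GUE,n,\sigma^2})(s)+\mathbb I_{n\text{ odd}}\;e^{\sigma^2s^2}{}_1F_1\Big(-\tfrac{n-1}2;\tfrac12;-2\sigma^2s^2\Big)\\ &\quad-e^{\sigma^2s^2/2}\sum_{i=0}^{\lfloor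 (n-1)/2\rfloor}\frac{\sigma^{2i}s^{2i}(n-1)!!}{(2i)!\,(n-1-2i)!!}\,{}_1F_1\big(-(n-1-2i);1+2i;-\sigma^2s^2\big)\\ &\quad+\mathbb I_{n\text{ even}}\;\frac{(n-1)!!}{2^{n/2}(n-1)!}\bigg[2\sqrt2\,\sigma s\,\frac{(n-1)!}{\left(\frac{n-2}2\right)!}\,{}_1F_1\Big(-\tfrac{n-2}2;\tfrac32;-2\sigma^2s^2\Big)e^{\sigma^2s^2}\sqrt2\int_0^{\sigma s}e^{-t^2/2}\,dt\\ &\qquad\qquad+2\,e^{\sigma^2s^2/2}\sum_{j=1}^{n-1}\binom{n-1}j(-\mathrm i)^{n-1-j}H_{n-1-j}\big(\mathrm i\sigma\sqrt2\,s\big)H_{j-1}\Big(-\frac{\sigma s}{\sqrt2}\Big)\bigg],\end{aligned}$$ where $\mathrm i$ is the imaginary unit in $(-\mathrm i)^{n-1-j}$ and in the argument of $H_{n-1-j}$, and a summation index elsewhere. -/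

import Mathlib

open MeasureTheory ProbabilityTheory

noncomputable section

/-- The confluent hypergeometric function
`₁F₁(a, b, x) = ∑ⱼ (a (a+1) ⋯ (a+j-1)) / (b (b+1) ⋯ (b+j-1)) * xʲ / j!`
(meaningful when `b` is not a non-positive integer). -/
def hyp1F1 (a b x : ℂ) : ℂ :=
  ∑' j : ℕ, (∏ i ∈ Finset.range j, (a + i)) / (∏ i ∈ Finset.range j, (b + i)) *
    (x ^ j / (Nat.factorial j : ℂ))

/-- The (physicists') Hermite polynomials, `H₀ = 1`, `Hₖ₊₁ = 2 X Hₖ - Hₖ'`.  The Rodrigues formula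
`Hₖ(x) = (-1)ᵏ exp(x²) (dᵏ/dxᵏ) exp(-x²)` is `hermitePoly_rodrigues` below. -/
def hermitePoly : ℕ → Polynomial ℤ
  | 0 => 1
  | k + 1 => 2 * Polynomial.X * hermitePoly k - Polynomial.derivative (hermitePoly k)

theorem iteratedDeriv_exp_neg_sq (k : ℕ) :
    iteratedDeriv k (fun y : ℝ => Real.exp (-y ^ 2)) =
      fun x => (-1 : ℝ) ^ k * Polynomial.aeval x (hermitePoly k) * Real.exp (-x ^ 2) := by
  induction k with
  | zero => funext x; simp [hermitePoly]
  | succ k ih =>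
    rw [iteratedDeriv_succ, ih]
    funext x
    have h1 : HasDerivAt (fun y : ℝ => Real.exp (-y ^ 2)) (Real.exp (-x ^ 2) * (-(2 * x))) x := by
      have h := ((hasDerivAt_pow 2 x).neg).exp
      simpa using h
    have h2 := (Polynomial.hasDerivAt_aeval (hermitePoly k) x).const_mul ((-1 : ℝ) ^ k)
    refine (h2.mul h1).deriv.trans ?_
    simp only [hermitePoly, map_sub, map_mul, Polynomial.aeval_X, map_ofNat]
    ring

/-- Rodrigues' formula for the Hermite polynomials. -/
theorem hermitePoly_rodrigues (k : ℕ) (x : ℝ) :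
    Polynomial.aeval x (hermitePoly k) =
      (-1 : ℝ) ^ k * Real.exp (x ^ 2) *
        iteratedDeriv k (fun y : ℝ => Real.exp (-y ^ 2)) x := by
  have h : Real.exp (x ^ 2) * Real.exp (-x ^ 2) = 1 := by
    rw [← Real.exp_add]; simp
  have h' : (-1 : ℝ) ^ k * (-1 : ℝ) ^ k = 1 := by
    rw [← mul_pow]; simp
  rw [iteratedDeriv_exp_neg_sq]
  linear_combination (-(Polynomial.aeval x (hermitePoly k))) * h
    - Real.exp (x ^ 2) * Real.exp (-x ^ 2) * Polynomial.aeval x (hermitePoly k) * h'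

/-- The value of the Hermite polynomial `Hₖ` at a complex number. -/
def hermiteH (k : ℕ) (z : ℂ) : ℂ := Polynomial.aeval z (hermitePoly k)

/-- The Hermite functions `φₖ(x) = (2ᵏ k! √π)^(-1/2) Hₖ(x) exp(-x²/2)`. -/
def hermitePhi (k : ℕ) (x : ℝ) : ℝ :=
  1 / Real.sqrt (2 ^ k * (Nat.factorial k : ℝ) * Real.sqrt Real.pi) *
    Polynomial.aeval x (hermitePoly k) * Real.exp (-x ^ 2 / 2)

/-- `τₙ(x) = √(n/2) φₙ₋₁(x) (1/2) ∫ sign(x - t) φₙ(t) dt`, for `n ≥ 1`. -/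
def tauFun (n : ℕ) (x : ℝ) : ℝ :=
  Real.sqrt ((n : ℝ) / 2) * hermitePhi (n - 1) x *
    ((1 / 2) * ∫ t : ℝ, Real.sign (x - t) * hermitePhi n t)

/-- `αₙ(x) = φₙ₋₁(x) / ∫ φₙ₋₁(t) dt` for odd `n`, and `αₙ = 0` for even `n`. -/
def alphaFun (n : ℕ) (x : ℝ) : ℝ :=
  if Odd n then hermitePhi (n - 1) x * (∫ t : ℝ, hermitePhi (n - 1) t)⁻¹ else 0

/-- The mean eigenvalue density of the GUE (total mass `n`). -/
def gueDensity (n : ℕ) (σ : ℝ) (x : ℝ) : ℝ :=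
  1 / (σ * Real.sqrt 2) *
    ∑ k ∈ Finset.range n, hermitePhi k (x / (σ * Real.sqrt 2)) ^ 2

/-- The mean eigenvalue density of the GOE (total mass `n`), for `n ≥ 1`. -/
def goeDensity (n : ℕ) (σ : ℝ) (x : ℝ) : ℝ :=
  gueDensity n σ x + 1 / (σ * Real.sqrt 2) *
    (tauFun n (x / (σ * Real.sqrt 2)) + alphaFun n (x / (σ * Real.sqrt 2)))

/-- The moment generating function (bilateral Laplace transform) of a density. -/
def laplaceTransform (p : ℝ → ℝ) (s : ℝ) : ℝ := ∫ x : ℝ, Real.exp (s * x) * p x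

/-- `A` is a GOE random matrix of order `n` with variance parameter `σ²`: it is real symmetric, the
entries on and above the diagonal are independent, those above the diagonal are `N(0, σ²)` and
those on the diagonal are `N(0, 2σ²)`. -/
structure IsGOE {Ω : Type*} [MeasurableSpace Ω] (P : Measure Ω) {n : ℕ} (σ : ℝ)
    (A : Ω → Matrix (Fin n) (Fin n) ℝ) : Prop where
  isSymm : ∀ ω, (A ω).IsSymm
  indep : iIndepFun (fun (p : {p : Fin n × Fin n // p.1 ≤ p.2}) ω => A ω p.1.1 p.1.2) P
  law_diag : ∀ i, HasLaw (fun ω => A ω i i) (gaussianReal 0 (2 * Real.toNNReal (σ ^ 2))) P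
  law_offDiag : ∀ i j, i < j →
    HasLaw (fun ω => A ω i j) (gaussianReal 0 (Real.toNNReal (σ ^ 2))) P

end

noncomputable section
open scoped ENNReal NNReal Matrix
open Polynomial (X C)

/-! Rescaling reduces everything to σ = 1/√2, where the matrix density is proportional to exp(-tr
M²/2) and the Laplace variable becomes r = σ√2 s. Two facts are needed: the density built from
Hermite functions is the mean eigenvalue density of the matrix, and its Laplace transform has the
stated closed form.

An eigenvalue is split off without using the joint law of the eigenvalues. A matrix of order m + 1
is a matrix B of order m bordered by a vector b and a corner a. The corner is traded for an
eigenvalue l through the secular equation, b for the vector w with b = (l - B) w, so that (w, 1) is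
an eigenvector, and B for the compression C = l - S (l - B) S, where S² = 1 + w wᵀ. The three
Jacobian factors are 1 + |w|², |det (l - B)| and (1 + |w|²)^(-(m+1)/2). The Gaussian weights combine
to exp(-l²/2 - tr C²/2) and w separates. Hence the mean of a sum over eigenvalues is an integral
over l against c exp(-l²/2) |det (l - C)|, with C a GOE matrix of order m
(`lintegral_goe_sum_roots`). In particular the mean eigenvalue density is c exp(-y²/2) E|det (y -
C)|.

The absolute value is removed by the identity |p(y)| = ±p(y) + 2 ∑ sign(p'(s)) p(y), summed over the
zeros s < y (`abs_prod_sub_eq`). Splitting off the eigenvalue s turns p'(s) into q(s), with q the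
characteristic polynomial of the smaller matrix, and the weight |q(s)| times the sign of q(s) is
q(s) itself (`integral_abs_charpoly`). What remains is the mean characteristic polynomial and the
two-point function E[q(l) q(y)]. Bordering gives recursions in the order for both; their solutions
are Hermite expressions (`meanChar_eq`, `charCorr_eq`). By the Christoffel-Darboux formula the
weighted two-point function is a derivative of the GUE kernel plus a rank-one term; integrating over
l < y produces the GUE density and τ, and the constants match by the recursions for Γ
(`goeDensityUnit_eq`).

The Laplace transforms follow by integration by parts. A product of two Hermite functions gives a
terminating ₁F₁ (`psiLaplace_add`). The primitive in τ unfolds into Hermite functions and, for even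
n, an error function (`hermEps_succ_eq_sum`), whose transform solves an inhomogeneous Hermite
recurrence (`epsLaplace_eq`). The inhomogeneous part is the final binomial sum. -/

/-! ### Symmetric matrices in coordinates and the normalised GOE -/

/-- Index set for the entries on and above the diagonal. -/
abbrev SymIdx (n : ℕ) : Type := {p : Fin n × Fin n // p.1 ≤ p.2}

/-- The symmetric matrix with prescribed entries on and above the diagonal. -/
def symOf {n : ℕ} (x : SymIdx n → ℝ) : Matrix (Fin n) (Fin n) ℝ :=
  Matrix.of fun i j => if h : i ≤ j then x ⟨(i, j), h⟩ else x ⟨(j, i), (not_le.mp h).le⟩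

theorem symOf_apply_of_le {n : ℕ} (x : SymIdx n → ℝ) {i j : Fin n} (h : i ≤ j) :
    symOf x i j = x ⟨(i, j), h⟩ := by
  simp [symOf, h]

theorem symOf_isSymm {n : ℕ} (x : SymIdx n → ℝ) : (symOf x).IsSymm := by
  ext i j
  rcases lt_trichotomy i j with h | h | h
  · simp [symOf, h.le, h.not_ge]
  · subst h; rfl
  · simp [symOf, h.le, h.not_ge]

theorem symOf_isHermitian {n : ℕ} (x : SymIdx n → ℝ) : (symOf x).IsHermitian := by
  have := symOf_isSymm x
  rwa [Matrix.IsHermitian, Matrix.conjTranspose_eq_transpose_of_trivial]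

/-- The entries on and above the diagonal of a matrix. -/
def symCoords {n : ℕ} (M : Matrix (Fin n) (Fin n) ℝ) : SymIdx n → ℝ := fun p => M p.1.1 p.1.2

theorem symOf_symCoords {n : ℕ} {M : Matrix (Fin n) (Fin n) ℝ} (hM : M.IsSymm) :
    symOf (symCoords M) = M := by
  ext i j
  by_cases h : i ≤ j
  · simp [symOf, symCoords, h]
  · simp [symOf, symCoords, h, hM.apply i j]

theorem symCoords_symOf {n : ℕ} (x : SymIdx n → ℝ) : symCoords (symOf x) = x := by
  ext p
  simp [symCoords, symOf_apply_of_le x p.2]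

theorem continuous_symOf {n : ℕ} : Continuous (symOf : (SymIdx n → ℝ) → _) := by
  refine continuous_matrix fun i j => ?_
  by_cases h : i ≤ j <;> simp only [symOf, h, Matrix.of_apply, dite_true, dite_false] <;> fun_prop

/-- The variances of the entries of the normalised GOE: `1` on the diagonal, `1/2` off it. -/
def symVar {n : ℕ} (p : SymIdx n) : ℝ≥0 := if p.1.1 = p.1.2 then 1 else 1 / 2

theorem symVar_ne_zero {n : ℕ} (p : SymIdx n) : symVar p ≠ 0 := by
  unfold symVar; split_ifs <;> simp

/-- The law of the entries of the normalised GOE matrix. -/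
def goeMeasure (n : ℕ) : Measure (SymIdx n → ℝ) :=
  Measure.pi fun p => gaussianReal 0 (symVar p)

instance (n : ℕ) : IsProbabilityMeasure (goeMeasure n) := by
  unfold goeMeasure; infer_instance

/-- The law of a vector of independent `N(0, 1/2)` variables. -/
def halfGaussian (m : ℕ) : Measure (Fin m → ℝ) := Measure.pi fun _ => gaussianReal 0 (1 / 2)

instance (n : ℕ) : IsProbabilityMeasure (halfGaussian n) := by
  unfold halfGaussian; infer_instance

/-- A symmetric matrix of order `m + 1` is a symmetric matrix of order `m`, a vector and a
number. -/
def symIdxEquiv (m : ℕ) : SymIdx m ⊕ (Fin m ⊕ Unit) ≃ SymIdx (m + 1) where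
  toFun
    | .inl p => ⟨(p.1.1.castSucc, p.1.2.castSucc), by simpa using p.2⟩
    | .inr (.inl i) => ⟨(i.castSucc, Fin.last m), Fin.le_last _⟩
    | .inr (.inr _) => ⟨(Fin.last m, Fin.last m), le_rfl⟩
  invFun p :=
    if h2 : p.1.2 = Fin.last m then
      if h1 : p.1.1 = Fin.last m then .inr (.inr ()) else .inr (.inl (p.1.1.castPred h1))
    else .inl ⟨(p.1.1.castPred fun h1 => h2 (Fin.last_le_iff.mp (h1 ▸ p.2)), p.1.2.castPred h2),
      by simpa using p.2⟩
  left_inv := by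
    rintro (p | i | u)
    · simp [Fin.castSucc_ne_last]
    · simp [Fin.castSucc_ne_last]
    · simp
  right_inv := by
    rintro ⟨⟨i, j⟩, h⟩
    by_cases h2 : j = Fin.last m
    · by_cases h1 : i = Fin.last m
      · simp [h1, h2]
      · simp [h1, h2]
    · simp [h2]

/-- Assemble the coordinates of a bordered symmetric matrix. -/
def border {m : ℕ} (z : (SymIdx m → ℝ) × ((Fin m → ℝ) × ℝ)) : SymIdx (m + 1) → ℝ :=
  fun p => Sum.elim z.1 (Sum.elim z.2.1 fun _ => z.2.2) ((symIdxEquiv m).symm p)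

/-- Both measures are products of one-dimensional Gaussians over the same entries, so it suffices to
compare boxes. This is the engine of every induction on the order: the last column is independent of
the leading block. -/
theorem measurePreserving_border (m : ℕ) :
    MeasurePreserving (border (m := m))
      ((goeMeasure m).prod ((halfGaussian m).prod (gaussianReal 0 1))) (goeMeasure (m + 1)) := by
  have hm : Measurable (border (m := m)) := by
    refine measurable_pi_iff.mpr fun p => ?_
    unfold border
    rcases (symIdxEquiv m).symm p with q | i | u <;> simp only [Sum.elim_inl, Sum.elim_inr] <;>
      fun_prop
  refine ⟨hm, (Measure.pi_eq fun s hs => ?_).symm⟩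
  rw [Measure.map_apply hm (MeasurableSet.univ_pi hs)]
  have hpre : border (m := m) ⁻¹' (Set.univ.pi s) =
      (Set.univ.pi fun p => s (symIdxEquiv m (.inl p))) ×ˢ
        ((Set.univ.pi fun i => s (symIdxEquiv m (.inr (.inl i)))) ×ˢ
          s (symIdxEquiv m (.inr (.inr ())))) := by
    ext ⟨β, b, a⟩
    simp only [Set.mem_preimage, Set.mem_pi, Set.mem_univ, true_implies, Set.mem_prod, border]
    rw [← (symIdxEquiv m).forall_congr_right]
    simp only [Sum.forall, Equiv.symm_apply_apply, Sum.elim_inl, Sum.elim_inr]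
    exact and_congr_right fun _ => and_congr_right fun _ => ⟨fun h => h (), fun h _ => h⟩
  rw [hpre, Measure.prod_prod, Measure.prod_prod, goeMeasure, halfGaussian, Measure.pi_pi,
    Measure.pi_pi, ← (symIdxEquiv m).prod_comp, Fintype.prod_sum_type, Fintype.prod_sum_type]
  congr 1
  · refine Finset.prod_congr rfl fun p _ => ?_
    congr 2
    simp [symVar, symIdxEquiv]
  · congr 1
    · refine Finset.prod_congr rfl fun p _ => ?_
      congr 2
      simp [symVar, symIdxEquiv, Fin.castSucc_ne_last]
    · simp [symVar, symIdxEquiv]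

/-- The bordered matrix `[[B, b], [bᵀ, a]]`. -/
def bordered {m : ℕ} (B : Matrix (Fin m) (Fin m) ℝ) (b : Fin m → ℝ) (a : ℝ) :
    Matrix (Fin m ⊕ Fin 1) (Fin m ⊕ Fin 1) ℝ :=
  Matrix.fromBlocks B (Matrix.of fun i _ => b i) (Matrix.of fun _ i => b i) (Matrix.of fun _ _ => a)

theorem symOf_border {m : ℕ} (β : SymIdx m → ℝ) (b : Fin m → ℝ) (a : ℝ) :
    symOf (border (β, b, a)) =
      Matrix.reindex finSumFinEquiv finSumFinEquiv (bordered (symOf β) b a) := by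
  have hS := symOf_isSymm (border (β, b, a))
  have hcl (i : Fin m) : ¬ Fin.last m ≤ i.castSucc := by simp
  have key : ∀ i j, symOf (border (β, b, a)) (finSumFinEquiv i) (finSumFinEquiv j) =
      bordered (symOf β) b a i j := by
    rintro (i | i) (j | j)
    · by_cases h : i ≤ j
      · have h' : Fin.castAdd 1 i ≤ Fin.castAdd 1 j := h
        rw [finSumFinEquiv_apply_left, finSumFinEquiv_apply_left, symOf_apply_of_le _ h']
        have : (⟨(Fin.castAdd 1 i, Fin.castAdd 1 j), h'⟩ : SymIdx (m + 1)) =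
          symIdxEquiv m (.inl ⟨(i, j), h⟩) := rfl
        simp [border, this, bordered, symOf_apply_of_le, h]
      · have h2 : j ≤ i := (not_le.mp h).le
        have h' : Fin.castAdd 1 j ≤ Fin.castAdd 1 i := h2
        rw [finSumFinEquiv_apply_left, finSumFinEquiv_apply_left, ← hS.apply,
          symOf_apply_of_le _ h']
        have : (⟨(Fin.castAdd 1 j, Fin.castAdd 1 i), h'⟩ : SymIdx (m + 1)) =
          symIdxEquiv m (.inl ⟨(j, i), h2⟩) := rfl
        simp [border, this, bordered, symOf, h]
    · obtain rfl : j = 0 := Subsingleton.elim _ _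
      have h' : Fin.castAdd 1 i ≤ Fin.natAdd m (0 : Fin 1) := Fin.le_last _
      rw [finSumFinEquiv_apply_left, finSumFinEquiv_apply_right, symOf_apply_of_le _ h']
      have : (⟨(Fin.castAdd 1 i, Fin.natAdd m 0), h'⟩ : SymIdx (m + 1)) =
        symIdxEquiv m (.inr (.inl i)) := rfl
      simp [border, this, bordered]
    · obtain rfl : i = 0 := Subsingleton.elim _ _
      have h' : Fin.castAdd 1 j ≤ Fin.natAdd m (0 : Fin 1) := Fin.le_last _
      rw [finSumFinEquiv_apply_left, finSumFinEquiv_apply_right, ← hS.apply,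
        symOf_apply_of_le _ h']
      have : (⟨(Fin.castAdd 1 j, Fin.natAdd m 0), h'⟩ : SymIdx (m + 1)) =
        symIdxEquiv m (.inr (.inl j)) := rfl
      simp [border, this, bordered]
    · obtain rfl : i = 0 := Subsingleton.elim _ _
      obtain rfl : j = 0 := Subsingleton.elim _ _
      rw [finSumFinEquiv_apply_right, symOf_apply_of_le _ le_rfl]
      have : (⟨(Fin.natAdd m (0 : Fin 1), Fin.natAdd m (0 : Fin 1)), le_rfl⟩ : SymIdx (m + 1)) =
        symIdxEquiv m (.inr (.inr ())) := rfl
      rw [border, this]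
      simp [bordered]
  ext i j
  obtain ⟨i, rfl⟩ := (finSumFinEquiv (m := m) (n := 1)).surjective i
  obtain ⟨j, rfl⟩ := (finSumFinEquiv (m := m) (n := 1)).surjective j
  rw [key]
  simp

theorem charpoly_symOf_border {m : ℕ} (β : SymIdx m → ℝ) (b : Fin m → ℝ) (a : ℝ) :
    (symOf (border (β, b, a))).charpoly = (bordered (symOf β) b a).charpoly := by
  rw [symOf_border, Matrix.charpoly_reindex]

/-! ### Gaussian densities -/

theorem pi_gaussianReal_eq_withDensity {ι : Type*} [Fintype ι] (v : ι → ℝ≥0) (hv : ∀ i, v i ≠ 0) :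
    Measure.pi (fun i => gaussianReal 0 (v i)) =
      volume.withDensity fun x : ι → ℝ => ENNReal.ofReal (∏ i, gaussianPDFReal 0 (v i) (x i)) := by
  refine Measure.pi_eq fun s hs => ?_
  rw [withDensity_apply _ (MeasurableSet.univ_pi hs), ← lintegral_indicator (MeasurableSet.univ_pi hs)]
  have h1 : ((Set.univ.pi s).indicator fun x : ι → ℝ =>
      ENNReal.ofReal (∏ i, gaussianPDFReal 0 (v i) (x i))) =
      fun x => ENNReal.ofReal (∏ i, (s i).indicator (gaussianPDFReal 0 (v i)) (x i)) := by
    ext x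
    by_cases hx : x ∈ Set.univ.pi s
    · rw [Set.indicator_of_mem hx]
      congr 1
      exact Finset.prod_congr rfl fun i _ => (Set.indicator_of_mem (hx i (Set.mem_univ i)) _).symm
    · rw [Set.indicator_of_notMem hx]
      simp only [Set.mem_pi, Set.mem_univ, true_implies, not_forall] at hx
      obtain ⟨i, hi⟩ := hx
      rw [Finset.prod_eq_zero (Finset.mem_univ i) (Set.indicator_of_notMem hi _), ENNReal.ofReal_zero]
  have hint : ∀ i, Integrable ((s i).indicator (gaussianPDFReal 0 (v i))) := fun i =>
    (integrable_gaussianPDFReal 0 (v i)).indicator (hs i)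
  have hnn : ∀ i x, 0 ≤ (s i).indicator (gaussianPDFReal 0 (v i)) x := fun i x =>
    Set.indicator_nonneg (fun y _ => gaussianPDFReal_nonneg 0 (v i) y) x
  rw [h1, ← ofReal_integral_eq_lintegral_ofReal]
  · rw [integral_fintype_prod_volume_eq_prod,
      ENNReal.ofReal_prod_of_nonneg fun i _ => integral_nonneg (hnn i)]
    refine Finset.prod_congr rfl fun i _ => ?_
    rw [integral_indicator (hs i), gaussianReal_apply_eq_integral 0 (hv i)]
  · exact Integrable.fintype_prod hint
  · exact ae_of_all _ fun x => Finset.prod_nonneg fun i _ => hnn i (x i)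

/-- Variance 1/2 makes the density exactly a constant times exp(-|b|²), which is rotation invariant.
No measurability of the integrand is needed because the density is measurable and finite. -/
theorem lintegral_halfGaussian {m : ℕ} (f : (Fin m → ℝ) → ℝ≥0∞) :
    ∫⁻ b, f b ∂halfGaussian m =
      ENNReal.ofReal ((√Real.pi)⁻¹ ^ m) * ∫⁻ b, ENNReal.ofReal (Real.exp (-(b ⬝ᵥ b))) * f b := by
  have hm : Measurable fun b : Fin m → ℝ => ENNReal.ofReal
      (∏ i, gaussianPDFReal 0 (1 / 2) (b i)) := by
    refine ENNReal.measurable_ofReal.comp (Finset.measurable_prod _ fun i _ => ?_)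
    exact (measurable_gaussianPDFReal _ _).comp (measurable_pi_apply i)
  rw [halfGaussian, pi_gaussianReal_eq_withDensity _ fun _ => by simp,
    lintegral_withDensity_eq_lintegral_mul_non_measurable _ hm (ae_of_all _ fun _ => by simp),
    ← lintegral_const_mul' _ _ ENNReal.ofReal_ne_top]
  refine lintegral_congr fun b => ?_
  rw [Pi.mul_apply, ← mul_assoc, ← ENNReal.ofReal_mul (by positivity)]
  congr 2
  simp only [gaussianPDFReal, Finset.prod_mul_distrib, ← Real.exp_sum, Finset.prod_const,
    Finset.card_univ, Fintype.card_fin]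
  congr 2
  · congr 2
    push_cast; ring
  · simp only [dotProduct, ← Finset.sum_neg_distrib]
    refine Finset.sum_congr rfl fun i _ => ?_
    push_cast; ring

/-- An off-diagonal entry occurs twice in tr M², which is why its variance is half the diagonal one.
The Gaussian weight therefore depends on the matrix only through tr M². -/
theorem trace_symOf_mul_self {m : ℕ} (β : SymIdx m → ℝ) :
    (symOf β * symOf β).trace = ∑ p : SymIdx m, β p ^ 2 / (symVar p : ℝ) := by
  have h1 : (symOf β * symOf β).trace = ∑ q : Fin m × Fin m, symOf β q.1 q.2 ^ 2 := by
    rw [Fintype.sum_prod_type]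
    simp only [Matrix.trace, Matrix.diag, Matrix.mul_apply]
    refine Finset.sum_congr rfl fun i _ => Finset.sum_congr rfl fun j _ => ?_
    rw [(symOf_isSymm β).apply j i, sq]
  have h2 : ∀ q : Fin m × Fin m, symOf β q.1 q.2 ^ 2 =
      (if q.1 ≤ q.2 then symOf β q.1 q.2 ^ 2 else 0) +
        (if q.2 < q.1 then symOf β q.1 q.2 ^ 2 else 0) := by
    intro q
    by_cases h : q.1 ≤ q.2
    · simp [h, not_lt.mpr h]
    · simp [h, not_le.mp h]
  have h3 : ∑ q : Fin m × Fin m, (if q.2 < q.1 then symOf β q.1 q.2 ^ 2 else 0) =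
      ∑ q : Fin m × Fin m, (if q.1 < q.2 then symOf β q.1 q.2 ^ 2 else 0) := by
    rw [← (Equiv.prodComm (Fin m) (Fin m)).sum_comp]
    refine Finset.sum_congr rfl fun q _ => ?_
    simp only [Equiv.prodComm_apply, Prod.fst_swap, Prod.snd_swap, (symOf_isSymm β).apply q.1 q.2]
  rw [h1, Finset.sum_congr rfl fun q _ => h2 q, Finset.sum_add_distrib, h3,
    ← Finset.sum_add_distrib]
  have h4 : ∀ q : Fin m × Fin m, ((if q.1 ≤ q.2 then symOf β q.1 q.2 ^ 2 else 0) +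
        (if q.1 < q.2 then symOf β q.1 q.2 ^ 2 else 0)) =
      if q.1 ≤ q.2 then symOf β q.1 q.2 ^ 2 / (if q.1 = q.2 then 1 else 1 / 2) else 0 := by
    intro q
    rcases lt_trichotomy q.1 q.2 with h | h | h
    · simp [h, h.le, h.ne]; ring
    · simp [h]
    · simp [h.not_ge, h.not_gt]
  rw [Finset.sum_congr rfl fun q _ => h4 q, ← Finset.sum_filter,
    Finset.sum_subtype (p := fun q : Fin m × Fin m => q.1 ≤ q.2) _ (by simp)]
  refine Finset.sum_congr rfl fun p _ => ?_
  rw [symOf_apply_of_le β p.2, symVar]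
  split_ifs <;> simp

/-- The normalising constant of the density of the normalised GOE. -/
def goeConst (m : ℕ) : ℝ := ∏ p : SymIdx m, (√(2 * Real.pi * symVar p))⁻¹

theorem lintegral_goeMeasure {m : ℕ} (f : (SymIdx m → ℝ) → ℝ≥0∞) :
    ∫⁻ β, f β ∂goeMeasure m = ENNReal.ofReal (goeConst m) *
      ∫⁻ β, ENNReal.ofReal (Real.exp (-((symOf β * symOf β).trace / 2))) * f β := by
  have hm : Measurable fun b : SymIdx m → ℝ => ENNReal.ofReal
      (∏ i, gaussianPDFReal 0 (symVar i) (b i)) := by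
    refine ENNReal.measurable_ofReal.comp (Finset.measurable_prod _ fun i _ => ?_)
    exact (measurable_gaussianPDFReal _ _).comp (measurable_pi_apply i)
  rw [goeMeasure, pi_gaussianReal_eq_withDensity _ symVar_ne_zero,
    lintegral_withDensity_eq_lintegral_mul_non_measurable _ hm (ae_of_all _ fun _ => by simp),
    ← lintegral_const_mul' _ _ ENNReal.ofReal_ne_top]
  refine lintegral_congr fun b => ?_
  rw [Pi.mul_apply, ← mul_assoc, ← ENNReal.ofReal_mul
    (show 0 ≤ goeConst m from Finset.prod_nonneg fun _ _ => by positivity)]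
  congr 2
  simp only [gaussianPDFReal, Finset.prod_mul_distrib, ← Real.exp_sum, goeConst]
  congr 2
  rw [trace_symOf_mul_self, Finset.sum_div, ← Finset.sum_neg_distrib]
  refine Finset.sum_congr rfl fun i _ => ?_
  have : (symVar i : ℝ) ≠ 0 := by exact_mod_cast symVar_ne_zero i
  field_simp
  ring

/-! ### Level sets of the secular function -/

section Secular

variable {m : ℕ}

/-- The secular function `x - ∑ᵢ cᵢ² / (x - μᵢ)`. -/
def secular (μ c : Fin m → ℝ) (x : ℝ) : ℝ := x - ∑ i, c i ^ 2 / (x - μ i)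

/-- The derivative of the secular function. -/
def secularDeriv (μ c : Fin m → ℝ) (x : ℝ) : ℝ := 1 + ∑ i, c i ^ 2 / (x - μ i) ^ 2

theorem secularDeriv_pos (μ c : Fin m → ℝ) (x : ℝ) : 0 < secularDeriv μ c x := by
  unfold secularDeriv
  have : 0 ≤ ∑ i, c i ^ 2 / (x - μ i) ^ 2 := Finset.sum_nonneg fun i _ => by positivity
  linarith

theorem hasDerivAt_secular (μ c : Fin m → ℝ) {x : ℝ} (hx : ∀ i, x ≠ μ i) :
    HasDerivAt (secular μ c) (secularDeriv μ c x) x := by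
  have h : ∀ i ∈ Finset.univ, HasDerivAt (fun y => c i ^ 2 / (y - μ i))
      (-(c i ^ 2 / (x - μ i) ^ 2)) x := by
    intro i _
    have h1 : HasDerivAt (fun y => y - μ i) 1 x := (hasDerivAt_id x).sub_const _
    refine ((hasDerivAt_const x (c i ^ 2)).div h1 (sub_ne_zero.mpr (hx i))).congr_deriv ?_
    simp [neg_div]
  refine ((hasDerivAt_id x).sub (HasDerivAt.fun_sum h)).congr_deriv ?_
  rw [secularDeriv, Finset.sum_neg_distrib, sub_neg_eq_add]

/-- The points off the poles with exactly `k` poles to the left. -/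
def secularPiece (μ : Fin m → ℝ) (k : ℕ) : Set ℝ :=
  {x | (∀ i, x ≠ μ i) ∧ (Finset.univ.filter fun i => μ i < x).card = k}

theorem measurableSet_ne_all (μ : Fin m → ℝ) : MeasurableSet {x : ℝ | ∀ i, x ≠ μ i} := by
  simp only [Set.ofPred_forall]
  exact MeasurableSet.iInter fun i => (measurableSet_singleton (μ i)).compl

theorem measurableSet_secularPiece (μ : Fin m → ℝ) (k : ℕ) : MeasurableSet (secularPiece μ k) := by
  refine (measurableSet_ne_all μ).inter ?_
  have hm : Measurable fun x : ℝ => (Finset.univ.filter fun i => μ i < x).card := by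
    simp only [Finset.card_filter]
    refine Finset.measurable_sum _ fun i _ => ?_
    exact Measurable.ite measurableSet_Ioi measurable_const measurable_const
  exact hm (measurableSet_singleton k)

/-- Two points with the same number of poles to their left have no pole between them, so the secular
function is differentiable with positive derivative on the whole interval joining them. -/
theorem strictMonoOn_secularPiece (μ c : Fin m → ℝ) (k : ℕ) :
    StrictMonoOn (secular μ c) (secularPiece μ k) := by
  intro x hx y hy hxy
  have hmem : ∀ z ∈ Set.Icc x y, ∀ i, z ≠ μ i := by
    rintro z ⟨h1, h2⟩ i rfl
    have hss : (Finset.univ.filter fun j => μ j < x) ⊂ (Finset.univ.filter fun j => μ j < y) := by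
      refine Finset.ssubset_iff_subset_ne.mpr ⟨fun j hj => ?_, fun h => ?_⟩
      · simp only [Finset.mem_filter, Finset.mem_univ, true_and] at hj ⊢
        exact hj.trans hxy
      · have : i ∈ (Finset.univ.filter fun j => μ j < y) := by
          simpa using lt_of_le_of_ne h2 (hy.1 i).symm
        rw [← h] at this
        simp only [Finset.mem_filter, Finset.mem_univ, true_and] at this
        exact absurd h1 (not_le.mpr this)
    have := Finset.card_lt_card hss
    rw [hx.2, hy.2] at this
    exact lt_irrefl _ this
  refine strictMonoOn_of_deriv_pos (convex_Icc x y) (f := secular μ c) ?_ ?_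
    (Set.left_mem_Icc.mpr hxy.le) (Set.right_mem_Icc.mpr hxy.le) hxy
  · exact fun z hz => (hasDerivAt_secular μ c (hmem z hz)).continuousAt.continuousWithinAt
  · intro z hz
    rw [(hasDerivAt_secular μ c (hmem z (interior_subset hz))).deriv]
    exact secularDeriv_pos μ c z

/-- The area formula for the secular function. -/
theorem lintegral_sum_secular_level (μ c : Fin m → ℝ) (R : ℝ → Finset ℝ)
    (hR : ∀ a l, l ∈ R a ↔ (∀ i, l ≠ μ i) ∧ secular μ c l = a)
    (Ψ : ℝ → ℝ → ℝ≥0∞) (hΨ : Measurable fun l => Ψ l (secular μ c l)) :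
    ∫⁻ a, ∑ l ∈ R a, Ψ l a =
      ∫⁻ l, ENNReal.ofReal (secularDeriv μ c l) * Ψ l (secular μ c l) := by
  classical
  set N : ℝ → ℕ := fun x => (Finset.univ.filter fun i => μ i < x).card with hN
  set h : ℕ → ℝ → ℝ≥0∞ := fun k a => ∑ l ∈ (R a).filter (fun l => N l = k), Ψ l a with hh
  have hfilter : ∀ k l, l ∈ secularPiece μ k →
      (R (secular μ c l)).filter (fun l => N l = k) = {l} := by
    intro k l hl
    ext x
    simp only [Finset.mem_filter, hR, Finset.mem_singleton]
    constructor
    · rintro ⟨⟨h1, h2⟩, h3⟩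
      exact (strictMonoOn_secularPiece μ c k).injOn ⟨h1, h3⟩ hl h2
    · rintro rfl
      exact ⟨⟨hl.1, rfl⟩, hl.2⟩
  have hval : ∀ k l, l ∈ secularPiece μ k → h k (secular μ c l) = Ψ l (secular μ c l) := by
    intro k l hl
    simp only [hh]
    rw [hfilter k l hl, Finset.sum_singleton]
  have hzero : ∀ k a, a ∉ secular μ c '' secularPiece μ k → h k a = 0 := by
    intro k a ha
    refine Finset.sum_eq_zero fun l hl => absurd ?_ ha
    simp only [Finset.mem_filter, hR] at hl
    exact ⟨l, ⟨hl.1.1, hl.2⟩, hl.1.2⟩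
  have hcont : ∀ k, ContinuousOn (secular μ c) (secularPiece μ k) := fun k z hz =>
    (hasDerivAt_secular μ c hz.1).continuousAt.continuousWithinAt
  have hemb : ∀ k, MeasurableEmbedding ((secularPiece μ k).domRestrict (secular μ c)) := fun k =>
    ContinuousOn.measurableEmbedding (measurableSet_secularPiece μ k) (hcont k)
      (strictMonoOn_secularPiece μ c k).injOn
  -- On each piece the root is the inverse of an injective continuous map, so the summand is the
  -- extension by zero of a measurable function along a measurable embedding. No explicit formula
  -- for the roots is required.
  have hmeas : ∀ k, Measurable (h k) := by
    intro k
    have heq : h k = Function.extend ((secularPiece μ k).domRestrict (secular μ c))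
        (fun l : secularPiece μ k => Ψ l (secular μ c l)) (fun _ => 0) := by
      funext a
      by_cases ha : a ∈ secular μ c '' secularPiece μ k
      · obtain ⟨l, hl, rfl⟩ := ha
        rw [hval k l hl]
        exact ((hemb k).injective.extend_apply (fun l : secularPiece μ k => Ψ l (secular μ c l))
          (fun _ => 0) (⟨l, hl⟩ : secularPiece μ k)).symm
      · rw [hzero k a ha, Function.extend_apply']
        rintro ⟨⟨l, hl⟩, rfl⟩
        exact ha ⟨l, hl, rfl⟩
    rw [heq]
    exact (hemb k).measurable_extend (hΨ.comp measurable_subtype_coe) measurable_const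
  have hsum : ∀ a, ∑ l ∈ R a, Ψ l a = ∑ k ∈ Finset.range (m + 1), h k a := by
    intro a
    simp only [hh]
    refine (Finset.sum_fiberwise_of_maps_to (fun l _ => ?_) _).symm
    rw [Finset.mem_range, Nat.lt_succ_iff]
    exact (Finset.card_filter_le _ _).trans (by simp)
  have hpiece : ∀ k, ∫⁻ a, h k a = ∫⁻ l in secularPiece μ k,
      ENNReal.ofReal (secularDeriv μ c l) * Ψ l (secular μ c l) := by
    intro k
    have himg : MeasurableSet (secular μ c '' secularPiece μ k) := by
      have := (hemb k).measurableSet_range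
      rwa [Set.range_domRestrict] at this
    have h1 : ∫⁻ a, h k a = ∫⁻ a in secular μ c '' secularPiece μ k, h k a := by
      rw [← lintegral_indicator himg]
      refine lintegral_congr fun a => ?_
      by_cases ha : a ∈ secular μ c '' secularPiece μ k
      · rw [Set.indicator_of_mem ha]
      · rw [Set.indicator_of_notMem ha, hzero k a ha]
    rw [h1, lintegral_image_eq_lintegral_abs_deriv_mul (measurableSet_secularPiece μ k)
      (fun x hx => (hasDerivAt_secular μ c hx.1).hasDerivWithinAt)
      (strictMonoOn_secularPiece μ c k).injOn]
    refine setLIntegral_congr_fun (measurableSet_secularPiece μ k) fun l hl => ?_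
    rw [hval k l hl, abs_of_pos (secularDeriv_pos μ c l)]
  simp only [hsum]
  rw [lintegral_finsetSum _ fun k _ => hmeas k, Finset.sum_congr rfl fun k _ => hpiece k,
    ← lintegral_biUnion_finset]
  · have hU : (⋃ k ∈ Finset.range (m + 1), secularPiece μ k) = (Set.range μ)ᶜ := by
      ext x
      simp only [Set.mem_iUnion, Finset.mem_range, Set.mem_compl_iff, Set.mem_range, not_exists,
        secularPiece, Set.mem_ofPred_eq]
      constructor
      · rintro ⟨k, _, h1, _⟩ i hi
        exact h1 i hi.symm
      · intro hx
        refine ⟨_, Nat.lt_succ_iff.mpr ?_, fun i hi => hx i hi.symm, rfl⟩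
        exact (Finset.card_filter_le _ _).trans (by simp)
    rw [hU]
    have h0 := (Set.finite_range μ).measure_zero (volume : Measure ℝ)
    have hmem : ∀ᵐ x : ℝ, x ∈ (Set.range μ)ᶜ := compl_mem_ae_iff.mpr h0
    rw [Measure.restrict_eq_self_of_ae_mem hmem]
  · intro j _ k _ hjk
    refine Set.disjoint_left.mpr fun x hx hx' => hjk ?_
    exact hx.2.symm.trans hx'.2
  · exact fun k _ => measurableSet_secularPiece μ k

end Secular

/-! ### Bordered matrices -/

theorem exists_orthogonal_diagonalization {m : ℕ} {B : Matrix (Fin m) (Fin m) ℝ}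
    (hB : B.IsHermitian) :
    ∃ V : Matrix (Fin m) (Fin m) ℝ, Vᵀ * V = 1 ∧ V * Vᵀ = 1 ∧
      B = V * Matrix.diagonal hB.eigenvalues * Vᵀ := by
  refine ⟨hB.eigenvectorUnitary, ?_, ?_, ?_⟩
  · have := Unitary.coe_star_mul_self hB.eigenvectorUnitary
    rwa [Matrix.star_eq_conjTranspose, Matrix.conjTranspose_eq_transpose_of_trivial] at this
  · have := Unitary.coe_mul_star_self hB.eigenvectorUnitary
    rwa [Unitary.coe_star, Matrix.star_eq_conjTranspose, Matrix.conjTranspose_eq_transpose_of_trivial] at this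
  · have := hB.spectral_theorem
    rw [Unitary.conjStarAlgAut_apply, Matrix.star_eq_conjTranspose,
      Matrix.conjTranspose_eq_transpose_of_trivial] at this
    simpa using! this

/-- `x - B` as used in the evaluation of the characteristic polynomial. -/
abbrev shifted {m : ℕ} (B : Matrix (Fin m) (Fin m) ℝ) (x : ℝ) : Matrix (Fin m) (Fin m) ℝ :=
  Matrix.scalar (Fin m) x - B

/-- The Schur complement of the block x - B. The vector w stands for (x - B)⁻¹ b, so that each
diagonalisation can supply its own solution. -/
theorem eval_charpoly_bordered {m : ℕ} {B : Matrix (Fin m) (Fin m) ℝ} {x : ℝ} (b w : Fin m → ℝ)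
    (a : ℝ) (hx : B.charpoly.eval x ≠ 0) (hw : shifted B x *ᵥ w = b) :
    (bordered B b a).charpoly.eval x = B.charpoly.eval x * (x - a - b ⬝ᵥ w) := by
  rw [Matrix.eval_charpoly] at hx
  have hu : IsUnit (shifted B x).det := isUnit_iff_ne_zero.mpr hx
  have : Invertible (shifted B x) := Matrix.invertibleOfIsUnitDet _ hu
  have hblock : Matrix.scalar (Fin m ⊕ Fin 1) x - bordered B b a =
      Matrix.fromBlocks (shifted B x) (-(Matrix.of fun i _ => b i))
        (-(Matrix.of fun _ i => b i)) (Matrix.of fun _ _ => x - a) := by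
    ext (i | i) (j | j)
    · simp [bordered, shifted, Matrix.diagonal_apply]
    · simp [bordered]
    · simp [bordered]
    · obtain rfl : i = 0 := Subsingleton.elim _ _
      obtain rfl : j = 0 := Subsingleton.elim _ _
      simp [bordered]
  rw [Matrix.eval_charpoly, Matrix.eval_charpoly, hblock, Matrix.det_fromBlocks₁₁,
    Matrix.det_fin_one]
  congr 1
  have hw' : ⅟(shifted B x) *ᵥ b = w := by
    rw [← hw, Matrix.mulVec_mulVec, invOf_mul_self, Matrix.one_mulVec]
  rw [Matrix.neg_mul, Matrix.neg_mul, Matrix.mul_neg, neg_neg, Matrix.sub_apply, Matrix.mul_assoc]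
  congr 1
  rw [Matrix.mul_apply, ← hw']
  rfl

section Bordered

variable {m : ℕ} {B V : Matrix (Fin m) (Fin m) ℝ} {μ : Fin m → ℝ}

theorem shifted_mulVec_resolvent (hV1 : Vᵀ * V = 1) (hV2 : V * Vᵀ = 1)
    (hB : B = V * Matrix.diagonal μ * Vᵀ) {x : ℝ} (hx : ∀ i, x ≠ μ i) (b : Fin m → ℝ) :
    shifted B x *ᵥ (V *ᵥ fun i => (Vᵀ *ᵥ b) i / (x - μ i)) = b := by
  have h1 : shifted B x = V * Matrix.diagonal (fun i => x - μ i) * Vᵀ := by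
    have : Matrix.diagonal (fun i => x - μ i) = Matrix.scalar (Fin m) x - Matrix.diagonal μ := by
      rw [Matrix.scalar_apply, Matrix.diagonal_sub]
    rw [this, Matrix.mul_sub, Matrix.sub_mul, ← hB, ← (Matrix.scalar_commute x (Commute.all x) V).eq,
      Matrix.mul_assoc, hV2, Matrix.mul_one]
  rw [h1, ← Matrix.mulVec_mulVec, Matrix.mulVec_mulVec _ Vᵀ, hV1, Matrix.one_mulVec,
    ← Matrix.mulVec_mulVec]
  have h2 : Matrix.diagonal (fun i => x - μ i) *ᵥ (fun i => (Vᵀ *ᵥ b) i / (x - μ i)) = Vᵀ *ᵥ b := by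
    ext i
    rw [Matrix.mulVec_diagonal]
    field_simp [sub_ne_zero.mpr (hx i)]
  rw [h2, Matrix.mulVec_mulVec, hV2, Matrix.one_mulVec]

theorem dotProduct_resolvent (b : Fin m → ℝ) (x : ℝ) :
    b ⬝ᵥ (V *ᵥ fun i => (Vᵀ *ᵥ b) i / (x - μ i)) = ∑ i, (Vᵀ *ᵥ b) i ^ 2 / (x - μ i) := by
  rw [Matrix.dotProduct_mulVec, ← Matrix.mulVec_transpose, dotProduct]
  exact Finset.sum_congr rfl fun i _ => by ring

theorem resolvent_dotProduct_self (hV1 : Vᵀ * V = 1) (b : Fin m → ℝ) (x : ℝ) :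
    (V *ᵥ fun i => (Vᵀ *ᵥ b) i / (x - μ i)) ⬝ᵥ (V *ᵥ fun i => (Vᵀ *ᵥ b) i / (x - μ i)) =
      ∑ i, (Vᵀ *ᵥ b) i ^ 2 / (x - μ i) ^ 2 := by
  rw [Matrix.dotProduct_mulVec, ← Matrix.mulVec_transpose, Matrix.mulVec_mulVec, hV1,
    Matrix.one_mulVec, dotProduct]
  exact Finset.sum_congr rfl fun i _ => by rw [← sq, div_pow]

theorem charpoly_of_diagonalization (hV1 : Vᵀ * V = 1) (hB : B = V * Matrix.diagonal μ * Vᵀ) :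
    B.charpoly = ∏ i, (X - C (μ i)) := by
  rw [hB, Matrix.mul_assoc, Matrix.charpoly_mul_comm, Matrix.mul_assoc, hV1, Matrix.mul_one,
    Matrix.charpoly_diagonal]

theorem eval_charpoly_ne_zero_iff (hV1 : Vᵀ * V = 1) (hB : B = V * Matrix.diagonal μ * Vᵀ) (x : ℝ) :
    B.charpoly.eval x ≠ 0 ↔ ∀ i, x ≠ μ i := by
  rw [charpoly_of_diagonalization hV1 hB, Polynomial.eval_prod, Finset.prod_ne_zero_iff]
  simp [sub_ne_zero]

theorem eval_charpoly_bordered_secular (hV1 : Vᵀ * V = 1) (hV2 : V * Vᵀ = 1)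
    (hB : B = V * Matrix.diagonal μ * Vᵀ) {x : ℝ} (hx : ∀ i, x ≠ μ i) (b : Fin m → ℝ) (a : ℝ) :
    (bordered B b a).charpoly.eval x =
      B.charpoly.eval x * (secular μ (Vᵀ *ᵥ b) x - a) := by
  rw [eval_charpoly_bordered b _ a ((eval_charpoly_ne_zero_iff hV1 hB x).mpr hx)
    (shifted_mulVec_resolvent hV1 hV2 hB hx b), dotProduct_resolvent, secular]
  ring

/-- Off the spectrum of B this is the secular formula with denominators cleared, and infinitely many
points determine a polynomial. The gain is that it can be evaluated at the eigenvalues of B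
themselves. -/
theorem charpoly_bordered_eq (hV1 : Vᵀ * V = 1) (hV2 : V * Vᵀ = 1)
    (hB : B = V * Matrix.diagonal μ * Vᵀ) (b : Fin m → ℝ) (a : ℝ) :
    (bordered B b a).charpoly = (∏ i, (X - C (μ i))) * (X - C a) -
      ∑ i, C ((Vᵀ *ᵥ b) i ^ 2) * ∏ j ∈ Finset.univ.erase i, (X - C (μ j)) := by
  refine Polynomial.eq_of_infinite_eval_eq _ _
    (((Set.finite_range μ).infinite_compl).mono fun x hx => ?_)
  have hx' : ∀ i, x ≠ μ i := fun i hi => hx ⟨i, hi.symm⟩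
  simp only [Set.mem_ofPred_eq]
  rw [eval_charpoly_bordered_secular hV1 hV2 hB hx', charpoly_of_diagonalization hV1 hB, secular]
  simp only [Polynomial.eval_sub, Polynomial.eval_mul, Polynomial.eval_finsetSum,
    Polynomial.eval_prod, Polynomial.eval_X, Polynomial.eval_C]
  have : ∀ i, (Vᵀ *ᵥ b) i ^ 2 * ∏ j ∈ Finset.univ.erase i, (x - μ j) =
      (∏ j, (x - μ j)) * ((Vᵀ *ᵥ b) i ^ 2 / (x - μ i)) := by
    intro i
    rw [← Finset.mul_prod_erase Finset.univ _ (Finset.mem_univ i)]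
    field_simp [sub_ne_zero.mpr (hx' i)]
  rw [Finset.sum_congr rfl fun i _ => this i, ← Finset.mul_sum]
  ring

/-- At an eigenvalue of B every term of the expansion but one contains a vanishing factor. The
surviving one is nonzero because the spectrum of B is simple and b has a component along each
eigenvector. Hence B and its bordering share no eigenvalue. -/
theorem eval_charpoly_bordered_ne_zero (hV1 : Vᵀ * V = 1) (hV2 : V * Vᵀ = 1)
    (hB : B = V * Matrix.diagonal μ * Vᵀ) (hμ : Function.Injective μ) {b : Fin m → ℝ}
    (hb : ∀ i, (Vᵀ *ᵥ b) i ≠ 0) (a : ℝ) (i : Fin m) :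
    (bordered B b a).charpoly.eval (μ i) ≠ 0 := by
  rw [charpoly_bordered_eq hV1 hV2 hB]
  simp only [Polynomial.eval_sub, Polynomial.eval_mul, Polynomial.eval_finsetSum,
    Polynomial.eval_prod, Polynomial.eval_X, Polynomial.eval_C]
  rw [Finset.prod_eq_zero (Finset.mem_univ i) (sub_self _), zero_mul, zero_sub, neg_ne_zero,
    Finset.sum_eq_single i]
  · refine mul_ne_zero (pow_ne_zero _ (hb i)) (Finset.prod_ne_zero_iff.mpr fun j hj => ?_)
    exact sub_ne_zero.mpr fun h => (Finset.ne_of_mem_erase hj) (hμ h).symm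
  · intro j _ hj
    rw [Finset.prod_eq_zero (Finset.mem_erase.mpr ⟨hj.symm, Finset.mem_univ i⟩) (sub_self _),
      mul_zero]
  · simp

/-- The corner is chosen so that x is a root. Differentiating the product of the characteristic
polynomial of B and the secular factor then leaves only the derivative of the second factor. -/
theorem derivative_charpoly_bordered (hV1 : Vᵀ * V = 1) (hV2 : V * Vᵀ = 1)
    (hB : B = V * Matrix.diagonal μ * Vᵀ) {x : ℝ} (hx : ∀ i, x ≠ μ i) (b : Fin m → ℝ) :
    (bordered B b (secular μ (Vᵀ *ᵥ b) x)).charpoly.derivative.eval x =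
      B.charpoly.eval x * secularDeriv μ (Vᵀ *ᵥ b) x := by
  set a := secular μ (Vᵀ *ᵥ b) x with ha
  have h1 := (bordered B b a).charpoly.hasDerivAt x
  have h2 := (B.charpoly.hasDerivAt x).mul ((hasDerivAt_secular μ (Vᵀ *ᵥ b) hx).sub_const a)
  have h3 : (fun y => (bordered B b a).charpoly.eval y) =ᶠ[nhds x]
      (fun y => B.charpoly.eval y) * (fun y => secular μ (Vᵀ *ᵥ b) y - a) := by
    have : ∀ᶠ y in nhds x, ∀ i, y ≠ μ i :=
      Filter.eventually_all.mpr fun i => isOpen_ne.mem_nhds (hx i)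
    filter_upwards [this] with y hy
    exact eval_charpoly_bordered_secular hV1 hV2 hB hy b a
  have h4 := h1.unique (h2.congr_of_eventuallyEq h3)
  rw [h4, ← ha]
  ring

theorem mem_roots_bordered_iff (hV1 : Vᵀ * V = 1) (hV2 : V * Vᵀ = 1)
    (hB : B = V * Matrix.diagonal μ * Vᵀ) (hμ : Function.Injective μ) {b : Fin m → ℝ}
    (hb : ∀ i, (Vᵀ *ᵥ b) i ≠ 0) (a l : ℝ) :
    l ∈ (bordered B b a).charpoly.roots ↔ (∀ i, l ≠ μ i) ∧ secular μ (Vᵀ *ᵥ b) l = a := by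
  rw [Polynomial.mem_roots (Matrix.charpoly_monic _).ne_zero, Polynomial.IsRoot.def]
  constructor
  · intro h
    have hl : ∀ i, l ≠ μ i := by
      rintro i rfl
      exact eval_charpoly_bordered_ne_zero hV1 hV2 hB hμ hb a i h
    refine ⟨hl, ?_⟩
    rw [eval_charpoly_bordered_secular hV1 hV2 hB hl] at h
    have := (mul_eq_zero.mp h).resolve_left ((eval_charpoly_ne_zero_iff hV1 hB l).mpr hl)
    linarith
  · rintro ⟨hl, rfl⟩
    rw [eval_charpoly_bordered_secular hV1 hV2 hB hl, sub_self, mul_zero]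

/-- The derivative at a root is a nonzero value of the characteristic polynomial of B times a
positive secular derivative, so no root is multiple. -/
theorem nodup_roots_bordered (hV1 : Vᵀ * V = 1) (hV2 : V * Vᵀ = 1)
    (hB : B = V * Matrix.diagonal μ * Vᵀ) (hμ : Function.Injective μ) {b : Fin m → ℝ}
    (hb : ∀ i, (Vᵀ *ᵥ b) i ≠ 0) (a : ℝ) :
    (bordered B b a).charpoly.roots.Nodup := by
  rw [Multiset.nodup_iff_count_le_one]
  intro l
  rw [Polynomial.count_roots]
  by_contra! h
  rw [Polynomial.one_lt_rootMultiplicity_iff_isRoot (Matrix.charpoly_monic _).ne_zero] at h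
  have hl := (mem_roots_bordered_iff hV1 hV2 hB hμ hb a l).mp
    ((Polynomial.mem_roots (Matrix.charpoly_monic _).ne_zero).mpr h.1)
  have h2 := h.2
  rw [Polynomial.IsRoot.def, ← hl.2, derivative_charpoly_bordered hV1 hV2 hB hl.1] at h2
  exact mul_ne_zero ((eval_charpoly_ne_zero_iff hV1 hB l).mpr hl.1)
    (secularDeriv_pos _ _ _).ne' h2

end Bordered

/-! ### Continuity of characteristic polynomials and generic simplicity of the spectrum -/

/-- The coefficients are evaluations of the universal characteristic polynomial, hence polynomials
in the entries. -/
theorem continuous_charpoly_coeff {ι : Type*} [Fintype ι] [DecidableEq ι] (k : ℕ) :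
    Continuous fun M : Matrix ι ι ℝ => M.charpoly.coeff k := by
  have h : (fun M : Matrix ι ι ℝ => M.charpoly.coeff k) = fun M =>
      MvPolynomial.eval (Function.uncurry M) ((Matrix.charpoly.univ ℝ ι).coeff k) := by
    funext M
    have := Matrix.charpoly.univ_coeff_eval₂Hom ι (RingHom.id ℝ) (Function.uncurry M) k
    have hM : Matrix.of (Function.curry (Function.uncurry M)) = M := rfl
    rw [hM] at this
    exact this.symm
  rw [h]
  refine (MvPolynomial.continuous_eval _).comp (continuous_pi fun p => ?_)
  exact (continuous_apply p.2).comp (continuous_apply p.1)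

theorem eval_charpoly_eq_sum {ι : Type*} [Fintype ι] [DecidableEq ι] (M : Matrix ι ι ℝ) (x : ℝ) :
    M.charpoly.eval x = ∑ k ∈ Finset.range (Fintype.card ι + 1), M.charpoly.coeff k * x ^ k :=
  Polynomial.eval_eq_sum_range' (by rw [Matrix.charpoly_natDegree_eq_dim]; omega) x

theorem eval_derivative_charpoly_eq_sum {ι : Type*} [Fintype ι] [DecidableEq ι] (M : Matrix ι ι ℝ)
    (x : ℝ) : M.charpoly.derivative.eval x =
      ∑ k ∈ Finset.range (Fintype.card ι + 1), M.charpoly.coeff k * (k * x ^ (k - 1)) := by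
  rw [Polynomial.derivative_eval, Polynomial.sum_over_range' _ (fun k => by simp)
    (Fintype.card ι + 1) (by rw [Matrix.charpoly_natDegree_eq_dim]; omega)]
  exact Finset.sum_congr rfl fun k _ => by ring

theorem continuous_eval_charpoly {ι : Type*} [Fintype ι] [DecidableEq ι] :
    Continuous fun p : Matrix ι ι ℝ × ℝ => p.1.charpoly.eval p.2 := by
  simp only [eval_charpoly_eq_sum]
  exact continuous_finsetSum _ fun k _ =>
    ((continuous_charpoly_coeff k).comp continuous_fst).mul (continuous_snd.pow k)

theorem continuous_eval_derivative_charpoly {ι : Type*} [Fintype ι] [DecidableEq ι] :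
    Continuous fun p : Matrix ι ι ℝ × ℝ => p.1.charpoly.derivative.eval p.2 := by
  simp only [eval_derivative_charpoly_eq_sum]
  exact continuous_finsetSum _ fun k _ =>
    ((continuous_charpoly_coeff k).comp continuous_fst).mul
      (continuous_const.mul (continuous_snd.pow (k - 1)))

theorem nodup_roots_charpoly_iff {ι : Type*} [Fintype ι] [DecidableEq ι] (M : Matrix ι ι ℝ) :
    M.charpoly.roots.Nodup ↔
      ∀ x, ¬ (M.charpoly.eval x = 0 ∧ M.charpoly.derivative.eval x = 0) := by
  rw [Multiset.nodup_iff_count_le_one]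
  refine forall_congr' fun x => ?_
  rw [Polynomial.count_roots, ← not_lt,
    Polynomial.one_lt_rootMultiplicity_iff_isRoot (Matrix.charpoly_monic _).ne_zero]
  rfl

/-- The complement says that the polynomial and its derivative have a common real zero. Restricting
the zero to [-N, N] gives the projection of a closed set along a compact factor, so the complement
is a countable union of closed sets. -/
theorem measurableSet_nodup_roots (m : ℕ) :
    MeasurableSet {β : SymIdx m → ℝ | (symOf β).charpoly.roots.Nodup} := by
  have h : {β : SymIdx m → ℝ | (symOf β).charpoly.roots.Nodup}ᶜ =
      ⋃ N : ℕ, Prod.fst '' {p : (SymIdx m → ℝ) × Set.Icc (-(N : ℝ)) N |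
        (symOf p.1).charpoly.eval (p.2 : ℝ) = 0 ∧
          (symOf p.1).charpoly.derivative.eval (p.2 : ℝ) = 0} := by
    ext β
    simp only [Set.mem_compl_iff, Set.mem_ofPred_eq, nodup_roots_charpoly_iff, not_forall, not_not,
      Set.mem_iUnion, Set.mem_image, Prod.exists, exists_and_right, exists_eq_right]
    constructor
    · rintro ⟨x, hx⟩
      obtain ⟨N, hN⟩ := exists_nat_ge |x|
      exact ⟨N, ⟨x, abs_le.mp hN⟩, hx⟩
    · rintro ⟨N, x, hx⟩
      exact ⟨x, hx⟩
  refine MeasurableSet.of_compl ?_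
  rw [h]
  refine MeasurableSet.iUnion fun N => IsClosed.measurableSet ?_
  refine isClosedMap_fst_of_compactSpace _ ?_
  have hc : Continuous fun p : (SymIdx m → ℝ) × Set.Icc (-(N : ℝ)) N =>
      (symOf p.1, (p.2 : ℝ)) :=
    (continuous_symOf.comp continuous_fst).prodMk (continuous_subtype_val.comp continuous_snd)
  exact (isClosed_singleton.preimage (continuous_eval_charpoly.comp hc)).inter
    (isClosed_singleton.preimage (continuous_eval_derivative_charpoly.comp hc))

theorem injective_eigenvalues_of_nodup {m : ℕ} {B : Matrix (Fin m) (Fin m) ℝ} (hB : B.IsHermitian)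
    (h : B.charpoly.roots.Nodup) : Function.Injective hB.eigenvalues := by
  rw [hB.roots_charpoly_eq_eigenvalues] at h
  intro i j hij
  exact Multiset.inj_on_of_nodup_map h i (Finset.mem_univ i) j (Finset.mem_univ j) (by simpa using hij)

theorem halfGaussian_absolutelyContinuous (m : ℕ) : halfGaussian m ≪ volume := by
  rw [halfGaussian, pi_gaussianReal_eq_withDensity _ fun _ => by simp]
  exact withDensity_absolutelyContinuous _ _

/-- Each condition fails only on the kernel of a nonzero linear form, a Lebesgue-null hyperplane. -/
theorem ae_mulVec_ne_zero {m : ℕ} {V : Matrix (Fin m) (Fin m) ℝ} (hV : Vᵀ * V = 1) :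
    ∀ᵐ b ∂halfGaussian m, ∀ i, (Vᵀ *ᵥ b) i ≠ 0 := by
  rw [ae_all_iff]
  intro i
  have h := Measure.addHaar_submodule (volume : Measure (Fin m → ℝ))
    (LinearMap.ker ((LinearMap.proj i : (Fin m → ℝ) →ₗ[ℝ] ℝ) ∘ₗ Matrix.toLin' Vᵀ)) ?_
  · have h' : ∀ᵐ b : Fin m → ℝ, (Vᵀ *ᵥ b) i ≠ 0 := by
      rw [ae_iff]
      convert h using 2
      ext b
      simp
    exact (halfGaussian_absolutelyContinuous m).ae_le h'
  · intro htop
    have h1 : V *ᵥ Pi.single i 1 ∈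
        LinearMap.ker ((LinearMap.proj i : (Fin m → ℝ) →ₗ[ℝ] ℝ) ∘ₗ Matrix.toLin' Vᵀ) := by
      rw [htop]; trivial
    rw [LinearMap.mem_ker, LinearMap.comp_apply, Matrix.toLin'_apply, Matrix.mulVec_mulVec, hV,
      Matrix.one_mulVec] at h1
    simp at h1

theorem measurable_border (m : ℕ) : Measurable (border (m := m)) :=
  (measurePreserving_border m).measurable

theorem ae_goeMeasure_succ {m : ℕ} {p : (SymIdx (m + 1) → ℝ) → Prop} (hp : MeasurableSet {x | p x})
    (h : ∀ᵐ β ∂goeMeasure m, ∀ᵐ b ∂halfGaussian m, ∀ᵐ a ∂gaussianReal 0 1, p (border (β, b, a))) :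
    ∀ᵐ x ∂goeMeasure (m + 1), p x := by
  rw [← (measurePreserving_border m).map_eq, ae_map_iff (measurable_border m).aemeasurable hp,
    Measure.ae_prod_iff_ae_ae (p := fun z => p (border z)) (measurable_border m hp)]
  filter_upwards [h] with β hβ
  rw [Measure.ae_prod_iff_ae_ae (p := fun z => p (border (β, z)))
    (((measurable_border m).comp measurable_prodMk_left) hp)]
  exact hβ

/-- Simplicity propagates under bordering: for a simple leading block and almost every column, every
choice of the corner gives a simple spectrum. -/
theorem ae_nodup_roots (m : ℕ) : ∀ᵐ β ∂goeMeasure m, (symOf β).charpoly.roots.Nodup := by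
  induction m with
  | zero =>
    refine ae_of_all _ fun β => ?_
    rw [Matrix.charpoly, Matrix.det_isEmpty]
    simp
  | succ m ih =>
    refine ae_goeMeasure_succ (measurableSet_nodup_roots (m + 1)) ?_
    filter_upwards [ih] with β hβ
    obtain ⟨V, hV1, hV2, hB⟩ := exists_orthogonal_diagonalization (symOf_isHermitian β)
    filter_upwards [ae_mulVec_ne_zero hV1] with b hb
    refine ae_of_all _ fun a => ?_
    rw [charpoly_symOf_border]
    exact nodup_roots_bordered hV1 hV2 hB (injective_eigenvalues_of_nodup _ hβ) hb a

theorem lintegral_goeMeasure_succ {m : ℕ} {G : (SymIdx (m + 1) → ℝ) → ℝ≥0∞} (hG : Measurable G) :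
    ∫⁻ x, G x ∂goeMeasure (m + 1) =
      ∫⁻ β, ∫⁻ b, ∫⁻ a, G (border (β, b, a)) ∂gaussianReal 0 1 ∂halfGaussian m ∂goeMeasure m := by
  rw [← (measurePreserving_border m).lintegral_comp hG,
    lintegral_prod (fun z => G (border z)) (hG.comp (measurable_border m)).aemeasurable]
  refine lintegral_congr fun β => ?_
  rw [lintegral_prod (fun z => G (border (β, z))) (hG.comp ((measurable_border m).comp measurable_prodMk_left)).aemeasurable]

/-! ### Disintegration along an eigenvalue -/

section Disintegration

variable {m : ℕ}

/-- The solution `w` of `(l - B) w = b`. -/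
def resolventVec (B : Matrix (Fin m) (Fin m) ℝ) (b : Fin m → ℝ) (l : ℝ) : Fin m → ℝ :=
  (shifted B l).det⁻¹ • ((shifted B l).adjugate *ᵥ b)

theorem resolventVec_mulVec {B : Matrix (Fin m) (Fin m) ℝ} {l : ℝ} (h : (shifted B l).det ≠ 0)
    (w : Fin m → ℝ) : resolventVec B (shifted B l *ᵥ w) l = w := by
  rw [resolventVec, Matrix.mulVec_mulVec, Matrix.adjugate_mul, Matrix.smul_mulVec,
    Matrix.one_mulVec, smul_smul, inv_mul_cancel₀ h, one_smul]

/-- The integrand obtained when the last diagonal entry is replaced by the eigenvalue. -/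
def eigenIntegrand (F : ℝ × ℝ × ℝ → ℝ≥0∞) (y : ℝ) (B : Matrix (Fin m) (Fin m) ℝ) (b : Fin m → ℝ)
    (l : ℝ) : ℝ≥0∞ :=
  if (shifted B l).det = 0 then 0 else
    ENNReal.ofReal (1 + resolventVec B b l ⬝ᵥ resolventVec B b l) *
      (gaussianPDF 0 1 (l - b ⬝ᵥ resolventVec B b l) *
        F (l, (shifted B l).det * (1 + resolventVec B b l ⬝ᵥ resolventVec B b l),
          (bordered B b (l - b ⬝ᵥ resolventVec B b l)).charpoly.eval y))

theorem continuous_shifted :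
    Continuous fun p : (SymIdx m → ℝ) × (Fin m → ℝ) × ℝ => shifted (symOf p.1) p.2.2 := by
  refine Continuous.sub ?_ (continuous_symOf.comp continuous_fst)
  refine continuous_matrix fun i j => ?_
  by_cases h : i = j
  · subst h; simp only [Matrix.scalar_apply, Matrix.diagonal_apply_eq]; fun_prop
  · simp only [Matrix.scalar_apply, Matrix.diagonal_apply_ne _ h]; fun_prop

/-- Cramer's rule writes the resolvent through determinant and adjugate, both continuous in the
entries, so joint measurability needs no selection of eigenvectors. -/
theorem measurable_resolventVec : Measurable fun p : (SymIdx m → ℝ) × (Fin m → ℝ) × ℝ =>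
    resolventVec (symOf p.1) p.2.1 p.2.2 := by
  have h1 : Measurable fun p : (SymIdx m → ℝ) × (Fin m → ℝ) × ℝ =>
      (shifted (symOf p.1) p.2.2).det⁻¹ := continuous_shifted.matrix_det.measurable.inv
  have h2 : Measurable fun p : (SymIdx m → ℝ) × (Fin m → ℝ) × ℝ =>
      (shifted (symOf p.1) p.2.2).adjugate *ᵥ p.2.1 :=
    (continuous_shifted.matrix_adjugate.matrix_mulVec
      (continuous_fst.comp continuous_snd)).measurable
  exact measurable_pi_iff.mpr fun i => h1.mul (measurable_pi_iff.mp h2 i)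

theorem continuous_bordered : Continuous fun p : (SymIdx m → ℝ) × (Fin m → ℝ) × ℝ =>
    bordered (symOf p.1) p.2.1 p.2.2 := by
  refine continuous_matrix fun i j => ?_
  rcases i with i | i <;> rcases j with j | j
  · exact (continuous_symOf.comp continuous_fst).matrix_elem i j
  all_goals simp only [bordered, Matrix.fromBlocks_apply₁₂, Matrix.fromBlocks_apply₂₁,
    Matrix.fromBlocks_apply₂₂, Matrix.of_apply]; fun_prop

theorem continuous_eval_charpoly_bordered (y : ℝ) :
    Continuous fun p : (SymIdx m → ℝ) × (Fin m → ℝ) × ℝ =>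
      (bordered (symOf p.1) p.2.1 p.2.2).charpoly.eval y := by
  simp only [Matrix.eval_charpoly]
  exact (continuous_const.sub continuous_bordered).matrix_det

theorem measurable_eval_charpoly_bordered {α : Type*} [MeasurableSpace α] {β : α → SymIdx m → ℝ}
    {b : α → Fin m → ℝ} {a : α → ℝ} (hβ : Measurable β) (hb : Measurable b) (ha : Measurable a)
    (y : ℝ) : Measurable fun x => (bordered (symOf (β x)) (b x) (a x)).charpoly.eval y := by
  have h1 := (continuous_eval_charpoly_bordered (m := m) y).measurable
  generalize hf : (fun p : (SymIdx m → ℝ) × (Fin m → ℝ) × ℝ =>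
    (bordered (symOf p.1) p.2.1 p.2.2).charpoly.eval y) = f at h1
  have h2 : Measurable fun x => f (β x, b x, a x) := h1.comp (hβ.prodMk (hb.prodMk ha))
  rw [← hf] at h2
  exact h2

theorem measurable_dotProduct {α : Type*} [MeasurableSpace α] {f g : α → Fin m → ℝ}
    (hf : Measurable f) (hg : Measurable g) : Measurable fun x => f x ⬝ᵥ g x :=
  (Continuous.dotProduct continuous_fst continuous_snd).measurable.comp (hf.prodMk hg)

theorem measurable_eigenIntegrand {F : ℝ × ℝ × ℝ → ℝ≥0∞} (hF : Measurable F) (y : ℝ) :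
    Measurable fun p : (SymIdx m → ℝ) × (Fin m → ℝ) × ℝ =>
      eigenIntegrand F y (symOf p.1) p.2.1 p.2.2 := by
  have hd := (continuous_shifted (m := m)).matrix_det.measurable
  have hw := measurable_resolventVec (m := m)
  have hww := (measurable_dotProduct hw hw).const_add 1
  have hb : Measurable fun p : (SymIdx m → ℝ) × (Fin m → ℝ) × ℝ => p.2.1 := by fun_prop
  have hl : Measurable fun p : (SymIdx m → ℝ) × (Fin m → ℝ) × ℝ => p.2.2 := by fun_prop
  have hg := hl.sub (measurable_dotProduct hb hw)
  have hc := measurable_eval_charpoly_bordered measurable_fst hb hg y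
  have hF' := hF.comp (hl.prodMk ((hd.mul hww).prodMk hc))
  have hp := (measurable_gaussianPDF 0 1).comp hg
  exact Measurable.ite (hd (measurableSet_singleton 0)) measurable_const
    (hww.ennreal_ofReal.mul (hp.mul hF'))

theorem Measurable.eigenIntegrand {F : ℝ × ℝ × ℝ → ℝ≥0∞} (hF : Measurable F) (y : ℝ) {α : Type*}
    [MeasurableSpace α] {β : α → SymIdx m → ℝ} {b : α → Fin m → ℝ} {l : α → ℝ} (hβ : Measurable β)
    (hb : Measurable b) (hl : Measurable l) :
    Measurable fun x => eigenIntegrand F y (symOf (β x)) (b x) (l x) := by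
  have h1 := measurable_eigenIntegrand (m := m) hF y
  generalize hf : (fun p : (SymIdx m → ℝ) × (Fin m → ℝ) × ℝ =>
    _root_.eigenIntegrand F y (symOf p.1) p.2.1 p.2.2) = f at h1
  have h2 : Measurable fun x => f (β x, b x, l x) := h1.comp (hβ.prodMk (hb.prodMk hl))
  rw [← hf] at h2
  exact h2

/-- A root l determines the corner as a = l - b ⬝ w with w = (l - B)⁻¹ b. Integrating over a and
summing over the roots is thus integrating over l, and the area formula contributes the secular
derivative 1 + |w|². The three arguments of F carry the eigenvalue, the derivative there, and the
characteristic polynomial at a fixed point y. -/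
theorem lintegral_roots_bordered {F : ℝ × ℝ × ℝ → ℝ≥0∞} (hF : Measurable F) (y : ℝ)
    {B V : Matrix (Fin m) (Fin m) ℝ} {μ : Fin m → ℝ} (hV1 : Vᵀ * V = 1) (hV2 : V * Vᵀ = 1)
    (hB : B = V * Matrix.diagonal μ * Vᵀ) (hμ : Function.Injective μ) {b : Fin m → ℝ}
    (hb : ∀ i, (Vᵀ *ᵥ b) i ≠ 0) :
    ∫⁻ a, ∑ l ∈ (bordered B b a).charpoly.roots.toFinset,
        F (l, (bordered B b a).charpoly.derivative.eval l, (bordered B b a).charpoly.eval y)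
          ∂gaussianReal 0 1 =
      ∫⁻ l, eigenIntegrand F y B b l := by
  set s := secular μ (Vᵀ *ᵥ b) with hs
  have hsm : Measurable s := by
    rw [hs]; unfold secular; fun_prop
  have hdm : Measurable (secularDeriv μ (Vᵀ *ᵥ b)) := by
    unfold secularDeriv; fun_prop
  have hQ : Measurable fun l => B.charpoly.eval l := B.charpoly.continuous.measurable
  have hcb : Measurable fun a => (bordered B b a).charpoly.eval y := by
    have : Continuous fun a => bordered B b a := by
      refine continuous_matrix fun i j => ?_
      rcases i with i | i <;> rcases j with j | j <;> simp only [bordered,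
        Matrix.fromBlocks_apply₁₁, Matrix.fromBlocks_apply₁₂, Matrix.fromBlocks_apply₂₁,
        Matrix.fromBlocks_apply₂₂, Matrix.of_apply] <;> fun_prop
    exact (continuous_eval_charpoly.comp (this.prodMk continuous_const)).measurable
  set Ψ : ℝ → ℝ → ℝ≥0∞ := fun l a => gaussianPDF 0 1 a *
    F (l, B.charpoly.eval l * secularDeriv μ (Vᵀ *ᵥ b) l, (bordered B b a).charpoly.eval y) with hΨ
  have hmem := mem_roots_bordered_iff hV1 hV2 hB hμ hb
  rw [gaussianReal_of_var_ne_zero _ one_ne_zero,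
    lintegral_withDensity_eq_lintegral_mul_non_measurable _ (measurable_gaussianPDF 0 1)
      (ae_of_all _ fun _ => gaussianPDF_lt_top)]
  have h1 : ∀ a, (gaussianPDF 0 1 * fun a => ∑ l ∈ (bordered B b a).charpoly.roots.toFinset,
        F (l, (bordered B b a).charpoly.derivative.eval l, (bordered B b a).charpoly.eval y)) a =
      ∑ l ∈ (bordered B b a).charpoly.roots.toFinset, Ψ l a := by
    intro a
    rw [Pi.mul_apply, Finset.mul_sum]
    refine Finset.sum_congr rfl fun l hl => ?_
    rw [Multiset.mem_toFinset, hmem] at hl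
    rw [hΨ, ← hl.2]
    simp only
    rw [derivative_charpoly_bordered hV1 hV2 hB hl.1]
  rw [lintegral_congr h1, lintegral_sum_secular_level μ (Vᵀ *ᵥ b) _
    (fun a l => by rw [Multiset.mem_toFinset, hmem])]
  · refine lintegral_congr_ae ?_
    have hae : ∀ᵐ l : ℝ, l ∈ (Set.range μ)ᶜ :=
      compl_mem_ae_iff.mpr ((Set.finite_range μ).measure_zero _)
    filter_upwards [hae] with l hl
    have hl' : ∀ i, l ≠ μ i := fun i hi => hl ⟨i, hi.symm⟩
    have hdet : (shifted B l).det ≠ 0 := by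
      have := (eval_charpoly_ne_zero_iff hV1 hB l).mpr hl'
      rwa [Matrix.eval_charpoly] at this
    have hw : resolventVec B b l = V *ᵥ fun i => (Vᵀ *ᵥ b) i / (l - μ i) := by
      conv_lhs => rw [← shifted_mulVec_resolvent hV1 hV2 hB hl' b]
      rw [resolventVec_mulVec hdet]
    rw [eigenIntegrand, if_neg hdet, hw, resolvent_dotProduct_self hV1, dotProduct_resolvent, hΨ]
    simp only
    rw [Matrix.eval_charpoly]
    rfl
  · exact ((measurable_gaussianPDF 0 1).comp hsm).mul
      (hF.comp (measurable_id.prodMk ((hQ.mul hdm).prodMk (hcb.comp hsm))))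

theorem lintegral_goe_eq_eigenIntegrand {F : ℝ × ℝ × ℝ → ℝ≥0∞} (hF : Measurable F) (y : ℝ)
    {G : (SymIdx (m + 1) → ℝ) → ℝ≥0∞} (hG : Measurable G)
    (hGF : ∀ x, (symOf x).charpoly.roots.Nodup → G x = ∑ l ∈ (symOf x).charpoly.roots.toFinset,
      F (l, (symOf x).charpoly.derivative.eval l, (symOf x).charpoly.eval y)) :
    ∫⁻ x, G x ∂goeMeasure (m + 1) =
      ∫⁻ l, ∫⁻ β, ∫⁻ b, eigenIntegrand F y (symOf β) b l ∂halfGaussian m ∂goeMeasure m := by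
  have h1 : ∀ᵐ β ∂goeMeasure m,
      ∫⁻ b, ∫⁻ a, G (border (β, b, a)) ∂gaussianReal 0 1 ∂halfGaussian m =
        ∫⁻ l, ∫⁻ b, eigenIntegrand F y (symOf β) b l ∂halfGaussian m := by
    filter_upwards [ae_nodup_roots m] with β hβ
    have h3 : Measurable (Function.uncurry fun l b => eigenIntegrand F y (symOf β) b l) :=
      hF.eigenIntegrand y measurable_const measurable_snd measurable_fst
    rw [lintegral_lintegral_swap h3.aemeasurable]
    refine lintegral_congr_ae ?_
    obtain ⟨V, hV1, hV2, hB⟩ := exists_orthogonal_diagonalization (symOf_isHermitian β)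
    have hμ := injective_eigenvalues_of_nodup (symOf_isHermitian β) hβ
    filter_upwards [ae_mulVec_ne_zero hV1] with b hb
    rw [← lintegral_roots_bordered hF y hV1 hV2 hB hμ hb]
    refine lintegral_congr fun a => ?_
    rw [hGF, charpoly_symOf_border]
    rw [charpoly_symOf_border]
    exact nodup_roots_bordered hV1 hV2 hB hμ hb a
  have h2 : Measurable fun p : ((SymIdx m → ℝ) × ℝ) × (Fin m → ℝ) =>
      eigenIntegrand F y (symOf p.1.1) p.2 p.1.2 :=
    hF.eigenIntegrand y measurable_fst.fst measurable_snd measurable_fst.snd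
  rw [lintegral_goeMeasure_succ hG, lintegral_congr_ae h1,
    lintegral_lintegral_swap (h2.lintegral_prod_right' (ν := halfGaussian m)).aemeasurable]

/-! ### The substitution of the eigenvector for the bordering column. -/

theorem lintegral_comp_mulVec {C : Matrix (Fin m) (Fin m) ℝ} (hC : C.det ≠ 0)
    (f : (Fin m → ℝ) → ℝ≥0∞) :
    ∫⁻ b, f b = ENNReal.ofReal |C.det| * ∫⁻ w, f (C *ᵥ w) := by
  have h := Real.map_matrix_volume_pi_eq_smul_volume_pi hC
  have he : MeasurableEmbedding (Matrix.toLin' C) := by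
    have hcont : Continuous (Matrix.toLin' C) := LinearMap.continuous_of_finiteDimensional _
    refine hcont.measurableEmbedding ?_
    exact Matrix.mulVec_injective_iff_isUnit.mpr
      ((Matrix.isUnit_iff_isUnit_det C).mpr (isUnit_iff_ne_zero.mpr hC))
  have h2 : ∫⁻ w, f (C *ᵥ w) = ∫⁻ b, f b ∂(Measure.map (Matrix.toLin' C) volume) := by
    rw [he.lintegral_map]; rfl
  rw [h2, h, lintegral_smul_measure, smul_eq_mul, ← mul_assoc, ← ENNReal.ofReal_mul (abs_nonneg _),
    ← abs_mul, mul_inv_cancel₀ hC, abs_one, ENNReal.ofReal_one, one_mul]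

/-- The integrand after the substitution `b = (l - B) w`. -/
def eigenvecIntegrand (F : ℝ × ℝ × ℝ → ℝ≥0∞) (y : ℝ) (B : Matrix (Fin m) (Fin m) ℝ) (w : Fin m → ℝ)
    (l : ℝ) : ℝ≥0∞ :=
  ENNReal.ofReal (|(shifted B l).det| * (1 + w ⬝ᵥ w) *
      Real.exp (-((shifted B l *ᵥ w) ⬝ᵥ (shifted B l *ᵥ w))) *
      Real.exp (-((l - w ⬝ᵥ (shifted B l *ᵥ w)) ^ 2 / 2))) *
    F (l, (shifted B l).det * (1 + w ⬝ᵥ w),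
      (bordered B (shifted B l *ᵥ w) (l - w ⬝ᵥ (shifted B l *ᵥ w))).charpoly.eval y)

/-- The substitution b = (l - B) w has Jacobian |det (l - B)|. When the determinant vanishes both
sides are zero: the left by the convention in `eigenIntegrand`, the right through the factor |det (l
- B)|. -/
theorem lintegral_eigenIntegrand (F : ℝ × ℝ × ℝ → ℝ≥0∞) (y : ℝ) (B : Matrix (Fin m) (Fin m) ℝ)
    (l : ℝ) : ∫⁻ b, eigenIntegrand F y B b l ∂halfGaussian m =
      ENNReal.ofReal ((√Real.pi)⁻¹ ^ m * (√(2 * Real.pi))⁻¹) *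
        ∫⁻ w, eigenvecIntegrand F y B w l := by
  by_cases hd : (shifted B l).det = 0
  · simp [eigenIntegrand, eigenvecIntegrand, hd]
  · rw [lintegral_halfGaussian, lintegral_comp_mulVec hd,
      ENNReal.ofReal_mul (by positivity), mul_assoc,
      ← lintegral_const_mul' _ _ ENNReal.ofReal_ne_top]
    simp only [← lintegral_const_mul' _ _ ENNReal.ofReal_ne_top]
    refine lintegral_congr fun w => ?_
    congr 1
    have hww : 0 ≤ w ⬝ᵥ w := Finset.sum_nonneg fun i _ => mul_self_nonneg (w i)
    rw [eigenIntegrand, if_neg hd, resolventVec_mulVec hd, eigenvecIntegrand, gaussianPDF,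
      gaussianPDFReal, dotProduct_comm (shifted B l *ᵥ w) w]
    simp only [← mul_assoc]
    congr 1
    rw [← ENNReal.ofReal_mul (by positivity), ← ENNReal.ofReal_mul (by positivity),
      ← ENNReal.ofReal_mul (by positivity), ← ENNReal.ofReal_mul (by positivity)]
    congr 1
    simp only [NNReal.coe_one, mul_one, sub_zero, neg_div]
    ring

end Disintegration

/-! ### Congruence action on symmetric matrices -/

section Congruence

variable {m : ℕ}

theorem symOf_add (x y : SymIdx m → ℝ) : symOf (x + y) = symOf x + symOf y := by
  ext i j
  by_cases h : i ≤ j <;> simp [symOf, h]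

theorem symOf_smul (c : ℝ) (x : SymIdx m → ℝ) : symOf (c • x) = c • symOf x := by
  ext i j
  by_cases h : i ≤ j <;> simp [symOf, h]

theorem isSymm_congruence (S : Matrix (Fin m) (Fin m) ℝ) (x : SymIdx m → ℝ) :
    (S * symOf x * Sᵀ).IsSymm := by
  rw [Matrix.IsSymm, Matrix.transpose_mul, Matrix.transpose_mul, Matrix.transpose_transpose,
    (symOf_isSymm x).eq, Matrix.mul_assoc]

/-- The linear map `M ↦ S M Sᵀ` on symmetric matrices, in coordinates. -/
def congruence (S : Matrix (Fin m) (Fin m) ℝ) : (SymIdx m → ℝ) →ₗ[ℝ] (SymIdx m → ℝ) where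
  toFun x := symCoords (S * symOf x * Sᵀ)
  map_add' x y := by
    ext p
    simp [symCoords, symOf_add, Matrix.mul_add, Matrix.add_mul]
  map_smul' c x := by
    ext p
    simp [symCoords, symOf_smul]

theorem symOf_congruence (S : Matrix (Fin m) (Fin m) ℝ) (x : SymIdx m → ℝ) :
    symOf (congruence S x) = S * symOf x * Sᵀ :=
  symOf_symCoords (isSymm_congruence S x)

theorem congruence_mul (S T : Matrix (Fin m) (Fin m) ℝ) :
    congruence (S * T) = congruence S ∘ₗ congruence T := by
  refine LinearMap.ext fun x => ?_
  rw [LinearMap.comp_apply, ← symCoords_symOf (congruence (S * T) x),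
    ← symCoords_symOf (congruence S (congruence T x)), symOf_congruence, symOf_congruence,
    symOf_congruence, Matrix.transpose_mul]
  simp only [Matrix.mul_assoc]

theorem congruence_one : congruence (1 : Matrix (Fin m) (Fin m) ℝ) = LinearMap.id := by
  refine LinearMap.ext fun x => ?_
  rw [← symCoords_symOf (congruence 1 x), symOf_congruence]
  simp [symCoords_symOf]

/-- The factor dᵢ is picked up once for each j ≥ i and once for each j ≤ i, hence m + 1 times. -/
theorem prod_symIdx (d : Fin m → ℝ) :
    ∏ p : SymIdx m, d p.1.1 * d p.1.2 = (∏ i, d i) ^ (m + 1) := by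
  have h1 : ∏ p : SymIdx m, d p.1.1 * d p.1.2 =
      ∏ i, ∏ j, if i ≤ j then d i * d j else 1 := by
    rw [← Fintype.prod_prod_type' (f := fun i j => if i ≤ j then d i * d j else 1),
      ← Finset.prod_filter,
      Finset.prod_subtype (p := fun q : Fin m × Fin m => q.1 ≤ q.2) _ (by simp)]
  have h2 : ∀ i j : Fin m, (if i ≤ j then d i * d j else 1) =
      (if i ≤ j then d i else 1) * (if i ≤ j then d j else 1) := by
    intro i j; split_ifs <;> simp
  rw [h1]
  simp only [h2, Finset.prod_mul_distrib]
  rw [Finset.prod_comm (f := fun i j => if i ≤ j then d j else 1), ← Finset.prod_mul_distrib,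
    ← Finset.prod_pow]
  refine Finset.prod_congr rfl fun i _ => ?_
  rw [← Finset.prod_filter, ← Finset.prod_filter, Finset.prod_const, Finset.prod_const, ← pow_add]
  congr 1
  have h3 : (Finset.univ.filter fun j : Fin m => i ≤ j) = Finset.Ici i := by ext; simp
  have h4 : (Finset.univ.filter fun j : Fin m => j ≤ i) = Finset.Iic i := by ext; simp
  rw [h3, h4, Fin.card_Ici, Fin.card_Iic]
  omega

theorem det_congruence_diagonal (d : Fin m → ℝ) :
    LinearMap.det (congruence (Matrix.diagonal d)) = (∏ i, d i) ^ (m + 1) := by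
  have h : congruence (Matrix.diagonal d) = LinearMap.pi fun p : SymIdx m =>
      ((d p.1.1 * d p.1.2) • (LinearMap.id : ℝ →ₗ[ℝ] ℝ)) ∘ₗ LinearMap.proj p := by
    refine LinearMap.ext fun x => funext fun p => ?_
    simp only [congruence, LinearMap.coe_mk, AddHom.coe_mk, symCoords, Matrix.diagonal_transpose,
      Matrix.mul_diagonal, Matrix.diagonal_mul, symOf_apply_of_le x p.2, LinearMap.pi_apply,
      LinearMap.comp_apply, LinearMap.proj_apply, LinearMap.smul_apply, LinearMap.id_apply,
      smul_eq_mul]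
    ring
  rw [h, LinearMap.det_pi, ← prod_symIdx]
  simp

/-- Congruence is multiplicative, so diagonalising S reduces to the diagonal case: the contributions
of V and Vᵀ cancel, both for the congruence and for the matrix. -/
theorem det_congruence {S : Matrix (Fin m) (Fin m) ℝ} (hS : S.IsHermitian) :
    LinearMap.det (congruence S) = S.det ^ (m + 1) := by
  obtain ⟨V, hV1, hV2, h⟩ := exists_orthogonal_diagonalization hS
  have h1 : LinearMap.det (congruence V) * LinearMap.det (congruence Vᵀ) = 1 := by
    rw [← LinearMap.det_comp, ← congruence_mul, hV2, congruence_one, LinearMap.det_id]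
  have h2 : V.det * Vᵀ.det = 1 := by rw [← Matrix.det_mul, hV2, Matrix.det_one]
  conv_lhs => rw [h, congruence_mul, congruence_mul, LinearMap.det_comp, LinearMap.det_comp,
    det_congruence_diagonal]
  conv_rhs => rw [h, Matrix.det_mul, Matrix.det_mul, Matrix.det_diagonal]
  rw [mul_right_comm, h1, mul_right_comm V.det, h2, one_mul, one_mul]

/-! ### The compression orthogonal to the eigenvector. -/

/-- The square root of `1 + w wᵀ`. -/
def rankOneRoot (w : Fin m → ℝ) : Matrix (Fin m) (Fin m) ℝ :=
  1 + (1 + √(1 + w ⬝ᵥ w))⁻¹ • Matrix.vecMulVec w w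

theorem dotProduct_self_nonneg' (w : Fin m → ℝ) : 0 ≤ w ⬝ᵥ w :=
  Finset.sum_nonneg fun i _ => mul_self_nonneg (w i)

theorem rankOneRoot_transpose (w : Fin m → ℝ) : (rankOneRoot w)ᵀ = rankOneRoot w := by
  rw [rankOneRoot, Matrix.transpose_add, Matrix.transpose_one, Matrix.transpose_smul,
    Matrix.transpose_vecMulVec]

/-- The square of 1 + c w wᵀ has coefficient 2c + c²|w|² on w wᵀ. With |w|² = q² - 1, the choice c =
1/(1 + q) makes it equal to 1. -/
theorem rankOneRoot_mul_self (w : Fin m → ℝ) :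
    rankOneRoot w * rankOneRoot w = 1 + Matrix.vecMulVec w w := by
  have hw := dotProduct_self_nonneg' w
  set q := √(1 + w ⬝ᵥ w) with hq
  have hq2 : w ⬝ᵥ w = q ^ 2 - 1 := by rw [hq, Real.sq_sqrt (by linarith)]; ring
  have hq0 : 0 ≤ q := Real.sqrt_nonneg _
  have hW : Matrix.vecMulVec w w * Matrix.vecMulVec w w = (w ⬝ᵥ w) • Matrix.vecMulVec w w := by
    rw [Matrix.vecMulVec_mul_vecMulVec, Matrix.vecMulVec_smul]
  rw [rankOneRoot, ← hq, Matrix.mul_add, Matrix.add_mul, Matrix.add_mul, Matrix.one_mul,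
    Matrix.one_mul, Matrix.mul_one, Matrix.smul_mul, Matrix.mul_smul, hW, hq2, smul_smul, smul_smul,
    add_assoc, ← add_smul, ← add_smul]
  congr 1
  have : (1 + q)⁻¹ + ((1 + q)⁻¹ + (1 + q)⁻¹ * (1 + q)⁻¹ * (q ^ 2 - 1)) = 1 := by
    field_simp
    ring
  rw [this, one_smul]

theorem det_one_add_vecMulVec (w : Fin m → ℝ) (c : ℝ) :
    (1 + c • Matrix.vecMulVec w w).det = 1 + c * (w ⬝ᵥ w) := by
  have := Matrix.det_one_add_replicateCol_mul_replicateRow (ι := Unit) (c • w) w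
  rw [← Matrix.vecMulVec_eq, Matrix.smul_vecMulVec, dotProduct_smul, smul_eq_mul] at this
  exact this

theorem det_rankOneRoot (w : Fin m → ℝ) : (rankOneRoot w).det = √(1 + w ⬝ᵥ w) := by
  have hw := dotProduct_self_nonneg' w
  rw [rankOneRoot, det_one_add_vecMulVec]
  set q := √(1 + w ⬝ᵥ w) with hq
  have hq2 : w ⬝ᵥ w = q ^ 2 - 1 := by rw [hq, Real.sq_sqrt (by linarith)]; ring
  have hq0 : 0 ≤ q := Real.sqrt_nonneg _
  rw [hq2]
  field_simp
  ring

/-- The compression of the bordered matrix to the complement of the eigenvector `(w, 1)`. -/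
def compression (B : Matrix (Fin m) (Fin m) ℝ) (w : Fin m → ℝ) (l : ℝ) :
    Matrix (Fin m) (Fin m) ℝ :=
  Matrix.scalar (Fin m) l - rankOneRoot w * shifted B l * rankOneRoot w

theorem shifted_compression (B : Matrix (Fin m) (Fin m) ℝ) (w : Fin m → ℝ) (l : ℝ) :
    shifted (compression B w l) l = rankOneRoot w * shifted B l * rankOneRoot w := by
  simp [shifted, compression]

/-- The right side is also the derivative at l of the bordered characteristic polynomial, so the
compression remembers exactly the quantity on which the summand depends. -/
theorem eval_charpoly_compression_self (B : Matrix (Fin m) (Fin m) ℝ) (w : Fin m → ℝ) (l : ℝ) :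
    (compression B w l).charpoly.eval l = (shifted B l).det * (1 + w ⬝ᵥ w) := by
  have hw := dotProduct_self_nonneg' w
  rw [Matrix.eval_charpoly]
  change (shifted (compression B w l) l).det = _
  rw [shifted_compression, Matrix.det_mul, Matrix.det_mul, det_rankOneRoot]
  have := Real.mul_self_sqrt (show 0 ≤ 1 + w ⬝ᵥ w by linarith)
  linear_combination (shifted B l).det * this

/-- With K = l - B and N = [1 | -w], the bordered matrix A satisfies l - A = Nᵀ K N. Since N kills
(w, 1), that vector is an eigenvector for l. As N Nᵀ = S², the identity det(1 + XY) = det(1 + YX)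
transfers the rest of the spectrum to S K S. -/
theorem charpoly_bordered_eigen (B : Matrix (Fin m) (Fin m) ℝ) (hB : B.IsSymm) (w : Fin m → ℝ)
    (l : ℝ) : (bordered B (shifted B l *ᵥ w) (l - w ⬝ᵥ (shifted B l *ᵥ w))).charpoly =
      (X - C l) * (compression B w l).charpoly := by
  set K := shifted B l with hK
  have hKs : Kᵀ = K := by
    rw [hK, shifted, Matrix.transpose_sub, hB.eq]
    simp
  set N : Matrix (Fin m) (Fin m ⊕ Fin 1) ℝ :=
    Matrix.of fun k => Sum.elim (fun j => (1 : Matrix (Fin m) (Fin m) ℝ) k j) (fun _ => -w k) with hN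
  have hN1 : ∀ k j, N k (.inl j) = (1 : Matrix (Fin m) (Fin m) ℝ) k j := fun _ _ => rfl
  have hN2 : ∀ k j, N k (.inr j) = -w k := fun _ _ => rfl
  have hKN1 : ∀ k j, (K * N) k (.inl j) = K k j := by
    intro k j
    simp [Matrix.mul_apply, hN1, Matrix.one_apply]
  have hKN2 : ∀ k j, (K * N) k (.inr j) = -(K *ᵥ w) k := by
    intro k j
    simp [Matrix.mul_apply, hN2, Matrix.mulVec, dotProduct]
  have hA : bordered B (K *ᵥ w) (l - w ⬝ᵥ (K *ᵥ w)) =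
      Matrix.scalar (Fin m ⊕ Fin 1) l - Nᵀ * (K * N) := by
    ext (i | i) (j | j)
    · have : (Nᵀ * (K * N)) (.inl i) (.inl j) = K i j := by
        rw [Matrix.mul_apply]
        simp [hKN1, hN1, Matrix.one_apply]
      rw [Matrix.sub_apply, this, hK]
      simp [bordered, shifted, Matrix.diagonal_apply]
    · have : (Nᵀ * (K * N)) (.inl i) (.inr j) = -(K *ᵥ w) i := by
        rw [Matrix.mul_apply]
        simp [hKN2, hN1, Matrix.one_apply]
      rw [Matrix.sub_apply, this]
      simp [bordered]
    · have : (Nᵀ * (K * N)) (.inr i) (.inl j) = -(K *ᵥ w) j := by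
        rw [Matrix.mul_apply]
        simp only [Matrix.transpose_apply, hN2, hKN1]
        conv_rhs => rw [← hKs]
        simp only [Matrix.mulVec, dotProduct, Matrix.transpose_apply, ← Finset.sum_neg_distrib]
        exact Finset.sum_congr rfl fun k _ => by ring
      rw [Matrix.sub_apply, this]
      simp [bordered]
    · obtain rfl : i = j := Subsingleton.elim _ _
      have : (Nᵀ * (K * N)) (.inr i) (.inr i) = w ⬝ᵥ (K *ᵥ w) := by
        rw [Matrix.mul_apply]
        simp only [Matrix.transpose_apply, hN2, hKN2, dotProduct]
        exact Finset.sum_congr rfl fun k _ => by ring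
      rw [Matrix.sub_apply, this]
      simp [bordered]
  have hNN : N * Nᵀ = rankOneRoot w * rankOneRoot w := by
    rw [rankOneRoot_mul_self]
    ext i j
    rw [Matrix.mul_apply, Fintype.sum_sum_type]
    simp [hN1, hN2, Matrix.one_apply, Matrix.vecMulVec_apply]
  refine Polynomial.eq_of_infinite_eval_eq _ _
    (((Set.finite_singleton l).infinite_compl).mono fun y hy => ?_)
  have hδ : y - l ≠ 0 := sub_ne_zero.mpr hy
  -- For y ≠ l one may divide by y - l to bring both determinants to the form det(1 + ·). The
  -- dimensions m + 1 and m leave different powers of y - l, whose ratio is the linear factor split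
  -- off.
  have hscal : ∀ {ι : Type} [Fintype ι] [DecidableEq ι] (M : Matrix ι ι ℝ),
      (Matrix.scalar ι (y - l) + M).det =
        (y - l) ^ Fintype.card ι * (1 + (y - l)⁻¹ • M).det := by
    intro ι _ _ M
    rw [← Matrix.det_smul, smul_add, smul_smul, mul_inv_cancel₀ hδ, one_smul]
    congr 2
    rw [Matrix.scalar_apply, Matrix.smul_one_eq_diagonal]
  rw [Set.mem_ofPred_eq, Polynomial.eval_mul, Matrix.eval_charpoly, Matrix.eval_charpoly, hA,
    compression, ← hK, sub_sub_eq_add_sub, sub_sub_eq_add_sub, add_sub_right_comm,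
    add_sub_right_comm, ← map_sub, ← map_sub, hscal, hscal]
  have h1 : (1 + (y - l)⁻¹ • (Nᵀ * (K * N))).det =
      (1 + (y - l)⁻¹ • (rankOneRoot w * K * rankOneRoot w)).det := by
    rw [← Matrix.mul_smul, Matrix.det_one_add_mul_comm, Matrix.smul_mul, Matrix.mul_assoc, hNN,
      ← Matrix.mul_assoc, ← Matrix.mul_smul, Matrix.mul_smul, ← Matrix.smul_mul,
      Matrix.det_one_add_mul_comm, Matrix.mul_smul, Matrix.mul_assoc]
  rw [h1]
  simp [pow_succ]
  ring

theorem trace_vecMulVec_mul (K : Matrix (Fin m) (Fin m) ℝ) (w : Fin m → ℝ) :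
    (K * Matrix.vecMulVec w w).trace = w ⬝ᵥ (K *ᵥ w) := by
  rw [Matrix.mul_vecMulVec, Matrix.trace_vecMulVec, dotProduct_comm]

/-- Both sides are tr A²/2 for the bordered matrix A: the left computed from its blocks, the right
from its spectrum, which is l together with that of the compression. The proof expands everything in
K = l - B. This identity is what lets the Gaussian weights factor. -/
theorem trace_compression_sq (B : Matrix (Fin m) (Fin m) ℝ) (hB : B.IsSymm) (w : Fin m → ℝ)
    (l : ℝ) : (B * B).trace / 2 + (shifted B l *ᵥ w) ⬝ᵥ (shifted B l *ᵥ w) +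
        (l - w ⬝ᵥ (shifted B l *ᵥ w)) ^ 2 / 2 =
      l ^ 2 / 2 + (compression B w l * compression B w l).trace / 2 := by
  set K := shifted B l with hK
  have hKs : Kᵀ = K := by
    rw [hK, shifted, Matrix.transpose_sub, hB.eq]
    simp
  set W := Matrix.vecMulVec w w with hW
  set S := rankOneRoot w with hS
  have hSS : S * S = 1 + W := rankOneRoot_mul_self w
  have hsq : ∀ M : Matrix (Fin m) (Fin m) ℝ,
      ((Matrix.scalar (Fin m) l - M) * (Matrix.scalar (Fin m) l - M)).trace =
        m * l ^ 2 - 2 * l * M.trace + (M * M).trace := by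
    intro M
    have h1 : Matrix.scalar (Fin m) l = l • (1 : Matrix (Fin m) (Fin m) ℝ) := by
      rw [Matrix.scalar_apply, Matrix.smul_one_eq_diagonal]
    rw [h1, Matrix.sub_mul, Matrix.mul_sub, Matrix.mul_sub, Matrix.smul_mul, Matrix.one_mul,
      Matrix.smul_mul, Matrix.one_mul, Matrix.mul_smul, Matrix.mul_one]
    simp only [Matrix.trace_sub, Matrix.trace_smul, Matrix.trace_one, smul_eq_mul,
      Fintype.card_fin]
    ring
  have hBK : B = Matrix.scalar (Fin m) l - K := by simp [hK, shifted]
  have h1 : (B * B).trace = m * l ^ 2 - 2 * l * K.trace + (K * K).trace := by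
    conv_lhs => rw [hBK]
    exact hsq K
  have h2 : (S * K * S).trace = K.trace + w ⬝ᵥ (K *ᵥ w) := by
    rw [Matrix.trace_mul_comm, ← Matrix.mul_assoc, hSS, Matrix.trace_mul_comm, Matrix.mul_add,
      Matrix.mul_one, Matrix.trace_add, trace_vecMulVec_mul]
  have h3 : (S * K * S * (S * K * S)).trace =
      (K * K).trace + 2 * ((K *ᵥ w) ⬝ᵥ (K *ᵥ w)) + (w ⬝ᵥ (K *ᵥ w)) ^ 2 := by
    have e1 : (S * K * S * (S * K * S)).trace = (K * (1 + W) * (K * (1 + W))).trace := by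
      have h4 : S * K * S * (S * K * S) = S * (K * (S * S) * K * S) := by
        simp only [Matrix.mul_assoc]
      rw [h4, Matrix.trace_mul_comm, ← hSS]
      simp only [Matrix.mul_assoc]
    have e2 : (K * (K * W)).trace = (K *ᵥ w) ⬝ᵥ (K *ᵥ w) := by
      rw [← Matrix.mul_assoc, trace_vecMulVec_mul, ← Matrix.mulVec_mulVec,
        Matrix.dotProduct_mulVec, ← Matrix.mulVec_transpose, hKs]
    have e3 : (K * W * K).trace = (K *ᵥ w) ⬝ᵥ (K *ᵥ w) := by
      rw [Matrix.trace_mul_comm, e2]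
    have e4 : (K * W * (K * W)).trace = (w ⬝ᵥ (K *ᵥ w)) ^ 2 := by
      rw [hW, Matrix.mul_vecMulVec, Matrix.vecMulVec_mul_vecMulVec, Matrix.vecMulVec_smul,
        Matrix.trace_smul, Matrix.trace_vecMulVec, dotProduct_comm (K *ᵥ w) w, smul_eq_mul, sq]
    rw [e1]
    simp only [Matrix.mul_add, Matrix.add_mul, Matrix.mul_one, Matrix.trace_add, e2, e3, e4]
    ring
  rw [compression, ← hS, ← hK, hsq, h1, h2, h3]
  ring

/-- The part of the eigenvalue integrand that only involves the compression. -/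
def restIntegrand (F : ℝ × ℝ × ℝ → ℝ≥0∞) (y l : ℝ) (B : Matrix (Fin m) (Fin m) ℝ) : ℝ≥0∞ :=
  ENNReal.ofReal |B.charpoly.eval l| * F (l, B.charpoly.eval l, (y - l) * B.charpoly.eval y)

/-- The map from B to its compression is affine with linear part the congruence by S, whose
determinant is (det S)^(m+1). The translation part drops out by invariance of Lebesgue measure. -/
theorem lintegral_symOf_affine (Φ : (SymIdx m → ℝ) → ℝ≥0∞) (w : Fin m → ℝ) (l : ℝ) :
    ∫⁻ β, Φ (symCoords (compression (symOf β) w l)) =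
      ENNReal.ofReal ((√(1 + w ⬝ᵥ w) ^ (m + 1))⁻¹) * ∫⁻ β, Φ β := by
  have hw := dotProduct_self_nonneg' w
  have hpos : 0 < √(1 + w ⬝ᵥ w) := Real.sqrt_pos.mpr (by linarith)
  set S := rankOneRoot w with hS
  have hSt : Sᵀ = S := rankOneRoot_transpose w
  set c : SymIdx m → ℝ := symCoords (Matrix.scalar (Fin m) l - S * Matrix.scalar (Fin m) l * S)
  have haff : ∀ β, symCoords (compression (symOf β) w l) = congruence S β + c := by
    intro β
    have : compression (symOf β) w l = S * symOf β * Sᵀ +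
        (Matrix.scalar (Fin m) l - S * Matrix.scalar (Fin m) l * S) := by
      rw [compression, shifted, ← hS, hSt, Matrix.mul_sub, Matrix.sub_mul]
      abel
    rw [this]
    rfl
  have hdet : LinearMap.det (congruence S) = √(1 + w ⬝ᵥ w) ^ (m + 1) := by
    rw [det_congruence, det_rankOneRoot]
    rw [Matrix.IsHermitian, Matrix.conjTranspose_eq_transpose_of_trivial, hSt]
  have hdet0 : LinearMap.det (congruence S) ≠ 0 := by rw [hdet]; positivity
  have he : MeasurableEmbedding (congruence S) := by
    have hcont : Continuous (congruence S) := LinearMap.continuous_of_finiteDimensional _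
    refine hcont.measurableEmbedding ?_
    exact (LinearMap.equivOfDetNeZero _ hdet0).injective
  have h := Measure.map_linearMap_addHaar_eq_smul_addHaar (volume : Measure (SymIdx m → ℝ)) hdet0
  simp only [haff]
  have h2 : ∫⁻ β, Φ (congruence S β + c) = ∫⁻ β, Φ (β + c) ∂(Measure.map (congruence S) volume) := by
    rw [he.lintegral_map]
  rw [h2, h, lintegral_smul_measure, smul_eq_mul, lintegral_add_right_eq_self, hdet,
    abs_of_nonneg (by positivity)]

/-- After passing to the compression, |det (l - B)| (1 + |w|²) becomes the absolute characteristic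
polynomial at l and the exponents recombine. All remaining dependence on w sits in one scalar
factor. -/
theorem lintegral_eigenvecIntegrand (F : ℝ × ℝ × ℝ → ℝ≥0∞) (y : ℝ) (w : Fin m → ℝ) (l : ℝ) :
    ∫⁻ β, eigenvecIntegrand F y (symOf β) w l ∂goeMeasure m =
      ENNReal.ofReal (Real.exp (-(l ^ 2 / 2))) * (ENNReal.ofReal ((√(1 + w ⬝ᵥ w) ^ (m + 1))⁻¹) *
        ∫⁻ β, restIntegrand F y l (symOf β) ∂goeMeasure m) := by
  have hw := dotProduct_self_nonneg' w
  rw [lintegral_goeMeasure, lintegral_goeMeasure, mul_left_comm (ENNReal.ofReal (_)⁻¹),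
    mul_left_comm (ENNReal.ofReal (Real.exp _)), ← lintegral_symOf_affine _ w l]
  congr 1
  rw [← lintegral_const_mul' _ _ ENNReal.ofReal_ne_top]
  refine lintegral_congr fun β => ?_
  have hB := symOf_isSymm β
  have hcs : (compression (symOf β) w l).IsSymm := by
    have hKs : (shifted (symOf β) l)ᵀ = shifted (symOf β) l := by
      rw [shifted, Matrix.transpose_sub, hB.eq]
      simp
    rw [Matrix.IsSymm, compression, Matrix.transpose_sub, Matrix.transpose_mul,
      Matrix.transpose_mul, rankOneRoot_transpose, hKs, Matrix.mul_assoc]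
    simp
  rw [symOf_symCoords hcs, eigenvecIntegrand, restIntegrand, charpoly_bordered_eigen _ hB,
    eval_charpoly_compression_self, Polynomial.eval_mul, abs_mul,
    abs_of_nonneg (show 0 ≤ 1 + w ⬝ᵥ w by linarith)]
  simp only [Polynomial.eval_sub, Polynomial.eval_X, Polynomial.eval_C]
  rw [← mul_assoc, ← mul_assoc, ← mul_assoc, ← ENNReal.ofReal_mul (by positivity),
    ← ENNReal.ofReal_mul (by positivity), ← ENNReal.ofReal_mul (by positivity)]
  congr 2
  have key : Real.exp (-((symOf β * symOf β).trace / 2)) *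
      (Real.exp (-((shifted (symOf β) l *ᵥ w) ⬝ᵥ (shifted (symOf β) l *ᵥ w))) *
      Real.exp (-((l - w ⬝ᵥ (shifted (symOf β) l *ᵥ w)) ^ 2 / 2))) =
      Real.exp (-(l ^ 2 / 2)) *
      Real.exp (-((compression (symOf β) w l * compression (symOf β) w l).trace / 2)) := by
    rw [← Real.exp_add, ← Real.exp_add, ← Real.exp_add]
    congr 1
    have := trace_compression_sq (symOf β) hB w l
    linarith
  linear_combination (|(shifted (symOf β) l).det| * (1 + w ⬝ᵥ w)) * key

end Congruence

/-! ### The disintegration formula -/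

section DisintegrationFormula

variable {m : ℕ}

/-- The constant in the density of the mean eigenvalue distribution. -/
def goeCoeff (n : ℕ) : ℝ := (√2 * Real.Gamma ((n : ℝ) / 2))⁻¹

theorem goeCoeff_pos {n : ℕ} (hn : 0 < n) : 0 < goeCoeff n := by
  have : 0 < Real.Gamma ((n : ℝ) / 2) := Real.Gamma_pos_of_pos (by positivity)
  unfold goeCoeff; positivity

theorem lintegral_exp_neg_mul_dotProduct {t : ℝ} (ht : 0 < t) :
    ∫⁻ w : Fin m → ℝ, ENNReal.ofReal (Real.exp (-(t * (w ⬝ᵥ w)))) =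
      ENNReal.ofReal (√(Real.pi / t) ^ m) := by
  have h : ∀ w : Fin m → ℝ, Real.exp (-(t * (w ⬝ᵥ w))) = ∏ i, Real.exp (-t * w i ^ 2) := by
    intro w
    rw [← Real.exp_sum, dotProduct, Finset.mul_sum, ← Finset.sum_neg_distrib]
    congr 1
    exact Finset.sum_congr rfl fun i _ => by ring
  simp only [h]
  rw [← ofReal_integral_eq_lintegral_ofReal]
  · rw [integral_fintype_prod_volume_eq_prod fun (_ : Fin m) (x : ℝ) => Real.exp (-t * x ^ 2)]
    simp only [integral_gaussian, Finset.prod_const, Finset.card_univ, Fintype.card_fin]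
  · exact Integrable.fintype_prod (f := fun (_ : Fin m) (x : ℝ) => Real.exp (-t * x ^ 2))
      fun _ => integrable_exp_neg_mul_sq ht
  · exact ae_of_all _ fun w => Finset.prod_nonneg fun i _ => (Real.exp_pos _).le

theorem lintegral_rpow_mul_exp_neg {a r : ℝ} (ha : 0 < a) (hr : 0 < r) :
    ∫⁻ t in Set.Ioi (0 : ℝ), ENNReal.ofReal (t ^ (a - 1) * Real.exp (-(r * t))) =
      ENNReal.ofReal ((1 / r) ^ a * Real.Gamma a) := by
  rw [← Real.integral_rpow_mul_exp_neg_mul_Ioi ha hr, ← ofReal_integral_eq_lintegral_ofReal]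
  · by_contra hni
    have h := Real.integral_rpow_mul_exp_neg_mul_Ioi ha hr
    rw [integral_undef hni] at h
    have : 0 < (1 / r) ^ a * Real.Gamma a :=
      mul_pos (Real.rpow_pos_of_pos (by positivity) _) (Real.Gamma_pos_of_pos ha)
    linarith
  · refine (ae_restrict_iff' measurableSet_Ioi).mpr (ae_of_all _ fun t ht => ?_)
    exact mul_nonneg (Real.rpow_nonneg (le_of_lt ht) _) (Real.exp_pos _).le

/-- The power of 1 + |w|² is written as a Gamma integral of exp(-t(1 + |w|²)) with exponent a = (m +
1)/2. Tonelli leaves a Gaussian integral in w, and then an integral in t equal to Γ(1/2) = √π. -/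
theorem lintegral_sqrt_one_add_pow :
    ∫⁻ w : Fin m → ℝ, ENNReal.ofReal ((√(1 + w ⬝ᵥ w) ^ (m + 1))⁻¹) =
      ENNReal.ofReal (√Real.pi ^ (m + 1) / Real.Gamma (((m + 1 : ℕ) : ℝ) / 2)) := by
  set a : ℝ := ((m + 1 : ℕ) : ℝ) / 2 with ha
  have ha0 : 0 < a := by positivity
  have hG : 0 < Real.Gamma a := Real.Gamma_pos_of_pos ha0
  have h1 : ∀ w : Fin m → ℝ, ENNReal.ofReal ((√(1 + w ⬝ᵥ w) ^ (m + 1))⁻¹) =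
      ENNReal.ofReal (Real.Gamma a)⁻¹ * ∫⁻ t in Set.Ioi (0 : ℝ),
        ENNReal.ofReal (t ^ (a - 1) * Real.exp (-t)) *
          ENNReal.ofReal (Real.exp (-(t * (w ⬝ᵥ w)))) := by
    intro w
    have hw := dotProduct_self_nonneg' w
    have hr : 0 < 1 + w ⬝ᵥ w := by linarith
    have h2 : ∀ t : ℝ, t ∈ Set.Ioi (0 : ℝ) → ENNReal.ofReal (t ^ (a - 1) * Real.exp (-t)) *
          ENNReal.ofReal (Real.exp (-(t * (w ⬝ᵥ w)))) =
        ENNReal.ofReal (t ^ (a - 1) * Real.exp (-((1 + w ⬝ᵥ w) * t))) := by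
      intro t ht
      rw [← ENNReal.ofReal_mul (mul_nonneg (Real.rpow_nonneg (le_of_lt ht) _) (Real.exp_pos _).le),
        mul_assoc, ← Real.exp_add]
      congr 3
      ring
    rw [setLIntegral_congr_fun measurableSet_Ioi h2, lintegral_rpow_mul_exp_neg ha0 hr,
      ← ENNReal.ofReal_mul (by positivity)]
    congr 1
    rw [mul_comm, mul_assoc, mul_inv_cancel₀ hG.ne', mul_one, one_div, Real.inv_rpow hr.le, ha,
      Real.sqrt_eq_rpow, ← Real.rpow_natCast, ← Real.rpow_mul hr.le]
    congr 2
    ring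
  simp only [h1]
  rw [lintegral_const_mul' _ _ ENNReal.ofReal_ne_top, lintegral_lintegral_swap]
  · have h3 : ∀ t : ℝ, t ∈ Set.Ioi (0 : ℝ) → ∫⁻ w : Fin m → ℝ,
        ENNReal.ofReal (t ^ (a - 1) * Real.exp (-t)) *
          ENNReal.ofReal (Real.exp (-(t * (w ⬝ᵥ w)))) =
        ENNReal.ofReal (√Real.pi ^ m) *
          ENNReal.ofReal (t ^ ((1 / 2 : ℝ) - 1) * Real.exp (-(1 * t))) := by
      intro t ht
      have ht' : (0 : ℝ) < t := ht
      rw [lintegral_const_mul' _ _ ENNReal.ofReal_ne_top, lintegral_exp_neg_mul_dotProduct ht,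
        ← ENNReal.ofReal_mul (mul_nonneg (Real.rpow_nonneg ht'.le _) (Real.exp_pos _).le),
        ← ENNReal.ofReal_mul (by positivity), one_mul, Real.sqrt_div Real.pi_pos.le, div_pow]
      congr 1
      have h4 : t ^ (a - 1) = t ^ ((1 / 2 : ℝ) - 1) * √t ^ m := by
        rw [Real.sqrt_eq_rpow, ← Real.rpow_natCast, ← Real.rpow_mul ht'.le, ← Real.rpow_add ht', ha]
        congr 1
        push_cast
        ring
      have h5 : √t ^ m ≠ 0 := by positivity
      rw [h4]
      field_simp
    rw [setLIntegral_congr_fun measurableSet_Ioi h3, lintegral_const_mul' _ _ ENNReal.ofReal_ne_top,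
      lintegral_rpow_mul_exp_neg (by norm_num) one_pos, ← ENNReal.ofReal_mul (by positivity),
      ← ENNReal.ofReal_mul (by positivity), Real.Gamma_one_half_eq]
    congr 1
    simp only [div_one, Real.one_rpow, one_mul]
    rw [pow_succ]
    field_simp
  · refine Measurable.aemeasurable ?_
    have hd : Measurable fun p : (Fin m → ℝ) × ℝ => p.1 ⬝ᵥ p.1 :=
      measurable_dotProduct measurable_fst measurable_fst
    simp only [Function.uncurry_def]
    fun_prop

theorem measurable_eigenvecIntegrand {F : ℝ × ℝ × ℝ → ℝ≥0∞} (hF : Measurable F) (y l : ℝ) :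
    Measurable fun p : (SymIdx m → ℝ) × (Fin m → ℝ) => eigenvecIntegrand F y (symOf p.1) p.2 l := by
  have hs : Continuous fun p : (SymIdx m → ℝ) × (Fin m → ℝ) => shifted (symOf p.1) l :=
    continuous_const.sub (continuous_symOf.comp continuous_fst)
  have hd := hs.matrix_det.measurable
  have hv := (hs.matrix_mulVec continuous_snd).measurable
  have hw : Measurable fun p : (SymIdx m → ℝ) × (Fin m → ℝ) => p.2 := measurable_snd
  have hww := (measurable_dotProduct hw hw).const_add 1
  have hvv := measurable_dotProduct hv hv
  have hg := (measurable_dotProduct hw hv).const_sub l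
  have hc := measurable_eval_charpoly_bordered measurable_fst hv hg y
  have hF' := hF.comp ((measurable_const (a := l)).prodMk ((hd.mul hww).prodMk hc))
  have h1 := (((hd.norm.mul hww).mul (Real.measurable_exp.comp hvv.neg)).mul
    (Real.measurable_exp.comp ((hg.pow_const 2).div_const 2).neg)).ennreal_ofReal
  exact h1.mul hF'

/-- Integrating a sum over the eigenvalues of the normalised GOE of order `m + 1`: an eigenvalue
`l` splits off, leaving a GOE of order `m` weighted by its characteristic polynomial at `l`. -/
theorem lintegral_goe_sum_roots {F : ℝ × ℝ × ℝ → ℝ≥0∞} (hF : Measurable F) (y : ℝ)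
    {G : (SymIdx (m + 1) → ℝ) → ℝ≥0∞} (hG : Measurable G)
    (hGF : ∀ x, (symOf x).charpoly.roots.Nodup → G x = ∑ l ∈ (symOf x).charpoly.roots.toFinset,
      F (l, (symOf x).charpoly.derivative.eval l, (symOf x).charpoly.eval y)) :
    ∫⁻ x, G x ∂goeMeasure (m + 1) = ENNReal.ofReal (goeCoeff (m + 1)) *
      ∫⁻ l, ENNReal.ofReal (Real.exp (-(l ^ 2 / 2))) *
        ∫⁻ β, restIntegrand F y l (symOf β) ∂goeMeasure m := by
  have h1 : ∀ l, ∫⁻ β, (∫⁻ w, eigenvecIntegrand F y (symOf β) w l) ∂goeMeasure m =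
      ENNReal.ofReal (√Real.pi ^ (m + 1) / Real.Gamma (((m + 1 : ℕ) : ℝ) / 2)) *
        (ENNReal.ofReal (Real.exp (-(l ^ 2 / 2))) *
          ∫⁻ β, restIntegrand F y l (symOf β) ∂goeMeasure m) := by
    intro l
    rw [lintegral_lintegral_swap (measurable_eigenvecIntegrand hF y l).aemeasurable]
    simp only [lintegral_eigenvecIntegrand]
    rw [lintegral_const_mul' _ _ ENNReal.ofReal_ne_top, lintegral_mul_const,
      lintegral_sqrt_one_add_pow]
    · ring
    · have hd : Measurable fun w : Fin m → ℝ => w ⬝ᵥ w :=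
        measurable_dotProduct measurable_id measurable_id
      fun_prop
  rw [lintegral_goe_eq_eigenIntegrand hF y hG hGF]
  simp only [lintegral_eigenIntegrand]
  simp only [lintegral_const_mul' _ _ ENNReal.ofReal_ne_top, h1]
  rw [← mul_assoc, ← ENNReal.ofReal_mul (by positivity)]
  congr 2
  rw [goeCoeff, Real.sqrt_mul zero_le_two, pow_succ, inv_pow]
  have : √Real.pi ≠ 0 := by positivity
  field_simp

end DisintegrationFormula

/-! ### Gaussian integrals of polynomials -/

theorem integrable_polynomial_mul_exp_neg_sq (p : Polynomial ℝ) {c : ℝ} (hc : 0 < c) :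
    Integrable fun x : ℝ => p.eval x * Real.exp (-c * x ^ 2) := by
  have h : (fun x : ℝ => p.eval x * Real.exp (-c * x ^ 2)) = fun x =>
      ∑ k ∈ Finset.range (p.natDegree + 1), p.coeff k * (x ^ k * Real.exp (-c * x ^ 2)) := by
    funext x
    rw [Polynomial.eval_eq_sum_range, Finset.sum_mul]
    exact Finset.sum_congr rfl fun k _ => by ring
  rw [h]
  refine integrable_finsetSum _ fun k _ => Integrable.const_mul ?_ _
  have := integrable_rpow_mul_exp_neg_mul_sq hc
    (show (-1 : ℝ) < (k : ℝ) by have := Nat.cast_nonneg (α := ℝ) k; linarith)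
  simpa only [Real.rpow_natCast] using this

theorem integrable_polynomial_mul_exp (p : Polynomial ℝ) (r : ℝ) {c : ℝ} (hc : 0 < c) :
    Integrable fun x : ℝ => p.eval x * Real.exp (r * x - c * x ^ 2) := by
  have h := (integrable_polynomial_mul_exp_neg_sq (p.comp (X + C (r / (2 * c)))) hc).comp_sub_right
    (r / (2 * c))
  refine (h.const_mul (Real.exp (r ^ 2 / (4 * c)))).congr (ae_of_all _ fun x => ?_)
  simp only [Polynomial.eval_comp, Polynomial.eval_add, Polynomial.eval_X, Polynomial.eval_C,
    sub_add_cancel]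
  rw [mul_left_comm, ← Real.exp_add]
  congr 2
  field_simp
  ring

theorem integrable_pow_gaussianReal (v : ℝ≥0) (k : ℕ) :
    Integrable (fun x : ℝ => x ^ k) (gaussianReal 0 v) := by
  have h := (memLp_id_gaussianReal (μ := 0) (v := v) (k : ℝ≥0)).integrable_norm_pow'
  refine h.mono (by fun_prop) (ae_of_all _ fun x => ?_)
  simp

theorem integral_sq_gaussianReal (v : ℝ≥0) : ∫ x, x ^ 2 ∂gaussianReal 0 v = v := by
  have h := variance_id_gaussianReal (μ := 0) (v := v)
  rw [variance_of_integral_eq_zero (by fun_prop) (by simp)] at h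
  simpa using h

theorem integral_pow_four_gaussianReal_half : ∫ x, x ^ 4 ∂gaussianReal 0 (1 / 2) = 3 / 4 := by
  have hv : (1 / 2 : ℝ≥0) ≠ 0 := by simp
  have h2 := integral_sq_gaussianReal (1 / 2)
  have hpdf : ∀ x : ℝ, gaussianPDFReal 0 (1 / 2) x =
      (√Real.pi)⁻¹ * Real.exp (0 * x - 1 * x ^ 2) := by
    intro x
    rw [gaussianPDFReal]
    congr 3
    · push_cast; ring
    · push_cast; ring
  rw [integral_gaussianReal_eq_integral_smul hv] at h2 ⊢
  simp only [hpdf, smul_eq_mul] at h2 ⊢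
  have hi : ∀ k : ℕ, Integrable fun x : ℝ => x ^ k * Real.exp (0 * x - 1 * x ^ 2) := fun k => by
    simpa using integrable_polynomial_mul_exp (X ^ k) 0 one_pos
  -- Integrating this derivative to zero relates the moments by 3 E[x²] = 2 E[x⁴].
  have hd : ∀ x : ℝ, HasDerivAt (fun x : ℝ => x ^ 3 * Real.exp (0 * x - 1 * x ^ 2))
      (3 * (x ^ 2 * Real.exp (0 * x - 1 * x ^ 2)) - 2 * (x ^ 4 * Real.exp (0 * x - 1 * x ^ 2))) x := by
    intro x
    have h1 : HasDerivAt (fun x : ℝ => 0 * x - 1 * x ^ 2) (-(2 * x)) x := by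
      have := ((hasDerivAt_id x).const_mul 0).sub ((hasDerivAt_pow 2 x).const_mul 1)
      refine this.congr_deriv ?_
      simp
    refine ((hasDerivAt_pow 3 x).mul h1.exp).congr_deriv ?_
    push_cast
    ring
  have h0 := integral_eq_zero_of_hasDerivAt_of_integrable hd
    (((hi 2).const_mul 3).sub ((hi 4).const_mul 2)) (hi 3)
  rw [integral_sub ((hi 2).const_mul 3) ((hi 4).const_mul 2), integral_const_mul,
    integral_const_mul] at h0
  simp only [mul_assoc, integral_const_mul] at h2 ⊢
  have h2' : (√Real.pi)⁻¹ * ∫ x : ℝ, Real.exp (0 * x - 1 * x ^ 2) * x ^ 2 = 1 / 2 := by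
    rw [h2]; push_cast; ring
  simp only [mul_comm (Real.exp _)] at h2' ⊢
  linear_combination (3 / 2) * h2' - (√Real.pi)⁻¹ / 2 * h0

theorem integrable_mvPolynomial_gaussian {ι : Type*} [Fintype ι] (v : ι → ℝ≥0)
    (p : MvPolynomial ι ℝ) :
    Integrable (fun x => MvPolynomial.eval x p) (Measure.pi fun i => gaussianReal 0 (v i)) := by
  simp only [MvPolynomial.eval_eq']
  refine integrable_finsetSum _ fun d _ => Integrable.const_mul ?_ _
  exact Integrable.fintype_prod (f := fun i (x : ℝ) => x ^ d i)
    fun i => integrable_pow_gaussianReal (v i) (d i)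

theorem integral_sq_halfGaussian {m : ℕ} (i : Fin m) : ∫ c, c i ^ 2 ∂halfGaussian m = 1 / 2 := by
  have h := integral_comp_eval (μ := fun _ : Fin m => gaussianReal 0 (1 / 2)) (i := i)
    (f := fun x : ℝ => x ^ 2) (by fun_prop)
  rw [halfGaussian, h, integral_sq_gaussianReal]
  simp

theorem integral_sq_mul_sq_halfGaussian {m : ℕ} (i j : Fin m) :
    ∫ c, c i ^ 2 * c j ^ 2 ∂halfGaussian m = 1 / 4 + if i = j then 1 / 2 else 0 := by
  by_cases hij : i = j
  · subst hij
    have h := integral_comp_eval (μ := fun _ : Fin m => gaussianReal 0 (1 / 2)) (i := i)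
      (f := fun x : ℝ => x ^ 4) (by fun_prop)
    simp only [← pow_add]
    rw [halfGaussian, h, integral_pow_four_gaussianReal_half]
    norm_num
  · have h := (iIndepFun_pi (μ := fun _ : Fin m => gaussianReal 0 (1 / 2))
      (X := fun _ (x : ℝ) => x ^ 2) (fun _ => by fun_prop)).indepFun hij
    have h2 := h.integral_mul_eq_mul_integral
      ((measurable_pi_apply i).pow_const 2).aestronglyMeasurable
      ((measurable_pi_apply j).pow_const 2).aestronglyMeasurable
    simp only [Pi.mul_apply] at h2
    have h3 := integral_sq_halfGaussian i
    have h4 := integral_sq_halfGaussian j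
    rw [halfGaussian] at h3 h4 ⊢
    refine h2.trans ?_
    rw [h3, h4]
    simp [hij]
    norm_num

/-- An orthogonal matrix preserves both Lebesgue measure and |b|². The bordering column may
therefore be expressed in the eigenbasis of the leading block. -/
theorem measurePreserving_mulVec_halfGaussian {m : ℕ} {V : Matrix (Fin m) (Fin m) ℝ}
    (hV : Vᵀ * V = 1) :
    MeasurePreserving (fun b => Vᵀ *ᵥ b) (halfGaussian m) (halfGaussian m) := by
  have hm : Measurable fun b : Fin m → ℝ => Vᵀ *ᵥ b :=
    (continuous_const.matrix_mulVec continuous_id).measurable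
  have hdet : V.det * V.det = 1 := by
    have := congrArg Matrix.det hV
    rwa [Matrix.det_mul, Matrix.det_transpose, Matrix.det_one] at this
  have hd0 : V.det ≠ 0 := fun h => by rw [h] at hdet; simp at hdet
  have habs : |V.det| = 1 := by
    have h1 : |V.det| * |V.det| = 1 := by rw [← abs_mul, hdet, abs_one]
    nlinarith [abs_nonneg V.det]
  refine ⟨hm, Measure.ext_of_lintegral _ fun f hf => ?_⟩
  rw [lintegral_map hf hm, lintegral_halfGaussian, lintegral_halfGaussian,
    lintegral_comp_mulVec hd0, habs, ENNReal.ofReal_one, one_mul]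
  congr 1
  refine lintegral_congr fun b => ?_
  rw [Matrix.mulVec_mulVec, hV, Matrix.one_mulVec, Matrix.dotProduct_mulVec,
    ← Matrix.mulVec_transpose, Matrix.mulVec_mulVec, hV, Matrix.one_mulVec]

/-! ### Mean characteristic polynomials and their two-point function -/

section MeanCharpoly

variable {m : ℕ}

/-- Being polynomial in independent Gaussian entries makes the coefficients, and products of two of
them, integrable. The index map folds an entry below the diagonal onto its mirror image. -/
theorem exists_mvPolynomial_coeff (m k : ℕ) : ∃ q : MvPolynomial (SymIdx m) ℝ,
    ∀ β, (symOf β).charpoly.coeff k = MvPolynomial.eval β q := by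
  let idx : Fin m × Fin m → SymIdx m := fun q =>
    if h : q.1 ≤ q.2 then ⟨q, h⟩ else ⟨(q.2, q.1), (not_le.mp h).le⟩
  refine ⟨MvPolynomial.rename idx ((Matrix.charpoly.univ ℝ (Fin m)).coeff k), fun β => ?_⟩
  have hβ : Function.uncurry (symOf β) = β ∘ idx := by
    funext q
    by_cases h : q.1 ≤ q.2 <;> simp [symOf, idx, h, Function.uncurry]
  rw [MvPolynomial.eval_rename, ← hβ]
  have := Matrix.charpoly.univ_coeff_eval₂Hom (Fin m) (RingHom.id ℝ) (Function.uncurry (symOf β)) k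
  have hM : Matrix.of (Function.curry (Function.uncurry (symOf β))) = symOf β := rfl
  rw [hM] at this
  exact this.symm

theorem integrable_coeff (k : ℕ) :
    Integrable (fun β => (symOf β).charpoly.coeff k) (goeMeasure m) := by
  obtain ⟨p, hp⟩ := exists_mvPolynomial_coeff m k
  simp only [hp]
  exact integrable_mvPolynomial_gaussian _ p

theorem integrable_coeff_mul_coeff (j k : ℕ) :
    Integrable (fun β => (symOf β).charpoly.coeff j * (symOf β).charpoly.coeff k)
      (goeMeasure m) := by
  obtain ⟨p, hp⟩ := exists_mvPolynomial_coeff m j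
  obtain ⟨q, hq⟩ := exists_mvPolynomial_coeff m k
  simp only [hp, hq, ← map_mul]
  exact integrable_mvPolynomial_gaussian _ (p * q)

theorem integrable_eval_charpoly (x : ℝ) :
    Integrable (fun β => (symOf β).charpoly.eval x) (goeMeasure m) := by
  simp only [eval_charpoly_eq_sum]
  exact integrable_finsetSum _ fun k _ => (integrable_coeff k).mul_const _

/-- The integral of a linear combination of products of two coefficients. -/
theorem integral_coeff_bilinear (f g : ℕ → ℝ) (n : ℕ) :
    Integrable (fun β => (∑ j ∈ Finset.range n, (symOf β).charpoly.coeff j * f j) *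
        ∑ k ∈ Finset.range n, (symOf β).charpoly.coeff k * g k) (goeMeasure m) ∧
    ∫ β, (∑ j ∈ Finset.range n, (symOf β).charpoly.coeff j * f j) *
        (∑ k ∈ Finset.range n, (symOf β).charpoly.coeff k * g k) ∂goeMeasure m =
      ∑ j ∈ Finset.range n, ∑ k ∈ Finset.range n,
        (∫ β, (symOf β).charpoly.coeff j * (symOf β).charpoly.coeff k ∂goeMeasure m) *
          (f j * g k) := by
  have h : ∀ β : SymIdx m → ℝ, (∑ j ∈ Finset.range n, (symOf β).charpoly.coeff j * f j) *
        (∑ k ∈ Finset.range n, (symOf β).charpoly.coeff k * g k) =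
      ∑ j ∈ Finset.range n, ∑ k ∈ Finset.range n,
        (symOf β).charpoly.coeff j * (symOf β).charpoly.coeff k * (f j * g k) := by
    intro β
    rw [Finset.sum_mul_sum]
    exact Finset.sum_congr rfl fun j _ => Finset.sum_congr rfl fun k _ => by ring
  have hi : ∀ j k : ℕ, Integrable (fun β : SymIdx m → ℝ =>
      (symOf β).charpoly.coeff j * (symOf β).charpoly.coeff k * (f j * g k)) (goeMeasure m) :=
    fun j k => (integrable_coeff_mul_coeff j k).mul_const _
  simp only [h]
  refine ⟨integrable_finsetSum _ fun j _ => integrable_finsetSum _ fun k _ => hi j k, ?_⟩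
  rw [integral_finsetSum _ fun j _ => integrable_finsetSum _ fun k _ => hi j k]
  refine Finset.sum_congr rfl fun j _ => ?_
  rw [integral_finsetSum _ fun k _ => hi j k]
  exact Finset.sum_congr rfl fun k _ => integral_mul_const _ _

/-- The mean characteristic polynomial. -/
def meanChar (m : ℕ) (x : ℝ) : ℝ := ∫ β, (symOf β).charpoly.eval x ∂goeMeasure m

/-- The mean derivative of the characteristic polynomial. -/
def meanCharDeriv (m : ℕ) (x : ℝ) : ℝ := ∫ β, (symOf β).charpoly.derivative.eval x ∂goeMeasure m

/-- The two-point function of the characteristic polynomial. -/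
def charCorr (m : ℕ) (x y : ℝ) : ℝ :=
  ∫ β, (symOf β).charpoly.eval x * (symOf β).charpoly.eval y ∂goeMeasure m

/-- The first partial derivative of `charCorr`. -/
def charCorrX (m : ℕ) (x y : ℝ) : ℝ :=
  ∫ β, (symOf β).charpoly.derivative.eval x * (symOf β).charpoly.eval y ∂goeMeasure m

/-- The mixed second derivative of `charCorr`. -/
def charCorrXY (m : ℕ) (x y : ℝ) : ℝ :=
  ∫ β, (symOf β).charpoly.derivative.eval x * (symOf β).charpoly.derivative.eval y ∂goeMeasure m

theorem hasDerivAt_mul_pow (e : ℝ) (k : ℕ) (x : ℝ) :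
    HasDerivAt (fun x : ℝ => e * x ^ k) (e * (k * x ^ (k - 1))) x :=
  (hasDerivAt_pow k x).const_mul e

theorem integrable_eval_derivative_charpoly (x : ℝ) :
    Integrable (fun β => (symOf β).charpoly.derivative.eval x) (goeMeasure m) := by
  simp only [eval_derivative_charpoly_eq_sum]
  exact integrable_finsetSum _ fun k _ => (integrable_coeff k).mul_const _

theorem hasDerivAt_meanChar (x : ℝ) : HasDerivAt (meanChar m) (meanCharDeriv m x) x := by
  have h1 : meanChar m = fun x => ∑ k ∈ Finset.range (Fintype.card (Fin m) + 1),
      (∫ β, (symOf β).charpoly.coeff k ∂goeMeasure m) * x ^ k := by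
    funext x
    simp only [meanChar, eval_charpoly_eq_sum]
    rw [integral_finsetSum _ fun k _ => (integrable_coeff k).mul_const _]
    exact Finset.sum_congr rfl fun k _ => integral_mul_const _ _
  have h2 : meanCharDeriv m x = ∑ k ∈ Finset.range (Fintype.card (Fin m) + 1),
      (∫ β, (symOf β).charpoly.coeff k ∂goeMeasure m) * (k * x ^ (k - 1)) := by
    simp only [meanCharDeriv, eval_derivative_charpoly_eq_sum]
    rw [integral_finsetSum _ fun k _ => (integrable_coeff k).mul_const _]
    exact Finset.sum_congr rfl fun k _ => integral_mul_const _ _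
  rw [h1, h2]
  exact HasDerivAt.fun_sum fun k _ => hasDerivAt_mul_pow _ k x

theorem integrable_charCorr (x y : ℝ) : Integrable
    (fun β => (symOf β).charpoly.eval x * (symOf β).charpoly.eval y) (goeMeasure m) := by
  simp only [eval_charpoly_eq_sum]
  exact (integral_coeff_bilinear _ _ _).1

theorem integrable_charCorrX (x y : ℝ) : Integrable
    (fun β => (symOf β).charpoly.derivative.eval x * (symOf β).charpoly.eval y) (goeMeasure m) := by
  simp only [eval_charpoly_eq_sum, eval_derivative_charpoly_eq_sum]
  exact (integral_coeff_bilinear _ _ _).1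

theorem integrable_charCorrXY (x y : ℝ) : Integrable
    (fun β => (symOf β).charpoly.derivative.eval x * (symOf β).charpoly.derivative.eval y)
      (goeMeasure m) := by
  simp only [eval_derivative_charpoly_eq_sum]
  exact (integral_coeff_bilinear _ _ _).1

theorem charCorr_comm (x y : ℝ) : charCorr m x y = charCorr m y x := by
  simp only [charCorr, mul_comm]

theorem hasDerivAt_charCorr (x y : ℝ) :
    HasDerivAt (fun x => charCorr m x y) (charCorrX m x y) x := by
  simp only [charCorr, charCorrX, eval_charpoly_eq_sum, eval_derivative_charpoly_eq_sum,
    (integral_coeff_bilinear _ _ _).2]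
  refine HasDerivAt.fun_sum fun j _ => HasDerivAt.fun_sum fun k _ => ?_
  exact ((hasDerivAt_pow j x).mul_const _).const_mul _

theorem hasDerivAt_charCorrX (x y : ℝ) :
    HasDerivAt (fun y => charCorrX m x y) (charCorrXY m x y) y := by
  simp only [charCorrX, charCorrXY, eval_charpoly_eq_sum, eval_derivative_charpoly_eq_sum,
    (integral_coeff_bilinear _ _ _).2]
  refine HasDerivAt.fun_sum fun j _ => HasDerivAt.fun_sum fun k _ => ?_
  exact ((hasDerivAt_pow k y).const_mul _).const_mul _

end MeanCharpoly

/-! ### Recursion for the mean characteristic polynomial and the two-point function -/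

section Recursion

variable {m : ℕ}

theorem eval_charpoly_bordered_of_diagonalization {V B : Matrix (Fin m) (Fin m) ℝ} {μ : Fin m → ℝ}
    (hV1 : Vᵀ * V = 1) (hV2 : V * Vᵀ = 1) (hB : B = V * Matrix.diagonal μ * Vᵀ) (b : Fin m → ℝ)
    (a x : ℝ) :
    (bordered B b a).charpoly.eval x = B.charpoly.eval x * (x - a) -
      ∑ i, (Vᵀ *ᵥ b) i ^ 2 * ∏ j ∈ Finset.univ.erase i, (x - μ j) := by
  rw [charpoly_bordered_eq hV1 hV2 hB, charpoly_of_diagonalization hV1 hB]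
  simp [Polynomial.eval_prod, Polynomial.eval_finsetSum]

theorem eval_derivative_charpoly_of_diagonalization {V B : Matrix (Fin m) (Fin m) ℝ}
    {μ : Fin m → ℝ} (hV1 : Vᵀ * V = 1) (hB : B = V * Matrix.diagonal μ * Vᵀ) (x : ℝ) :
    B.charpoly.derivative.eval x = ∑ i, ∏ j ∈ Finset.univ.erase i, (x - μ j) := by
  rw [charpoly_of_diagonalization hV1 hB, Polynomial.derivative_prod_finset]
  simp [Polynomial.eval_prod, Polynomial.eval_finsetSum]

/-- Partial fractions for 1/((x - μᵢ)(y - μᵢ)), cleared of denominators. This is what closes the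
recursion for the two-point function: the variance of the quadratic form is expressed by the
polynomial and its derivative at x and y only. -/
theorem sum_prod_erase_mul_prod_erase (μ : Fin m → ℝ) (x y : ℝ) :
    (y - x) * ∑ i, (∏ j ∈ Finset.univ.erase i, (x - μ j)) * ∏ j ∈ Finset.univ.erase i, (y - μ j) =
      (∑ i, ∏ j ∈ Finset.univ.erase i, (x - μ j)) * ∏ j, (y - μ j) -
        (∏ j, (x - μ j)) * ∑ i, ∏ j ∈ Finset.univ.erase i, (y - μ j) := by
  rw [Finset.mul_sum, Finset.sum_mul, Finset.mul_sum, ← Finset.sum_sub_distrib]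
  refine Finset.sum_congr rfl fun i _ => ?_
  rw [← Finset.mul_prod_erase Finset.univ (fun j => x - μ j) (Finset.mem_univ i),
    ← Finset.mul_prod_erase Finset.univ (fun j => y - μ j) (Finset.mem_univ i)]
  ring

/-- The quadratic form `∑ cᵢ² pᵢ`. -/
theorem integrable_sq_form (p : Fin m → ℝ) :
    Integrable (fun c : Fin m → ℝ => ∑ i, c i ^ 2 * p i) (halfGaussian m) := by
  have h := integrable_mvPolynomial_gaussian (fun _ : Fin m => (1 / 2 : ℝ≥0))
    (∑ i, MvPolynomial.X i ^ 2 * MvPolynomial.C (p i))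
  simpa [halfGaussian] using h

theorem integrable_sq_form_mul (p q : Fin m → ℝ) :
    Integrable (fun c : Fin m → ℝ => (∑ i, c i ^ 2 * p i) * ∑ i, c i ^ 2 * q i)
      (halfGaussian m) := by
  have h := integrable_mvPolynomial_gaussian (fun _ : Fin m => (1 / 2 : ℝ≥0))
    ((∑ i, MvPolynomial.X i ^ 2 * MvPolynomial.C (p i)) *
      ∑ i, MvPolynomial.X i ^ 2 * MvPolynomial.C (q i))
  simpa [halfGaussian] using h

theorem integrable_sq_mul_sq_halfGaussian (i j : Fin m) :
    Integrable (fun c : Fin m → ℝ => c i ^ 2 * c j ^ 2) (halfGaussian m) := by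
  have h := integrable_mvPolynomial_gaussian (fun _ : Fin m => (1 / 2 : ℝ≥0))
    (MvPolynomial.X i ^ 2 * MvPolynomial.X j ^ 2)
  simpa [halfGaussian] using h

theorem integrable_sq_halfGaussian (i : Fin m) :
    Integrable (fun c : Fin m → ℝ => c i ^ 2) (halfGaussian m) := by
  have h := integrable_mvPolynomial_gaussian (fun _ : Fin m => (1 / 2 : ℝ≥0))
    (MvPolynomial.X i ^ 2)
  simpa [halfGaussian] using h

theorem integral_sq_form (p : Fin m → ℝ) :
    ∫ c, ∑ i, c i ^ 2 * p i ∂halfGaussian m = (∑ i, p i) / 2 := by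
  rw [integral_finsetSum _ fun i _ => (integrable_sq_halfGaussian i).mul_const _, Finset.sum_div]
  refine Finset.sum_congr rfl fun i _ => ?_
  rw [integral_mul_const, integral_sq_halfGaussian]
  ring

/-- The first term is the product of the means. The second is the covariance, where only equal
indices contribute, with variance 3/4 - 1/4 = 1/2. -/
theorem integral_sq_form_mul (p q : Fin m → ℝ) :
    ∫ c, (∑ i, c i ^ 2 * p i) * (∑ i, c i ^ 2 * q i) ∂halfGaussian m =
      (∑ i, p i) * (∑ i, q i) / 4 + (∑ i, p i * q i) / 2 := by
  have h : ∀ c : Fin m → ℝ, (∑ i, c i ^ 2 * p i) * (∑ i, c i ^ 2 * q i) =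
      ∑ i, ∑ j, c i ^ 2 * c j ^ 2 * (p i * q j) := by
    intro c
    rw [Finset.sum_mul_sum]
    exact Finset.sum_congr rfl fun _ _ => Finset.sum_congr rfl fun _ _ => by ring
  have hi : ∀ i j : Fin m, Integrable (fun c : Fin m → ℝ => c i ^ 2 * c j ^ 2 * (p i * q j))
      (halfGaussian m) := fun i j => (integrable_sq_mul_sq_halfGaussian i j).mul_const _
  simp only [h]
  rw [integral_finsetSum _ fun i _ => integrable_finsetSum _ fun j _ => hi i j]
  simp only [integral_finsetSum _ fun j _ => hi _ j, integral_mul_const,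
    integral_sq_mul_sq_halfGaussian, add_mul, Finset.sum_add_distrib, ite_mul, zero_mul,
    Finset.sum_ite_eq, Finset.mem_univ, if_true]
  rw [Finset.sum_mul_sum, Finset.sum_div, Finset.sum_div]
  congr 1
  · refine Finset.sum_congr rfl fun i _ => ?_
    rw [Finset.sum_div]
    exact Finset.sum_congr rfl fun j _ => by ring
  · exact Finset.sum_congr rfl fun j _ => by ring

theorem integral_sub_gaussian (x : ℝ) : ∫ a, (x - a) ∂gaussianReal 0 1 = x := by
  have h1 : Integrable (fun a : ℝ => a) (gaussianReal 0 1) := by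
    simpa using integrable_pow_gaussianReal 1 1
  rw [integral_sub (integrable_const _) h1]
  simp

theorem integrable_sub_gaussian (x : ℝ) : Integrable (fun a => x - a) (gaussianReal 0 1) := by
  have h1 : Integrable (fun a : ℝ => a) (gaussianReal 0 1) := by
    simpa using integrable_pow_gaussianReal 1 1
  exact (integrable_const _).sub h1

theorem integral_sub_mul_sub_gaussian (x y : ℝ) :
    Integrable (fun a => (x - a) * (y - a)) (gaussianReal 0 1) ∧
    ∫ a, (x - a) * (y - a) ∂gaussianReal 0 1 = x * y + 1 := by
  have h1 : Integrable (fun a : ℝ => a) (gaussianReal 0 1) := by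
    simpa using integrable_pow_gaussianReal 1 1
  have h2 := integrable_pow_gaussianReal 1 2
  have h : (fun a : ℝ => (x - a) * (y - a)) = fun a => x * y - (x + y) * a + a ^ 2 := by
    funext a; ring
  have h3 : Integrable (fun a : ℝ => x * y - (x + y) * a) (gaussianReal 0 1) :=
    (integrable_const _).sub (h1.const_mul _)
  rw [h]
  refine ⟨h3.add h2, ?_⟩
  rw [integral_add h3 h2, integral_sub (integrable_const _) (h1.const_mul _), integral_const_mul,
    integral_sq_gaussianReal, integral_const_mul]
  simp

theorem integral_comp_of_measurePreserving {α β : Type*} [MeasurableSpace α]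
    [MeasurableSpace β] {μ : Measure α} {ν : Measure β} {g : α → β} (hg : MeasurePreserving g μ ν)
    {f : β → ℝ} (hf : Measurable f) {F : α → ℝ} (hF : ∀ x, F x = f (g x)) :
    ∫ x, F x ∂μ = ∫ y, f y ∂ν := by
  simp only [hF]
  rw [← hg.map_eq, integral_map hg.measurable.aemeasurable hf.aestronglyMeasurable]

theorem integral_eval_charpoly_bordered {B : Matrix (Fin m) (Fin m) ℝ} (hH : B.IsHermitian)
    (x : ℝ) :
    ∫ z : (Fin m → ℝ) × ℝ, (bordered B z.1 z.2).charpoly.eval x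
        ∂(halfGaussian m).prod (gaussianReal 0 1) =
      x * B.charpoly.eval x - B.charpoly.derivative.eval x / 2 := by
  obtain ⟨V, hV1, hV2, hB⟩ := exists_orthogonal_diagonalization hH
  set μ := hH.eigenvalues
  set p : Fin m → ℝ := fun i => ∏ j ∈ Finset.univ.erase i, (x - μ j) with hp
  have hmp := (measurePreserving_mulVec_halfGaussian hV1).prod
    (MeasurePreserving.id (gaussianReal 0 1))
  refine (integral_comp_of_measurePreserving hmp (f := fun w : (Fin m → ℝ) × ℝ =>
      B.charpoly.eval x * (x - w.2) - ∑ i, w.1 i ^ 2 * p i)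
    ?_ ?_).trans ?_
  · fun_prop
  · exact fun z => eval_charpoly_bordered_of_diagonalization hV1 hV2 hB z.1 z.2 x
  have i1 : Integrable (fun w : (Fin m → ℝ) × ℝ => B.charpoly.eval x * (x - w.2))
      ((halfGaussian m).prod (gaussianReal 0 1)) :=
    ((integrable_sub_gaussian x).const_mul _).comp_snd _
  have i2 : Integrable (fun w : (Fin m → ℝ) × ℝ => ∑ i, w.1 i ^ 2 * p i)
      ((halfGaussian m).prod (gaussianReal 0 1)) := (integrable_sq_form p).comp_fst _
  rw [integral_sub i1 i2, integral_fun_snd (fun a => B.charpoly.eval x * (x - a)),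
    integral_fun_fst (fun c : Fin m → ℝ => ∑ i, c i ^ 2 * p i), integral_sq_form,
    integral_const_mul, integral_sub_gaussian,
    eval_derivative_charpoly_of_diagonalization hV1 hB]
  simp [hp]
  ring

/-- In the eigenbasis of B the bordered polynomial is α(x - a) minus a quadratic form in independent
variables. The product is expanded and integrated term by term; the diagonal part of the fourth
moments produces the divided difference with denominator y - x. -/
theorem integral_eval_charpoly_bordered_mul {B : Matrix (Fin m) (Fin m) ℝ} (hH : B.IsHermitian)
    {x y : ℝ} (hxy : y ≠ x) :
    ∫ z : (Fin m → ℝ) × ℝ, (bordered B z.1 z.2).charpoly.eval x *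
        (bordered B z.1 z.2).charpoly.eval y ∂(halfGaussian m).prod (gaussianReal 0 1) =
      (x * y + 1) * (B.charpoly.eval x * B.charpoly.eval y)
      - x / 2 * (B.charpoly.derivative.eval y * B.charpoly.eval x)
      - y / 2 * (B.charpoly.derivative.eval x * B.charpoly.eval y)
      + 1 / 4 * (B.charpoly.derivative.eval x * B.charpoly.derivative.eval y)
      + (1 / (2 * (y - x)) * (B.charpoly.derivative.eval x * B.charpoly.eval y)
        - 1 / (2 * (y - x)) * (B.charpoly.derivative.eval y * B.charpoly.eval x)) := by
  obtain ⟨V, hV1, hV2, hB⟩ := exists_orthogonal_diagonalization hH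
  set μ := hH.eigenvalues
  set p : Fin m → ℝ := fun i => ∏ j ∈ Finset.univ.erase i, (x - μ j) with hp
  set q : Fin m → ℝ := fun i => ∏ j ∈ Finset.univ.erase i, (y - μ j) with hq
  set α := B.charpoly.eval x
  set γ := B.charpoly.eval y
  have hmp := (measurePreserving_mulVec_halfGaussian hV1).prod
    (MeasurePreserving.id (gaussianReal 0 1))
  refine (integral_comp_of_measurePreserving hmp (f := fun w : (Fin m → ℝ) × ℝ =>
          1 * (α * γ * ((x - w.2) * (y - w.2)))
          - (∑ i, w.1 i ^ 2 * q i) * (α * (x - w.2)) - (∑ i, w.1 i ^ 2 * p i) * (γ * (y - w.2))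
          + (∑ i, w.1 i ^ 2 * p i) * (∑ i, w.1 i ^ 2 * q i) * 1)
    ?_ ?_).trans ?_
  · fun_prop
  · intro z
    rw [eval_charpoly_bordered_of_diagonalization hV1 hV2 hB,
      eval_charpoly_bordered_of_diagonalization hV1 hV2 hB]
    simp only [Prod.map_fst, Prod.map_snd, id]
    ring
  obtain ⟨j1, e1⟩ := integral_sub_mul_sub_gaussian x y
  have i1 := Integrable.mul_prod (integrable_const (1 : ℝ) (μ := halfGaussian m))
    (j1.const_mul (α * γ))
  have i2 := Integrable.mul_prod (integrable_sq_form q) ((integrable_sub_gaussian x).const_mul α)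
  have i3 := Integrable.mul_prod (integrable_sq_form p) ((integrable_sub_gaussian y).const_mul γ)
  have i4 := Integrable.mul_prod (integrable_sq_form_mul p q)
    (integrable_const (1 : ℝ) (μ := gaussianReal 0 1))
  have a1 : Integrable (fun w : (Fin m → ℝ) × ℝ => 1 * (α * γ * ((x - w.2) * (y - w.2)))
      - (∑ i, w.1 i ^ 2 * q i) * (α * (x - w.2))) ((halfGaussian m).prod (gaussianReal 0 1)) :=
    i1.sub i2
  have a2 : Integrable (fun w : (Fin m → ℝ) × ℝ => 1 * (α * γ * ((x - w.2) * (y - w.2)))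
      - (∑ i, w.1 i ^ 2 * q i) * (α * (x - w.2)) - (∑ i, w.1 i ^ 2 * p i) * (γ * (y - w.2)))
      ((halfGaussian m).prod (gaussianReal 0 1)) := a1.sub i3
  rw [integral_add a2 i4, integral_sub a1 i3, integral_sub i1 i2,
    integral_prod_mul (fun _ => (1 : ℝ)) (fun a => α * γ * ((x - a) * (y - a))),
    integral_prod_mul (fun c : Fin m → ℝ => ∑ i, c i ^ 2 * q i) (fun a => α * (x - a)),
    integral_prod_mul (fun c : Fin m → ℝ => ∑ i, c i ^ 2 * p i) (fun a => γ * (y - a)),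
    integral_prod_mul (fun c : Fin m → ℝ => (∑ i, c i ^ 2 * p i) * (∑ i, c i ^ 2 * q i))
      (fun _ => (1 : ℝ)), integral_sq_form, integral_sq_form, integral_sq_form_mul,
    integral_const_mul, integral_const_mul, integral_const_mul, integral_sub_gaussian,
    integral_sub_gaussian, e1]
  have hd := sum_prod_erase_mul_prod_erase μ x y
  have hα : α = ∏ j, (x - μ j) := by
    simp only [α, charpoly_of_diagonalization hV1 hB, Polynomial.eval_prod]
    simp
  have hγ : γ = ∏ j, (y - μ j) := by
    simp only [γ, charpoly_of_diagonalization hV1 hB, Polynomial.eval_prod]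
    simp
  rw [eval_derivative_charpoly_of_diagonalization hV1 hB,
    eval_derivative_charpoly_of_diagonalization hV1 hB]
  rw [← hα, ← hγ] at hd
  have hyx : y - x ≠ 0 := sub_ne_zero.mpr hxy
  have hd' : ∑ i, p i * q i = ((∑ i, p i) * γ - α * ∑ i, q i) / (y - x) := by
    rw [eq_div_iff hyx, mul_comm, ← hd]
  rw [hd']
  simp only [integral_const, probReal_univ, smul_eq_mul]
  field_simp
  ring

theorem integral_goeMeasure_succ {f : (SymIdx (m + 1) → ℝ) → ℝ}
    (hf : Integrable f (goeMeasure (m + 1))) :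
    ∫ x, f x ∂goeMeasure (m + 1) = ∫ β, ∫ z : (Fin m → ℝ) × ℝ, f (border (β, z.1, z.2))
      ∂(halfGaussian m).prod (gaussianReal 0 1) ∂goeMeasure m := by
  have h := measurePreserving_border m
  have hf' := hf
  rw [← h.map_eq] at hf'
  rw [← h.map_eq, integral_map h.measurable.aemeasurable hf'.1]
  exact integral_prod _ ((integrable_map_measure hf'.1 h.measurable.aemeasurable).mp hf')

theorem meanChar_succ (x : ℝ) :
    meanChar (m + 1) x = x * meanChar m x - meanCharDeriv m x / 2 := by
  rw [meanChar, integral_goeMeasure_succ (integrable_eval_charpoly x)]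
  simp only [charpoly_symOf_border, integral_eval_charpoly_bordered (symOf_isHermitian _)]
  rw [integral_sub ((integrable_eval_charpoly x).const_mul _)
    ((integrable_eval_derivative_charpoly x).div_const _), integral_const_mul, integral_div]
  rfl

theorem integral_linear_combination {α : Type*} [MeasurableSpace α] {μ : Measure α}
    {f₀ f₁ f₂ f₃ f₄ f₅ : α → ℝ} (h₀ : Integrable f₀ μ) (h₁ : Integrable f₁ μ) (h₂ : Integrable f₂ μ)
    (h₃ : Integrable f₃ μ) (h₄ : Integrable f₄ μ) (h₅ : Integrable f₅ μ) :
    ∫ x, (f₀ x - f₁ x - f₂ x + f₃ x + (f₄ x - f₅ x)) ∂μ = ∫ x, f₀ x ∂μ - ∫ x, f₁ x ∂μ -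
      ∫ x, f₂ x ∂μ + ∫ x, f₃ x ∂μ + (∫ x, f₄ x ∂μ - ∫ x, f₅ x ∂μ) := by
  have a₁ : Integrable (fun x => f₀ x - f₁ x) μ := h₀.sub h₁
  have a₂ : Integrable (fun x => f₀ x - f₁ x - f₂ x) μ := a₁.sub h₂
  have a₃ : Integrable (fun x => f₀ x - f₁ x - f₂ x + f₃ x) μ := a₂.add h₃
  have a₄ : Integrable (fun x => f₄ x - f₅ x) μ := h₄.sub h₅
  rw [integral_add a₃ a₄, integral_add a₂ h₃, integral_sub a₁ h₂, integral_sub h₀ h₁,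
    integral_sub h₄ h₅]

theorem charCorr_succ {x y : ℝ} (hxy : y ≠ x) :
    charCorr (m + 1) x y = (x * y + 1) * charCorr m x y - x / 2 * charCorrX m y x
      - y / 2 * charCorrX m x y + 1 / 4 * charCorrXY m x y
      + (1 / (2 * (y - x)) * charCorrX m x y - 1 / (2 * (y - x)) * charCorrX m y x) := by
  rw [charCorr, integral_goeMeasure_succ (integrable_charCorr x y)]
  simp only [charpoly_symOf_border, integral_eval_charpoly_bordered_mul (symOf_isHermitian _) hxy]
  have i0 := (integrable_charCorr (m := m) x y).const_mul (x * y + 1)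
  have i1 := (integrable_charCorrX (m := m) y x).const_mul (x / 2)
  have i2 := (integrable_charCorrX (m := m) x y).const_mul (y / 2)
  have i3 := (integrable_charCorrXY (m := m) x y).const_mul (1 / 4)
  have i4 := (integrable_charCorrX (m := m) x y).const_mul (1 / (2 * (y - x)))
  have i5 := (integrable_charCorrX (m := m) y x).const_mul (1 / (2 * (y - x)))
  rw [integral_linear_combination i0 i1 i2 i3 i4 i5]
  simp only [integral_const_mul]
  rfl

end Recursion

/-! ### Hermite polynomials on the real line -/

/-- The value of the Hermite polynomial `Hₖ` at a real number. -/
def hermR (k : ℕ) (x : ℝ) : ℝ := Polynomial.aeval x (hermitePoly k)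

theorem derivative_hermitePoly_succ (k : ℕ) :
    (hermitePoly (k + 1)).derivative = (2 * (k + 1) : ℤ) • hermitePoly k := by
  induction k with
  | zero => simp [hermitePoly]
  | succ k ih =>
    rw [hermitePoly, Polynomial.derivative_sub, Polynomial.derivative_mul, ih]
    rw [Polynomial.derivative_smul]
    have h : hermitePoly (k + 1) = 2 * X * hermitePoly k - (hermitePoly k).derivative := rfl
    have h' : (hermitePoly k).derivative = 2 * X * hermitePoly k - hermitePoly (k + 1) := by
      rw [h]; ring
    rw [h']
    have h2 : (2 * X : Polynomial ℤ).derivative = 2 := by simp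
    rw [h2]
    simp only [zsmul_eq_mul]
    push_cast
    ring

theorem hermitePoly_succ_succ (k : ℕ) :
    hermitePoly (k + 2) = 2 * X * hermitePoly (k + 1) - (2 * (k + 1) : ℤ) • hermitePoly k := by
  rw [hermitePoly, derivative_hermitePoly_succ]

@[simp] theorem hermR_zero (x : ℝ) : hermR 0 x = 1 := by simp [hermR, hermitePoly]

theorem hermR_one (x : ℝ) : hermR 1 x = 2 * x := by simp [hermR, hermitePoly, map_ofNat]

theorem hermR_succ_succ (k : ℕ) (x : ℝ) :
    hermR (k + 2) x = 2 * x * hermR (k + 1) x - 2 * (k + 1) * hermR k x := by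
  simp [hermR, hermitePoly_succ_succ, Polynomial.aeval_def]

theorem hasDerivAt_hermR_succ (k : ℕ) (x : ℝ) :
    HasDerivAt (hermR (k + 1)) (2 * (k + 1) * hermR k x) x := by
  refine (Polynomial.hasDerivAt_aeval (hermitePoly (k + 1)) x).congr_deriv ?_
  simp [derivative_hermitePoly_succ, hermR, Polynomial.aeval_def]

theorem hasDerivAt_hermR (k : ℕ) (x : ℝ) :
    HasDerivAt (hermR k) (2 * x * hermR k x - hermR (k + 1) x) x := by
  refine (Polynomial.hasDerivAt_aeval (hermitePoly k) x).congr_deriv ?_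
  simp only [hermitePoly, hermR, map_sub, map_mul, Polynomial.aeval_X, map_ofNat]
  ring

/-- `Hₖ` as a real polynomial. -/
theorem hermR_eq_eval (k : ℕ) (x : ℝ) :
    hermR k x = ((hermitePoly k).map (Int.castRingHom ℝ)).eval x := by
  rw [hermR, Polynomial.aeval_def, Polynomial.eval_map]
  rfl

/-! ### Closed forms for the moments of the characteristic polynomial -/

/-- The bordering recursion x f - f'/2 is, up to the factor 2, the recursion defining the Hermite
polynomials. -/
theorem meanChar_eq (m : ℕ) (x : ℝ) : meanChar m x = hermR m x / 2 ^ m := by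
  induction m generalizing x with
  | zero => simp [meanChar]
  | succ m ih =>
    have h : meanCharDeriv m x = (2 * x * hermR m x - hermR (m + 1) x) / 2 ^ m := by
      refine (hasDerivAt_meanChar x).unique ?_
      rw [funext ih]
      exact (hasDerivAt_hermR m x).div_const _
    rw [meanChar_succ, ih, h]
    field_simp
    ring

/-- The antisymmetric polynomial in the closed form of the two-point function. -/
def charCorrNum (m : ℕ) (x y : ℝ) : ℝ :=
  (hermR (m + 2) x * hermR (m + 1) y - hermR (m + 1) x * hermR (m + 2) y) +
    (x - y) * (y * hermR (m + 2) x * hermR (m + 1) y + x * hermR (m + 1) x * hermR (m + 2) y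
      - hermR (m + 2) x * hermR (m + 2) y - 2 * (m + 2) * hermR (m + 1) x * hermR (m + 1) y)

/-- Induction on the order. The recursion for the next two-point function involves the first partial
derivatives and the mixed one; all are obtained by differentiating the induction hypothesis. Hermite
derivatives stay within H_{m+1} and H_{m+2}, so a polynomial identity in x, y and four Hermite
values remains. -/
theorem charCorr_eq (m : ℕ) (x y : ℝ) :
    4 ^ (m + 1) * (m + 1) * (x - y) ^ 3 * charCorr m x y = charCorrNum m x y := by
  induction m generalizing x y with
  | zero =>
    simp only [charCorr, charCorrNum, hermR_succ_succ, hermR_one, hermR_zero, zero_add]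
    simp
    ring
  | succ m ih =>
    -- The recursion divides by y - x; on the diagonal both sides of the claim vanish.
    rcases eq_or_ne y x with hxy | hxy
    · subst hxy
      simp [charCorrNum]
      ring
    have hD : x - y ≠ 0 := sub_ne_zero.mpr hxy.symm
    set K : ℝ := 4 ^ (m + 1) * (m + 1) with hK
    set u := hermR (m + 2) x with hu
    set u1 := hermR (m + 1) x with hu1
    set v := hermR (m + 2) y with hv
    set v1 := hermR (m + 1) y with hv1
    have hu' : ∀ x, HasDerivAt (hermR (m + 2)) (2 * (m + 2) * hermR (m + 1) x) x := fun x =>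
      (hasDerivAt_hermR_succ (m + 1) x).congr_deriv (by push_cast; ring)
    have hu1' : ∀ x, HasDerivAt (hermR (m + 1)) (2 * x * hermR (m + 1) x - hermR (m + 2) x) x :=
      fun x => hasDerivAt_hermR (m + 1) x
    have hx : ∀ x y, K * (3 * (x - y) ^ 2 * charCorr m x y + (x - y) ^ 3 * charCorrX m x y) =
        (2 * (m + 2) * hermR (m + 1) x * hermR (m + 1) y
          - (2 * x * hermR (m + 1) x - hermR (m + 2) x) * hermR (m + 2) y) +
        (y * hermR (m + 2) x * hermR (m + 1) y + x * hermR (m + 1) x * hermR (m + 2) y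
          - hermR (m + 2) x * hermR (m + 2) y - 2 * (m + 2) * hermR (m + 1) x * hermR (m + 1) y) +
        (x - y) * (y * (2 * (m + 2) * hermR (m + 1) x) * hermR (m + 1) y
          + hermR (m + 1) x * hermR (m + 2) y
          + x * (2 * x * hermR (m + 1) x - hermR (m + 2) x) * hermR (m + 2) y
          - 2 * (m + 2) * hermR (m + 1) x * hermR (m + 2) y
          - 2 * (m + 2) * (2 * x * hermR (m + 1) x - hermR (m + 2) x) * hermR (m + 1) y) := by
      intro x y
      have h1 : HasDerivAt (fun x => K * (x - y) ^ 3 * charCorr m x y)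
          (K * (3 * (x - y) ^ 2 * charCorr m x y + (x - y) ^ 3 * charCorrX m x y)) x := by
        refine (((((hasDerivAt_id x).sub_const y).pow 3).const_mul K).mul
          (hasDerivAt_charCorr x y)).congr_deriv ?_
        simp
        ring
      refine h1.unique ?_
      rw [funext fun x => ih x y]
      have hE := (((((hu' x).const_mul y).mul_const (hermR (m + 1) y)).add
        (((hasDerivAt_id x).mul (hu1' x)).mul_const (hermR (m + 2) y))).sub
        ((hu' x).mul_const (hermR (m + 2) y))).sub
        (((hu1' x).const_mul (2 * ((m : ℝ) + 2))).mul_const (hermR (m + 1) y))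
      refine ((((hu' x).mul_const (hermR (m + 1) y)).sub ((hu1' x).mul_const (hermR (m + 2) y))).add
        (((hasDerivAt_id x).sub_const y).mul hE)).congr_deriv ?_
      simp
      ring
    have hy : ∀ x y, HasDerivAt (fun y => charCorr m x y) (charCorrX m y x) y := fun x y => by
      rw [funext fun y => charCorr_comm x y]
      exact hasDerivAt_charCorr y x
    have hxy' : K * (-(6 * (x - y)) * charCorr m x y + 3 * (x - y) ^ 2 * charCorrX m y x
          - 3 * (x - y) ^ 2 * charCorrX m x y + (x - y) ^ 3 * charCorrXY m x y) =
        2 * (m + 2) * u1 * (2 * y * v1 - v) - (2 * x * u1 - u) * (2 * (m + 2) * v1) +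
        (u * v1 + y * u * (2 * y * v1 - v) + x * u1 * (2 * (m + 2) * v1) - u * (2 * (m + 2) * v1)
          - 2 * (m + 2) * u1 * (2 * y * v1 - v)) -
        (y * (2 * (m + 2) * u1) * v1 + u1 * v + x * (2 * x * u1 - u) * v - 2 * (m + 2) * u1 * v
          - 2 * (m + 2) * (2 * x * u1 - u) * v1) +
        (x - y) * (2 * (m + 2) * u1 * v1 + y * (2 * (m + 2) * u1) * (2 * y * v1 - v)
          + u1 * (2 * (m + 2) * v1) + x * (2 * x * u1 - u) * (2 * (m + 2) * v1)
          - 2 * (m + 2) * u1 * (2 * (m + 2) * v1)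
          - 2 * (m + 2) * (2 * x * u1 - u) * (2 * y * v1 - v)) := by
      have hd := (hasDerivAt_id y).const_sub x
      have h1 : HasDerivAt
          (fun y => K * (3 * (x - y) ^ 2 * charCorr m x y + (x - y) ^ 3 * charCorrX m x y))
          (K * (-(6 * (x - y)) * charCorr m x y + 3 * (x - y) ^ 2 * charCorrX m y x
          - 3 * (x - y) ^ 2 * charCorrX m x y + (x - y) ^ 3 * charCorrXY m x y)) y := by
        refine (((((hd.pow 2).const_mul 3).mul (hy x y)).add
          ((hd.pow 3).mul (hasDerivAt_charCorrX x y))).const_mul K).congr_deriv ?_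
        simp [-mul_eq_mul_left_iff]
        ring
      refine h1.unique ?_
      rw [funext fun y => hx x y]
      have e1 : HasDerivAt (fun y => 2 * (m + 2) * u1 * hermR (m + 1) y
          - (2 * x * u1 - u) * hermR (m + 2) y)
          (2 * (m + 2) * u1 * (2 * y * v1 - v) - (2 * x * u1 - u) * (2 * (m + 2) * v1)) y :=
        ((hu1' y).const_mul _).sub ((hu' y).const_mul _)
      have e2 : HasDerivAt (fun y => y * u * hermR (m + 1) y + x * u1 * hermR (m + 2) y
          - u * hermR (m + 2) y - 2 * (m + 2) * u1 * hermR (m + 1) y)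
          (1 * u * v1 + y * u * (2 * y * v1 - v) + x * u1 * (2 * (m + 2) * v1)
            - u * (2 * (m + 2) * v1) - 2 * (m + 2) * u1 * (2 * y * v1 - v)) y :=
        (((((hasDerivAt_id y).mul_const u).mul (hu1' y)).add ((hu' y).const_mul _)).sub
          ((hu' y).const_mul _)).sub ((hu1' y).const_mul _)
      have e3 : HasDerivAt (fun y => y * (2 * (m + 2) * u1) * hermR (m + 1) y
          + u1 * hermR (m + 2) y + x * (2 * x * u1 - u) * hermR (m + 2) y
          - 2 * (m + 2) * u1 * hermR (m + 2) y
          - 2 * (m + 2) * (2 * x * u1 - u) * hermR (m + 1) y)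
          (1 * (2 * (m + 2) * u1) * v1 + y * (2 * (m + 2) * u1) * (2 * y * v1 - v)
            + u1 * (2 * (m + 2) * v1) + x * (2 * x * u1 - u) * (2 * (m + 2) * v1)
            - 2 * (m + 2) * u1 * (2 * (m + 2) * v1)
            - 2 * (m + 2) * (2 * x * u1 - u) * (2 * y * v1 - v)) y :=
        ((((((hasDerivAt_id y).mul_const _).mul (hu1' y)).add ((hu' y).const_mul _)).add
          ((hu' y).const_mul _)).sub ((hu' y).const_mul _)).sub ((hu1' y).const_mul _)
      refine ((e1.add e2).add (hd.mul e3)).congr_deriv ?_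
      simp
      ring
    have hX := hx x y
    have hY := hx y x
    have h0 := ih x y
    rw [← hu, ← hu1, ← hv, ← hv1] at hX hY
    rw [charCorrNum, ← hu, ← hu1, ← hv, ← hv1] at h0
    rw [charCorr_comm y x] at hY
    have hu3 : hermR (m + 1 + 2) x = 2 * x * u - 2 * (m + 2) * u1 := by
      rw [hermR_succ_succ]; push_cast; ring
    have hv3 : hermR (m + 1 + 2) y = 2 * y * v - 2 * (m + 2) * v1 := by
      rw [hermR_succ_succ]; push_cast; ring
    have hu2 : hermR (m + 1 + 1) x = u := rfl
    have hv2 : hermR (m + 1 + 1) y = v := rfl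
    rw [charCorrNum, hu3, hv3, hu2, hv2, charCorr_succ hxy]
    set Q := charCorr m x y
    set Qx := charCorrX m x y
    set Qy := charCorrX m y x
    set Qxy := charCorrXY m x y
    clear_value u u1 v v1 Q Qx Qy Qxy
    have hm : (m : ℝ) + 1 ≠ 0 := by positivity
    have hyx : y - x ≠ 0 := sub_ne_zero.mpr hxy
    have hD2 : ((m : ℝ) + 1) * (x - y) ^ 2 ≠ 0 := mul_ne_zero hm (pow_ne_zero 2 hD)
    have hinv : 1 / (2 * (y - x)) * (x - y) = -(1 / 2) := by field_simp; ring
    -- The induction hypothesis controls (x - y)³ Q. Each differentiation costs one more factor x -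
    -- y, so the mixed derivative needs (x - y)⁵. The factor 4(m + 2) turns K into m + 1 times the
    -- constant of the next order; the surplus (m + 1)(x - y)² is cancelled afterwards.
    have key : (x - y) ^ 5 * K * ((x * y + 1) * Q - x / 2 * Qy - y / 2 * Qx + 1 / 4 * Qxy
        + (1 / (2 * (y - x)) * Qx - 1 / (2 * (y - x)) * Qy)) * (4 * (m + 2)) =
        ((m : ℝ) + 1) * (x - y) ^ 2 * ((2 * x * u - 2 * (m + 2) * u1) * v - u * (2 * y * v - 2 * (m + 2) * v1)
          + (x - y) * (y * (2 * x * u - 2 * (m + 2) * u1) * v + x * u * (2 * y * v - 2 * (m + 2) * v1)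
            - (2 * x * u - 2 * (m + 2) * u1) * (2 * y * v - 2 * (m + 2) * v1)
            - 2 * (m + 3) * u * v)) := by
      linear_combination (4 * (m + 2)) * ((x * y + 1) * (x - y) ^ 2 * h0
        - x / 2 * (-(x - y) * hY + 3 * h0) * (x - y)
        - y / 2 * ((x - y) * hX - 3 * h0) * (x - y)
        + 1 / 4 * ((x - y) ^ 2 * hxy' - 3 * (x - y) * (-hY) + 3 * (x - y) * hX - 12 * h0)
        - 1 / 2 * ((x - y) * hX + (x - y) * hY - 6 * h0)
        + (x - y) ^ 4 * K * (Qx - Qy) * hinv)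
    refine mul_left_cancel₀ hD2 ?_
    push_cast
    rw [hK] at key
    refine Eq.trans ?_ (key.trans ?_) <;> ring

/-! ### Expected absolute value of the characteristic polynomial -/

/-- The absolute value of a product of linear factors through the signs of its derivative at the
zeros. -/
theorem abs_prod_sub_eq (S : Finset ℝ) (y : ℝ) :
    |∏ s ∈ S, (y - s)| = (-1) ^ S.card * ∏ s ∈ S, (y - s) +
      2 * ∑ s ∈ S, (if s < y then
        (SignType.sign (∏ t ∈ S.erase s, (s - t)) : ℝ) * ∏ t ∈ S, (y - t) else 0) := by
  induction S using Finset.induction_on_max with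
  | empty => simp
  | insert M S hM ih =>
    have hMS : M ∉ S := fun h => lt_irrefl _ (hM M h)
    -- A new largest zero M adds a negative factor s - M to the derivative at each earlier zero,
    -- flipping every sign, while the derivative at M itself is positive.
    have h1 : ∀ s ∈ S, (SignType.sign (∏ t ∈ (insert M S).erase s, (s - t)) : ℝ) =
        -(SignType.sign (∏ t ∈ S.erase s, (s - t)) : ℝ) := by
      intro s hs
      have hne : M ≠ s := (hM s hs).ne'
      rw [Finset.erase_insert_of_ne hne, Finset.prod_insert fun h => hMS (Finset.mem_of_mem_erase h),
        sign_mul, sign_neg (sub_neg.mpr (hM s hs))]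
      simp
    have h2 : (SignType.sign (∏ t ∈ (insert M S).erase M, (M - t)) : ℝ) = 1 := by
      rw [Finset.erase_insert hMS, sign_pos (Finset.prod_pos fun t ht => sub_pos.mpr (hM t ht))]
      simp
    rw [Finset.sum_insert hMS, Finset.card_insert_of_notMem hMS, Finset.prod_insert hMS, h2]
    have h3 : ∑ s ∈ S, (if s < y then
        (SignType.sign (∏ t ∈ (insert M S).erase s, (s - t)) : ℝ) *
          ((y - M) * ∏ t ∈ S, (y - t)) else 0) = -(y - M) * ∑ s ∈ S, (if s < y then
        (SignType.sign (∏ t ∈ S.erase s, (s - t)) : ℝ) * ∏ t ∈ S, (y - t) else 0) := by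
      rw [Finset.mul_sum]
      refine Finset.sum_congr rfl fun s hs => ?_
      rw [h1 s hs]
      split_ifs <;> ring
    rw [h3, abs_mul]
    by_cases hy : M < y
    · have hp : 0 < ∏ s ∈ S, (y - s) :=
        Finset.prod_pos fun s hs => sub_pos.mpr ((hM s hs).trans hy)
      rw [if_pos hy, abs_of_pos (sub_pos.mpr hy), abs_of_pos hp]
      rw [abs_of_pos hp] at ih
      rw [pow_succ]
      linear_combination (-(y - M)) * ih
    · rw [if_neg hy, abs_of_nonpos (sub_nonpos.mpr (not_lt.mp hy)), ih, pow_succ]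
      ring

theorem coe_sign_eq_div_abs (u : ℝ) : (SignType.sign u : ℝ) = u / |u| := by
  rcases lt_trichotomy u 0 with h | h | h
  · rw [sign_neg h, abs_of_neg h, div_neg, div_self h.ne]; simp
  · simp [h]
  · rw [sign_pos h, abs_of_pos h, div_self h.ne']; simp

section AbsCharpoly

variable {m : ℕ}

theorem eq_prod_roots_toFinset {B : Matrix (Fin m) (Fin m) ℝ} (hB : B.IsHermitian)
    (h : B.charpoly.roots.Nodup) :
    B.charpoly = ∏ s ∈ B.charpoly.roots.toFinset, (X - C s) ∧
      B.charpoly.roots.toFinset.card = m := by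
  have hs := hB.splits_charpoly
  have h1 := hs.eq_prod_roots_of_monic B.charpoly_monic
  constructor
  · rw [Finset.prod, Multiset.toFinset_val, h.dedup]
    exact h1
  · rw [Multiset.toFinset_card_of_nodup h, ← hs.natDegree_eq_card_roots,
      Matrix.charpoly_natDegree_eq_dim, Fintype.card_fin]

theorem sum_sign_derivative_mul_eval {B : Matrix (Fin m) (Fin m) ℝ} (hB : B.IsHermitian)
    (h : B.charpoly.roots.Nodup) (y : ℝ) :
    ∑ l ∈ B.charpoly.roots.toFinset, (if l < y then
      B.charpoly.derivative.eval l / |B.charpoly.derivative.eval l| * B.charpoly.eval y else 0) =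
      (|B.charpoly.eval y| - (-1) ^ m * B.charpoly.eval y) / 2 := by
  obtain ⟨h1, h2⟩ := eq_prod_roots_toFinset hB h
  set S := B.charpoly.roots.toFinset
  have e1 : B.charpoly.eval y = ∏ s ∈ S, (y - s) := by
    rw [h1, Polynomial.eval_prod]; simp
  have e2 : ∀ l ∈ S, B.charpoly.derivative.eval l = ∏ t ∈ S.erase l, (l - t) := by
    intro l hl
    rw [h1, Polynomial.derivative_prod_finset, Polynomial.eval_finsetSum,
      Finset.sum_eq_single_of_mem l hl]
    · simp [Polynomial.eval_prod]
    · intro b _ hbl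
      simp only [Polynomial.derivative_sub, Polynomial.derivative_X, Polynomial.derivative_C,
        sub_zero, mul_one, Polynomial.eval_prod]
      exact Finset.prod_eq_zero (Finset.mem_erase.mpr ⟨hbl.symm, hl⟩) (by simp)
  have h3 := abs_prod_sub_eq S y
  simp only [coe_sign_eq_div_abs] at h3
  rw [h2, ← e1] at h3
  rw [h3, Finset.sum_congr rfl fun l hl => by rw [e2 l hl]]
  ring

theorem continuous_eval_charpoly_symOf :
    Continuous fun p : ℝ × (SymIdx m → ℝ) => (symOf p.2).charpoly.eval p.1 :=
  continuous_eval_charpoly.comp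
    ((continuous_symOf.comp continuous_snd).prodMk continuous_fst)

theorem measurable_eval_charpoly_symOf (y : ℝ) :
    Measurable fun x : SymIdx m → ℝ => (symOf x).charpoly.eval y :=
  (continuous_eval_charpoly_symOf.comp (continuous_const.prodMk continuous_id)).measurable

theorem measurable_rest {f : ℝ × ℝ × ℝ → ℝ} (hf : Measurable f) (y : ℝ) :
    Measurable fun p : ℝ × (SymIdx m → ℝ) => Real.exp (-(p.1 ^ 2 / 2)) *
        (|(symOf p.2).charpoly.eval p.1| * f (p.1, (symOf p.2).charpoly.eval p.1,
          (y - p.1) * (symOf p.2).charpoly.eval y)) := by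
  have hm1 : Measurable fun p : ℝ × (SymIdx m → ℝ) => (symOf p.2).charpoly.eval p.1 :=
    continuous_eval_charpoly_symOf.measurable
  have hm2 : Measurable fun p : ℝ × (SymIdx m → ℝ) => (symOf p.2).charpoly.eval y :=
    (measurable_eval_charpoly_symOf y).comp measurable_snd
  have hm3 : Measurable fun p : ℝ × (SymIdx m → ℝ) => f (p.1, (symOf p.2).charpoly.eval p.1,
          (y - p.1) * (symOf p.2).charpoly.eval y) :=
    hf.comp (measurable_fst.prodMk (hm1.prodMk ((measurable_fst.const_sub y).mul hm2)))
  have hm4 : Measurable fun p : ℝ × (SymIdx m → ℝ) => Real.exp (-(p.1 ^ 2 / 2)) :=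
    (by fun_prop : Measurable fun l : ℝ => Real.exp (-(l ^ 2 / 2))).comp measurable_fst
  have hm5 : Measurable fun p : ℝ × (SymIdx m → ℝ) => |(symOf p.2).charpoly.eval p.1| :=
    hm1.norm
  exact hm4.mul (hm5.mul hm3)

/-- The disintegration formula for real-valued functions. -/
theorem lintegral_goe_sum_roots_ofReal {f : ℝ × ℝ × ℝ → ℝ} (hf : Measurable f) (hf0 : ∀ p, 0 ≤ f p)
    (y : ℝ) {g : (SymIdx (m + 1) → ℝ) → ℝ} (hg : Measurable g)
    (hgf : ∀ x, (symOf x).charpoly.roots.Nodup → g x = ∑ l ∈ (symOf x).charpoly.roots.toFinset,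
      f (l, (symOf x).charpoly.derivative.eval l, (symOf x).charpoly.eval y)) :
    ∫⁻ x, ENNReal.ofReal (g x) ∂goeMeasure (m + 1) = ENNReal.ofReal (goeCoeff (m + 1)) *
      ∫⁻ p : ℝ × (SymIdx m → ℝ), ENNReal.ofReal (Real.exp (-(p.1 ^ 2 / 2)) *
        (|(symOf p.2).charpoly.eval p.1| * f (p.1, (symOf p.2).charpoly.eval p.1,
          (y - p.1) * (symOf p.2).charpoly.eval y))) ∂volume.prod (goeMeasure m) := by
  have hm := measurable_rest (m := m) hf y
  rw [lintegral_prod _ (hm.ennreal_ofReal.aemeasurable),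
    lintegral_goe_sum_roots (F := fun p => ENNReal.ofReal (f p)) hf.ennreal_ofReal y
      hg.ennreal_ofReal fun x hx => by rw [hgf x hx, ENNReal.ofReal_sum_of_nonneg fun _ _ => hf0 _]]
  congr 1
  refine lintegral_congr fun l => ?_
  rw [← lintegral_const_mul' _ _ ENNReal.ofReal_ne_top]
  refine lintegral_congr fun β => ?_
  rw [restIntegrand, ← ENNReal.ofReal_mul (abs_nonneg _), ← ENNReal.ofReal_mul (Real.exp_pos _).le]

theorem integral_goe_sum_roots {f : ℝ × ℝ × ℝ → ℝ} (hf : Measurable f) (hf0 : ∀ p, 0 ≤ f p)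
    (y : ℝ) {g : (SymIdx (m + 1) → ℝ) → ℝ} (hg : Measurable g) (hg0 : ∀ x, 0 ≤ g x)
    (hgi : Integrable g (goeMeasure (m + 1)))
    (hgf : ∀ x, (symOf x).charpoly.roots.Nodup → g x = ∑ l ∈ (symOf x).charpoly.roots.toFinset,
      f (l, (symOf x).charpoly.derivative.eval l, (symOf x).charpoly.eval y)) :
    Integrable (fun p : ℝ × (SymIdx m → ℝ) => Real.exp (-(p.1 ^ 2 / 2)) *
        (|(symOf p.2).charpoly.eval p.1| * f (p.1, (symOf p.2).charpoly.eval p.1,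
          (y - p.1) * (symOf p.2).charpoly.eval y))) (volume.prod (goeMeasure m)) ∧
    ∫ x, g x ∂goeMeasure (m + 1) = goeCoeff (m + 1) *
      ∫ p : ℝ × (SymIdx m → ℝ), Real.exp (-(p.1 ^ 2 / 2)) *
        (|(symOf p.2).charpoly.eval p.1| * f (p.1, (symOf p.2).charpoly.eval p.1,
          (y - p.1) * (symOf p.2).charpoly.eval y)) ∂volume.prod (goeMeasure m) := by
  have hC := goeCoeff_pos (Nat.succ_pos m)
  have key := lintegral_goe_sum_roots_ofReal hf hf0 y hg hgf
  have hm := measurable_rest (m := m) hf y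
  have hnn : ∀ p : ℝ × (SymIdx m → ℝ), 0 ≤ Real.exp (-(p.1 ^ 2 / 2)) *
        (|(symOf p.2).charpoly.eval p.1| * f (p.1, (symOf p.2).charpoly.eval p.1,
          (y - p.1) * (symOf p.2).charpoly.eval y)) := fun p =>
    mul_nonneg (Real.exp_pos _).le (mul_nonneg (abs_nonneg _) (hf0 _))
  rw [← ofReal_integral_eq_lintegral_ofReal hgi (ae_of_all _ hg0)] at key
  have hI : Integrable (fun p : ℝ × (SymIdx m → ℝ) => Real.exp (-(p.1 ^ 2 / 2)) *
        (|(symOf p.2).charpoly.eval p.1| * f (p.1, (symOf p.2).charpoly.eval p.1,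
          (y - p.1) * (symOf p.2).charpoly.eval y))) (volume.prod (goeMeasure m)) := by
    refine ⟨hm.aestronglyMeasurable, ?_⟩
    rw [hasFiniteIntegral_iff_ofReal (ae_of_all _ hnn), lt_top_iff_ne_top]
    intro h
    rw [h, ENNReal.mul_top (by simpa using hC)] at key
    exact ENNReal.ofReal_ne_top key
  refine ⟨hI, ?_⟩
  rw [← ofReal_integral_eq_lintegral_ofReal hI (ae_of_all _ hnn), ← ENNReal.ofReal_mul hC.le,
    ENNReal.ofReal_eq_ofReal_iff (integral_nonneg hg0)
      (mul_nonneg hC.le (integral_nonneg hnn))] at key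
  exact key

/-- The signed sum over eigenvalues below y yields the absolute value. Under the splitting, p'(l)
becomes q(l) and p(y) becomes (y - l) q(y). The weight |q(l)| absorbs the sign, so only the product
q(l) q(y) is averaged. -/
theorem integral_abs_charpoly (m : ℕ) (y : ℝ) :
    ∫ x, |(symOf x).charpoly.eval y| ∂goeMeasure (m + 1) = (-1) ^ (m + 1) * meanChar (m + 1) y +
      goeCoeff (m + 1) * ∫ l in Set.Iio y, Real.exp (-(l ^ 2 / 2)) *
        (2 * (y - l) * charCorr m l y) := by
  have hi := integrable_eval_charpoly (m := m + 1) y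
  have hM := measurable_eval_charpoly_symOf (m := m + 1) y
  have hM' : Measurable fun x : SymIdx (m + 1) → ℝ => |(symOf x).charpoly.eval y| := hM.norm
  have hi' : Integrable (fun x => |(symOf x).charpoly.eval y|) (goeMeasure (m + 1)) := hi.norm
  -- The splitting formula is available for nonnegative summands only. It is applied to 2|p(y)|,
  -- summed over all m + 1 eigenvalues, and then to the same summand plus the signed one, which is
  -- still nonnegative; the two results are subtracted.
  obtain ⟨a1, a2⟩ := integral_goe_sum_roots (m := m) (f := fun p => 2 * |p.2.2|) (by fun_prop)
    (fun p => by positivity) y (g := fun x => (m + 1 : ℝ) * (2 * |(symOf x).charpoly.eval y|))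
    ((hM'.const_mul _).const_mul _) (fun x => by positivity) ((hi'.const_mul _).const_mul _)
    fun x hx => by
      dsimp only
      rw [Finset.sum_const, (eq_prod_roots_toFinset (symOf_isHermitian x) hx).2, nsmul_eq_mul]
      push_cast; ring
  obtain ⟨b1, b2⟩ := integral_goe_sum_roots (m := m)
    (f := fun p => 2 * |p.2.2| +
      2 * (if p.1 < y then p.2.1 / |p.2.1| * p.2.2 else 0)) (by
      refine Measurable.add (by fun_prop) (Measurable.const_mul (Measurable.ite ?_ ?_ ?_) _)
      · exact measurableSet_lt measurable_fst measurable_const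
      · fun_prop
      · fun_prop)
    (fun p => by
      have h1 : abs (p.2.1 / |p.2.1|) ≤ 1 := by
        rw [abs_div, abs_abs]
        exact div_self_le_one _
      have h2 : abs (p.2.1 / |p.2.1| * p.2.2) ≤ |p.2.2| := by
        rw [abs_mul]
        exact mul_le_of_le_one_left (abs_nonneg _) h1
      have h3 := neg_le_of_abs_le h2
      split_ifs
      · linarith
      · simp) y
    (g := fun x => (m + 1 : ℝ) * (2 * |(symOf x).charpoly.eval y|) +
      (|(symOf x).charpoly.eval y| - (-1) ^ (m + 1) * (symOf x).charpoly.eval y))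
    (((hM'.const_mul _).const_mul _).add (hM'.sub (hM.const_mul _))) (fun x => by
      have h1 : (-1 : ℝ) ^ (m + 1) * (symOf x).charpoly.eval y ≤ |(symOf x).charpoly.eval y| := by
        refine (le_abs_self _).trans ?_
        rw [abs_mul, abs_pow, abs_neg, abs_one, one_pow, one_mul]
      have h2 : 0 ≤ (m + 1 : ℝ) * (2 * |(symOf x).charpoly.eval y|) := by positivity
      linarith) (((hi'.const_mul _).const_mul _).add (hi'.sub (hi.const_mul _)))
    fun x hx => by
      dsimp only
      rw [Finset.sum_add_distrib, ← Finset.mul_sum _ _ (2 : ℝ),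
        ← Finset.mul_sum _ (fun l => if l < y then _ else _) (2 : ℝ),
        sum_sign_derivative_mul_eval (symOf_isHermitian x) hx,
        Finset.sum_const, (eq_prod_roots_toFinset (symOf_isHermitian x) hx).2, nsmul_eq_mul]
      push_cast; ring
  dsimp only at a1 a2 b1 b2
  have hs : Integrable (fun x => |(symOf x).charpoly.eval y| -
      (-1) ^ (m + 1) * (symOf x).charpoly.eval y) (goeMeasure (m + 1)) :=
    hi'.sub (hi.const_mul _)
  rw [integral_add ((hi'.const_mul _).const_mul _) hs, a2,
    integral_sub hi' (hi.const_mul _), integral_const_mul] at b2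
  have hd := b1.sub a1
  have hsub := integral_sub b1 a1
  have heq : ∀ p : ℝ × (SymIdx m → ℝ), Real.exp (-(p.1 ^ 2 / 2)) *
        (|(symOf p.2).charpoly.eval p.1| * (2 * |(y - p.1) * (symOf p.2).charpoly.eval y| +
          2 * (if p.1 < y then (symOf p.2).charpoly.eval p.1 / |(symOf p.2).charpoly.eval p.1| *
            ((y - p.1) * (symOf p.2).charpoly.eval y) else 0))) -
      Real.exp (-(p.1 ^ 2 / 2)) * (|(symOf p.2).charpoly.eval p.1| *
        (2 * |(y - p.1) * (symOf p.2).charpoly.eval y|)) =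
      (Set.Iio y).indicator (fun l => Real.exp (-(l ^ 2 / 2)) * (2 * (y - l) *
        ((symOf p.2).charpoly.eval l * (symOf p.2).charpoly.eval y))) p.1 := by
    intro p
    have h1 : |(symOf p.2).charpoly.eval p.1| *
        ((symOf p.2).charpoly.eval p.1 / |(symOf p.2).charpoly.eval p.1|) =
        (symOf p.2).charpoly.eval p.1 := by
      rcases eq_or_ne ((symOf p.2).charpoly.eval p.1) 0 with h | h
      · simp [h]
      · field_simp
    by_cases hp : p.1 < y
    · rw [if_pos hp, Set.indicator_of_mem (Set.mem_Iio.mpr hp)]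
      linear_combination 2 * Real.exp (-(p.1 ^ 2 / 2)) *
        ((y - p.1) * (symOf p.2).charpoly.eval y) * h1
    · rw [if_neg hp, Set.indicator_of_notMem (by simpa using hp)]
      ring
  have hd' : Integrable (fun p : ℝ × (SymIdx m → ℝ) =>
      (Set.Iio y).indicator (fun l => Real.exp (-(l ^ 2 / 2)) * (2 * (y - l) *
        ((symOf p.2).charpoly.eval l * (symOf p.2).charpoly.eval y))) p.1)
      (volume.prod (goeMeasure m)) := hd.congr (ae_of_all _ heq)
  rw [integral_congr_ae (ae_of_all _ heq), integral_prod _ hd'] at hsub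
  have hin : ∀ l, ∫ β, (Set.Iio y).indicator (fun l => Real.exp (-(l ^ 2 / 2)) * (2 * (y - l) *
        ((symOf β).charpoly.eval l * (symOf β).charpoly.eval y))) l ∂goeMeasure m =
      (Set.Iio y).indicator (fun l => Real.exp (-(l ^ 2 / 2)) *
        (2 * (y - l) * charCorr m l y)) l := by
    intro l
    by_cases hl : l < y
    · simp only [Set.indicator_of_mem (Set.mem_Iio.mpr hl), integral_const_mul]
      rfl
    · simp only [Set.indicator_of_notMem (show l ∉ Set.Iio y by simpa using hl), integral_zero]
  simp only [hin] at hsub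
  rw [integral_indicator measurableSet_Iio] at hsub
  rw [hsub]
  rw [meanChar]
  linear_combination b2

end AbsCharpoly

/-! ### Unnormalised Hermite functions -/

/-- The unnormalised Hermite function `Hₖ(x) exp(-x²/2)`. -/
def hermPsi (k : ℕ) (x : ℝ) : ℝ := hermR k x * Real.exp (-(x ^ 2 / 2))

/-- The squared norm `2ᵏ k! √π` of `hermPsi k`. -/
def hermNorm (k : ℕ) : ℝ := 2 ^ k * (k.factorial : ℝ) * √Real.pi

theorem hermNorm_pos (k : ℕ) : 0 < hermNorm k := by
  unfold hermNorm
  have := Real.pi_pos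
  positivity

theorem hermNorm_succ (k : ℕ) : hermNorm (k + 1) = 2 * (k + 1) * hermNorm k := by
  simp only [hermNorm, Nat.factorial_succ, pow_succ]
  push_cast
  ring

theorem hermitePhi_eq (k : ℕ) (x : ℝ) : hermitePhi k x = hermPsi k x / √(hermNorm k) := by
  rw [hermitePhi, hermPsi, hermR, hermNorm, neg_div]
  ring

theorem hasDerivAt_exp_neg_sq_div_two (x : ℝ) :
    HasDerivAt (fun x : ℝ => Real.exp (-(x ^ 2 / 2))) (-x * Real.exp (-(x ^ 2 / 2))) x := by
  have h : HasDerivAt (fun x : ℝ => -(x ^ 2 / 2)) (-x) x := by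
    refine ((hasDerivAt_pow 2 x).div_const 2).neg.congr_deriv ?_
    simp
  exact h.exp.congr_deriv (mul_comm _ _)

theorem hasDerivAt_hermPsi (k : ℕ) (x : ℝ) :
    HasDerivAt (hermPsi k) (x * hermPsi k x - hermPsi (k + 1) x) x := by
  refine ((hasDerivAt_hermR k x).mul (hasDerivAt_exp_neg_sq_div_two x)).congr_deriv ?_
  simp only [hermPsi]
  ring

theorem hasDerivAt_hermPsi_succ (k : ℕ) (x : ℝ) :
    HasDerivAt (hermPsi (k + 1)) ((k + 1) * hermPsi k x - hermPsi (k + 2) x / 2) x := by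
  refine (hasDerivAt_hermPsi (k + 1) x).congr_deriv ?_
  simp only [hermPsi, hermR_succ_succ]
  ring

theorem hasDerivAt_hermPsi_zero (x : ℝ) : HasDerivAt (hermPsi 0) (-(hermPsi 1 x / 2)) x := by
  refine (hasDerivAt_hermPsi 0 x).congr_deriv ?_
  simp only [hermPsi, hermR_one, hermR_zero, zero_add]
  ring

theorem integrable_exp_mul_hermPsi (k : ℕ) (r : ℝ) :
    Integrable fun x => Real.exp (r * x) * hermPsi k x := by
  refine (integrable_polynomial_mul_exp ((hermitePoly k).map (Int.castRingHom ℝ)) r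
    (c := 1 / 2) (by norm_num)).congr (ae_of_all _ fun x => ?_)
  simp only [hermPsi, hermR_eq_eval]
  rw [show r * x - 1 / 2 * x ^ 2 = r * x + -(x ^ 2 / 2) by ring, Real.exp_add]
  ring

theorem integrable_hermPsi (k : ℕ) : Integrable (hermPsi k) := by
  simpa using integrable_exp_mul_hermPsi k 0

theorem integral_hermPsi_zero : ∫ x, hermPsi 0 x = √2 * √Real.pi := by
  have h := integral_gaussian (1 / 2)
  rw [← Real.sqrt_mul (by norm_num)]
  refine Eq.trans (integral_congr_ae (ae_of_all _ fun x => ?_)) (h.trans ?_)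
  · simp only [hermPsi, hermR_zero, one_mul]
    congr 1
    ring
  · congr 1
    ring

theorem integral_hermPsi_one : ∫ x, hermPsi 1 x = 0 := by
  have h := integral_eq_zero_of_hasDerivAt_of_integrable hasDerivAt_hermPsi_zero
    ((integrable_hermPsi 1).div_const 2).neg (integrable_hermPsi 0)
  rw [integral_neg, integral_div] at h
  linarith

theorem integral_hermPsi_succ_succ (k : ℕ) :
    ∫ x, hermPsi (k + 2) x = 2 * (k + 1) * ∫ x, hermPsi k x := by
  have i1 := (integrable_hermPsi k).const_mul ((k : ℝ) + 1)
  have i2 := (integrable_hermPsi (k + 2)).div_const 2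
  have h := integral_eq_zero_of_hasDerivAt_of_integrable (hasDerivAt_hermPsi_succ k)
    (i1.sub i2) (integrable_hermPsi (k + 1))
  rw [integral_sub i1 i2, integral_const_mul, integral_div] at h
  linarith

theorem integral_hermPsi_odd (j : ℕ) : ∫ x, hermPsi (2 * j + 1) x = 0 := by
  induction j with
  | zero => exact integral_hermPsi_one
  | succ j ih =>
    rw [show 2 * (j + 1) + 1 = (2 * j + 1) + 2 by ring, integral_hermPsi_succ_succ, ih, mul_zero]

/-- Γ and the integral of an even-indexed Hermite function satisfy matching two-step recursions.
This identifies the mean-polynomial term of the density with α. -/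
theorem goeCoeff_odd (j : ℕ) : goeCoeff (2 * j + 1) / 2 ^ (2 * j) = (∫ x, hermPsi (2 * j) x)⁻¹ := by
  have h : ∫ x, hermPsi (2 * j) x = √2 * Real.Gamma (((2 * j + 1 : ℕ) : ℝ) / 2) * 2 ^ (2 * j) := by
    induction j with
    | zero =>
      rw [mul_zero, integral_hermPsi_zero]
      simp [-one_div, ← Real.Gamma_one_half_eq]
    | succ j ih =>
      rw [show 2 * (j + 1) = 2 * j + 2 by ring, integral_hermPsi_succ_succ, ih]
      have : (((2 * j + 2 + 1 : ℕ) : ℝ) / 2) = ((2 * j + 1 : ℕ) : ℝ) / 2 + 1 := by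
        push_cast; ring
      rw [this, Real.Gamma_add_one (by positivity)]
      push_cast
      ring
  rw [h, goeCoeff, div_eq_mul_inv, ← mul_inv]

/-- Here the mean-polynomial term supplies the constant that turns the integral over (-∞, y] into
half the integral against the sign function, as in τ. -/
theorem goeCoeff_even (j : ℕ) : goeCoeff (2 * j + 2) / 2 ^ (2 * j + 1) =
    (∫ x, hermPsi (2 * j + 2) x) / (4 * hermNorm (2 * j + 1)) := by
  have h2 : √2 * √2 = 2 := Real.mul_self_sqrt (by norm_num)
  have h : ∫ x, hermPsi (2 * j + 2) x =
      2 * √2 * √Real.pi * ((2 * j + 1).factorial : ℝ) / (j.factorial : ℝ) := by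
    induction j with
    | zero =>
      rw [mul_zero, integral_hermPsi_succ_succ, integral_hermPsi_zero]
      simp
      ring
    | succ j ih =>
      rw [show 2 * (j + 1) + 2 = (2 * j + 2) + 2 by ring, integral_hermPsi_succ_succ, ih,
        show 2 * (j + 1) + 1 = (2 * j + 1 + 1) + 1 by ring, Nat.factorial_succ (2 * j + 1 + 1),
        Nat.factorial_succ (2 * j + 1), Nat.factorial_succ j]
      have : (j.factorial : ℝ) ≠ 0 := by positivity
      push_cast
      field_simp
      ring
  have hg : Real.Gamma (((2 * j + 2 : ℕ) : ℝ) / 2) = j.factorial := by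
    rw [← Real.Gamma_nat_eq_factorial]
    congr 1
    push_cast
    ring
  rw [h, goeCoeff, hg, hermNorm]
  have h3 : (√Real.pi) ≠ 0 := (Real.sqrt_pos.mpr Real.pi_pos).ne'
  have h4 : (j.factorial : ℝ) ≠ 0 := by positivity
  have h5 : ((2 * j + 1).factorial : ℝ) ≠ 0 := by positivity
  have h6 : √2 ≠ 0 := by positivity
  field_simp
  linear_combination -2 * h2

/-- Legendre's duplication formula for Γ at (m + 1)/2. -/
theorem goeCoeff_mul_goeCoeff (m : ℕ) :
    goeCoeff (m + 2) * goeCoeff (m + 1) = 2 ^ m / (2 * m.factorial * √Real.pi) := by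
  have h := Real.Gamma_mul_Gamma_add_half (((m + 1 : ℕ) : ℝ) / 2)
  have e1 : ((m + 1 : ℕ) : ℝ) / 2 + 1 / 2 = ((m + 2 : ℕ) : ℝ) / 2 := by push_cast; ring
  have e2 : 2 * (((m + 1 : ℕ) : ℝ) / 2) = m + 1 := by push_cast; ring
  rw [e1, e2, Real.Gamma_nat_eq_factorial] at h
  have e3 : (2 : ℝ) ^ (1 - ((m : ℝ) + 1)) = (2 ^ m)⁻¹ := by
    rw [show 1 - ((m : ℝ) + 1) = -m by ring, Real.rpow_neg (by norm_num), Real.rpow_natCast]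
  rw [e3] at h
  have h2 : √2 * √2 = 2 := Real.mul_self_sqrt (by norm_num)
  rw [goeCoeff, goeCoeff, ← mul_inv,
    show √2 * Real.Gamma (((m + 2 : ℕ) : ℝ) / 2) * (√2 * Real.Gamma (((m + 1 : ℕ) : ℝ) / 2)) =
      √2 * √2 * (Real.Gamma (((m + 1 : ℕ) : ℝ) / 2) * Real.Gamma (((m + 2 : ℕ) : ℝ) / 2)) by ring,
    h, h2]
  have h3 : (√Real.pi) ≠ 0 := (Real.sqrt_pos.mpr Real.pi_pos).ne'
  have h4 : (m.factorial : ℝ) ≠ 0 := by positivity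
  field_simp

/-! ### The Christoffel-Darboux kernel -/

/-- The polynomial part of the Christoffel-Darboux kernel. -/
def hermKernel (n : ℕ) (y t : ℝ) : ℝ :=
  ∑ k ∈ Finset.range n, hermR k y * hermR k t / hermNorm k

theorem christoffel_darboux (n : ℕ) (y t : ℝ) : (y - t) * hermKernel (n + 1) y t =
    (hermR (n + 1) y * hermR n t - hermR n y * hermR (n + 1) t) / (2 * hermNorm n) := by
  induction n with
  | zero =>
    have := (hermNorm_pos 0).ne'
    simp [hermKernel, hermR_one]
    field_simp
  | succ n ih =>
    rw [hermKernel, Finset.sum_range_succ, mul_add]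
    change (y - t) * hermKernel (n + 1) y t + _ = _
    rw [ih, hermNorm_succ, hermR_succ_succ, hermR_succ_succ]
    have := (hermNorm_pos n).ne'
    have : (n : ℝ) + 1 ≠ 0 := by positivity
    field_simp
    ring

/-- The derivative of `hermKernel` in the second variable. -/
def hermKernelDeriv (n : ℕ) (y t : ℝ) : ℝ :=
  ∑ k ∈ Finset.range n, hermR k y * (2 * t * hermR k t - hermR (k + 1) t) / hermNorm k

theorem hasDerivAt_hermKernel (n : ℕ) (y t : ℝ) :
    HasDerivAt (hermKernel n y) (hermKernelDeriv n y t) t :=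
  HasDerivAt.fun_sum fun k _ => ((hasDerivAt_hermR k t).const_mul _).div_const _

/-- The bracket K' - tK is, up to the Gaussian weight, the t-derivative of the weighted kernel.
Differentiating the Christoffel-Darboux formula once in t and combining it with the formula itself
clears both powers of y - t and leaves the numerator of the two-point function. -/
theorem sq_mul_hermKernelDeriv (m : ℕ) (y t : ℝ) :
    (y - t) ^ 2 * (hermKernelDeriv (m + 2) y t - t * hermKernel (m + 2) y t
      + hermR (m + 1) y * hermR (m + 2) t / (2 * hermNorm (m + 1))) =
      -charCorrNum m t y / (2 * hermNorm (m + 1)) := by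
  have h0 := christoffel_darboux (m + 1) y t
  have h1 : -hermKernel (m + 2) y t + (y - t) * hermKernelDeriv (m + 2) y t =
      (hermR (m + 2) y * (2 * t * hermR (m + 1) t - hermR (m + 2) t)
        - hermR (m + 1) y * (2 * (m + 2) * hermR (m + 1) t)) / (2 * hermNorm (m + 1)) := by
    have hd : HasDerivAt (fun t => (y - t) * hermKernel (m + 2) y t)
        (-hermKernel (m + 2) y t + (y - t) * hermKernelDeriv (m + 2) y t) t := by
      refine (((hasDerivAt_id t).const_sub y).mul (hasDerivAt_hermKernel _ y t)).congr_deriv ?_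
      simp
    refine hd.unique ?_
    rw [funext fun t => christoffel_darboux (m + 1) y t]
    refine ((((hasDerivAt_hermR (m + 1) t).const_mul _).sub
      ((hasDerivAt_hermR_succ (m + 1) t).const_mul _)).div_const _).congr_deriv ?_
    push_cast
    ring
  have hN := (hermNorm_pos (m + 1)).ne'
  have e1 : hermR (m + 1 + 1) y = hermR (m + 2) y := rfl
  have e2 : hermR (m + 1 + 1) t = hermR (m + 2) t := rfl
  rw [e1, e2] at h0
  rw [charCorrNum]
  rw [eq_div_iff (by positivity)] at h0 h1 ⊢
  have h2 : hermR (m + 1) y * hermR (m + 2) t / (2 * hermNorm (m + 1)) * (2 * hermNorm (m + 1)) =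
      hermR (m + 1) y * hermR (m + 2) t := by field_simp
  change (y - t) * hermKernel (m + 2) y t * _ = _ at h0
  linear_combination (y - t) * h1 + (1 - t * (y - t)) * h0 + (y - t) ^ 2 * h2

/-! ### The mean eigenvalue density -/

theorem tendsto_hermPsi_atBot (k : ℕ) : Filter.Tendsto (hermPsi k) Filter.atBot (nhds 0) := by
  cases k with
  | zero =>
    exact tendsto_zero_of_hasDerivAt_of_integrableOn_Iic (a := 0)
      (fun x _ => hasDerivAt_hermPsi_zero x)
      ((integrable_hermPsi 1).div_const 2).neg.integrableOn (integrable_hermPsi 0).integrableOn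
  | succ k =>
    exact tendsto_zero_of_hasDerivAt_of_integrableOn_Iic (a := 0)
      (fun x _ => hasDerivAt_hermPsi_succ k x)
      (((integrable_hermPsi k).const_mul _).sub
        ((integrable_hermPsi (k + 2)).div_const 2)).integrableOn
      (integrable_hermPsi (k + 1)).integrableOn

theorem integral_Iic_hermPsi_one (y : ℝ) : ∫ t in Set.Iic y, hermPsi 1 t = -2 * hermPsi 0 y := by
  have h := integral_Iic_of_hasDerivAt_of_tendsto' (a := y) (m := -2 * 0)
    (fun x _ => (hasDerivAt_hermPsi_zero x).const_mul (-2))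
    (by
      refine ((integrable_hermPsi 1).congr (ae_of_all _ fun x => ?_)).integrableOn
      ring) ((tendsto_hermPsi_atBot 0).const_mul _)
  rw [mul_zero, sub_zero] at h
  rw [← h]
  congr 1
  funext t
  ring

theorem integrable_deriv_hermPsi (k : ℕ) :
    Integrable fun t => t * hermPsi k t - hermPsi (k + 1) t := by
  cases k with
  | zero =>
    refine ((integrable_hermPsi 1).div_const 2).neg.congr (ae_of_all _ fun x => ?_)
    exact (hasDerivAt_hermPsi_zero x).unique (hasDerivAt_hermPsi 0 x)
  | succ k =>
    refine (((integrable_hermPsi k).const_mul ((k : ℝ) + 1)).sub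
        ((integrable_hermPsi (k + 2)).div_const 2)).congr (ae_of_all _ fun x => ?_)
    exact (hasDerivAt_hermPsi_succ k x).unique (hasDerivAt_hermPsi (k + 1) x)

/-- The integrand is the t-derivative of the weighted kernel, which vanishes at -∞ and takes the
value of the GUE density at t = y. -/
theorem integral_Iic_psiKernel (n : ℕ) (y : ℝ) :
    IntegrableOn (fun t => ∑ k ∈ Finset.range n,
      hermPsi k y / hermNorm k * (t * hermPsi k t - hermPsi (k + 1) t)) (Set.Iic y) ∧
    ∫ t in Set.Iic y, ∑ k ∈ Finset.range n,
      hermPsi k y / hermNorm k * (t * hermPsi k t - hermPsi (k + 1) t) =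
      ∑ k ∈ Finset.range n, hermPsi k y ^ 2 / hermNorm k := by
  have hi : ∀ k, IntegrableOn (fun t => hermPsi k y / hermNorm k *
      (t * hermPsi k t - hermPsi (k + 1) t)) (Set.Iic y) := fun k =>
    ((integrable_deriv_hermPsi k).const_mul _).integrableOn
  refine ⟨integrable_finsetSum _ fun k _ => hi k, ?_⟩
  rw [integral_finsetSum _ fun k _ => hi k]
  refine Finset.sum_congr rfl fun k _ => ?_
  rw [integral_const_mul, integral_Iic_of_hasDerivAt_of_tendsto'
    (fun x _ => hasDerivAt_hermPsi k x) (integrable_deriv_hermPsi k).integrableOn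
    (tendsto_hermPsi_atBot k)]
  ring

/-- The weighted two-point function is a kernel derivative plus a rank-one term. The first
integrates to the GUE density, the second to τ without its constant. The hypothesis t ≠ y permits
cancelling (y - t)² and costs nothing under the integral. -/
theorem goeCoeff_mul_exp_mul_charCorr (m : ℕ) {y t : ℝ} (h : t ≠ y) :
    goeCoeff (m + 2) * goeCoeff (m + 1) * Real.exp (-(y ^ 2 / 2)) *
      (Real.exp (-(t ^ 2 / 2)) * (2 * (y - t) * charCorr m t y)) =
    ∑ k ∈ Finset.range (m + 2), hermPsi k y / hermNorm k * (t * hermPsi k t - hermPsi (k + 1) t) +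
      hermPsi (m + 1) y / (2 * hermNorm (m + 1)) * hermPsi (m + 2) t := by
  have h1 : ∑ k ∈ Finset.range (m + 2), hermPsi k y / hermNorm k *
      (t * hermPsi k t - hermPsi (k + 1) t) = Real.exp (-(y ^ 2 / 2)) * Real.exp (-(t ^ 2 / 2)) *
      (hermKernelDeriv (m + 2) y t - t * hermKernel (m + 2) y t) := by
    rw [hermKernelDeriv, hermKernel, Finset.mul_sum, ← Finset.sum_sub_distrib, Finset.mul_sum]
    refine Finset.sum_congr rfl fun k _ => ?_
    simp only [hermPsi]
    ring
  have h2 := sq_mul_hermKernelDeriv m y t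
  have h3 := charCorr_eq m t y
  have hD : y - t ≠ 0 := sub_ne_zero.mpr h.symm
  have hD2 : (y - t) ^ 2 ≠ 0 := pow_ne_zero 2 hD
  rw [h1, goeCoeff_mul_goeCoeff]
  refine mul_left_cancel₀ hD2 ?_
  have hN := (hermNorm_pos (m + 1)).ne'
  have h4 : 2 ^ m / (2 * m.factorial * √Real.pi) * 2 =
      4 ^ (m + 1) * (m + 1) / (2 * hermNorm (m + 1)) := by
    have h5 : (√Real.pi) ≠ 0 := (Real.sqrt_pos.mpr Real.pi_pos).ne'
    have h6 : (m.factorial : ℝ) ≠ 0 := by positivity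
    rw [hermNorm, Nat.factorial_succ, show (4 : ℝ) = 2 * 2 by norm_num, mul_pow]
    push_cast
    field_simp
    ring
  have h7 : 2 ^ m / (2 * m.factorial * √Real.pi) * 2 * (y - t) ^ 3 * charCorr m t y =
      -charCorrNum m t y / (2 * hermNorm (m + 1)) := by
    rw [h4, ← h3]
    ring
  simp only [hermPsi]
  linear_combination Real.exp (-(y ^ 2 / 2)) * Real.exp (-(t ^ 2 / 2)) * (h7 - h2)

theorem goeCoeff_mul_integral_abs_charpoly (m : ℕ) (y : ℝ) :
    goeCoeff (m + 1) * Real.exp (-(y ^ 2 / 2)) * ∫ β, |(symOf β).charpoly.eval y| ∂goeMeasure m =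
    ∑ k ∈ Finset.range (m + 1), hermPsi k y ^ 2 / hermNorm k +
      hermPsi m y / (2 * hermNorm m) * (∫ t in Set.Iic y, hermPsi (m + 1) t) +
      (-1) ^ m * (goeCoeff (m + 1) / 2 ^ m) * hermPsi m y := by
  cases m with
  -- For order 0 the characteristic polynomial is 1. The first two terms on the right cancel and the
  -- last gives the left side, so the formula holds without a two-point function.
  | zero =>
    rw [integral_Iic_hermPsi_one]
    simp [hermPsi]
    ring
  | succ m =>
    rw [integral_abs_charpoly, meanChar_eq, ← integral_Iic_eq_integral_Iio]
    obtain ⟨i1, e1⟩ := integral_Iic_psiKernel (m + 2) y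
    have i2 : IntegrableOn (fun t => hermPsi (m + 1) y / (2 * hermNorm (m + 1)) *
      hermPsi (m + 2) t) (Set.Iic y) := ((integrable_hermPsi (m + 2)).const_mul _).integrableOn
    have key : goeCoeff (m + 2) * goeCoeff (m + 1) * Real.exp (-(y ^ 2 / 2)) *
        ∫ t in Set.Iic y, Real.exp (-(t ^ 2 / 2)) * (2 * (y - t) * charCorr m t y) =
        ∑ k ∈ Finset.range (m + 2), hermPsi k y ^ 2 / hermNorm k +
        hermPsi (m + 1) y / (2 * hermNorm (m + 1)) * ∫ t in Set.Iic y, hermPsi (m + 2) t := by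
      rw [← e1, ← integral_const_mul, ← integral_const_mul (hermPsi (m + 1) y / _),
        ← integral_add i1 i2, integral_Iic_eq_integral_Iio, integral_Iic_eq_integral_Iio]
      exact setIntegral_congr_fun measurableSet_Iio fun t ht =>
        goeCoeff_mul_exp_mul_charCorr m (ne_of_lt ht)
    change _ = ∑ k ∈ Finset.range (m + 2), hermPsi k y ^ 2 / hermNorm k + hermPsi (m + 1) y /
      (2 * hermNorm (m + 1)) * (∫ t in Set.Iic y, hermPsi (m + 2) t) + _
    rw [← key]
    simp only [hermPsi]
    ring

/-- The mean eigenvalue density for `σ = 1 / √2`. -/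
def goeDensityUnit (n : ℕ) (x : ℝ) : ℝ :=
  ∑ k ∈ Finset.range n, hermitePhi k x ^ 2 + (tauFun n x + alphaFun n x)

theorem integral_sign_mul_hermPsi (k : ℕ) (y : ℝ) :
    ∫ t, Real.sign (y - t) * hermPsi k t =
      2 * (∫ t in Set.Iic y, hermPsi k t) - ∫ t, hermPsi k t := by
  have i := integrable_hermPsi k
  have h : ∀ᵐ t : ℝ, Real.sign (y - t) * hermPsi k t =
      2 * (Set.Iic y).indicator (hermPsi k) t - hermPsi k t := by
    filter_upwards [Measure.ae_ne volume y] with t ht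
    rcases lt_or_gt_of_ne ht with h | h
    · rw [Real.sign_of_pos (sub_pos.mpr h), Set.indicator_of_mem (Set.mem_Iic.mpr h.le)]
      ring
    · rw [Real.sign_of_neg (sub_neg.mpr h), Set.indicator_of_notMem (by simpa using h)]
      ring
  rw [integral_congr_ae h, integral_sub ((i.indicator measurableSet_Iic).const_mul 2) i,
    integral_const_mul, integral_indicator measurableSet_Iic]

/-- The norms satisfy N_{m+1} = 2(m + 1) N_m, so the prefactor √((m+1)/2)/√(N_m N_{m+1}) is 1/(2
N_m). -/
theorem tauFun_succ (m : ℕ) (y : ℝ) : tauFun (m + 1) y = hermPsi m y / (2 * hermNorm m) *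
    ((∫ t in Set.Iic y, hermPsi (m + 1) t) - (∫ t, hermPsi (m + 1) t) / 2) := by
  have hN := hermNorm_pos m
  have hm : (0 : ℝ) < m + 1 := by positivity
  simp only [tauFun, hermitePhi_eq, Nat.add_sub_cancel, mul_div_assoc']
  rw [integral_div, integral_sign_mul_hermPsi, hermNorm_succ, Real.sqrt_mul (by positivity),
    show ((m + 1 : ℕ) : ℝ) / 2 = 2 * ((m : ℝ) + 1) / (2 * 2) by push_cast; ring,
    Real.sqrt_div' _ (by norm_num), Real.sqrt_mul_self (by norm_num)]
  have h1 : √(2 * ((m : ℝ) + 1)) ≠ 0 := by positivity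
  have h2 : √(hermNorm m) ≠ 0 := by positivity
  have h3 : hermNorm m = √(hermNorm m) * √(hermNorm m) := (Real.mul_self_sqrt hN.le).symm
  rw [div_mul_eq_mul_div (hermPsi m y) (2 * hermNorm m)]
  conv_rhs => rw [h3]
  field_simp

/-- For odd order the full integral inside τ vanishes by parity and the extra term is α. For even
order α is absent and the extra term is the constant part of τ. The sign (-1)^m fits both cases. -/
theorem goeDensityUnit_eq (m : ℕ) (y : ℝ) : goeDensityUnit (m + 1) y =
    goeCoeff (m + 1) * Real.exp (-(y ^ 2 / 2)) * ∫ β, |(symOf β).charpoly.eval y| ∂goeMeasure m := by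
  rw [goeCoeff_mul_integral_abs_charpoly, goeDensityUnit, tauFun_succ]
  have h1 : ∑ k ∈ Finset.range (m + 1), hermitePhi k y ^ 2 =
      ∑ k ∈ Finset.range (m + 1), hermPsi k y ^ 2 / hermNorm k := by
    refine Finset.sum_congr rfl fun k _ => ?_
    rw [hermitePhi_eq, div_pow, Real.sq_sqrt (hermNorm_pos k).le]
  rw [h1, alphaFun]
  rcases Nat.even_or_odd' m with ⟨j, rfl | rfl⟩
  · rw [if_pos ⟨j, rfl⟩, Nat.add_sub_cancel, goeCoeff_odd, integral_hermPsi_odd]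
    have h2 : √(hermNorm (2 * j)) ≠ 0 := by
      have := hermNorm_pos (2 * j)
      positivity
    simp only [hermitePhi_eq, integral_div]
    rw [pow_mul, neg_one_sq, one_pow]
    field_simp
    ring
  · rw [if_neg (by rw [Nat.not_odd_iff_even]; exact ⟨j + 1, by ring⟩)]
    have h2 := goeCoeff_even j
    have h3 : (-1 : ℝ) ^ (2 * j + 1) = -1 := by rw [pow_succ, pow_mul]; simp
    change _ + (hermPsi (2 * j + 1) y / (2 * hermNorm (2 * j + 1)) *
      ((∫ t in Set.Iic y, hermPsi (2 * j + 2) t) - (∫ t, hermPsi (2 * j + 2) t) / 2) + 0) =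
      _ + hermPsi (2 * j + 1) y / (2 * hermNorm (2 * j + 1)) *
      (∫ t in Set.Iic y, hermPsi (2 * j + 2) t) +
      (-1) ^ (2 * j + 1) * (goeCoeff (2 * j + 2) / 2 ^ (2 * j + 1)) * hermPsi (2 * j + 1) y
    rw [h2, h3]
    have hN := (hermNorm_pos (2 * j + 1)).ne'
    field_simp
    ring

/-! ### The trace of the exponential -/

section TraceExp

variable {m : ℕ}

theorem trace_exp_smul {B : Matrix (Fin m) (Fin m) ℝ} (hB : B.IsHermitian) (r : ℝ) :
    (NormedSpace.exp (r • B)).trace = (B.charpoly.roots.map fun l => Real.exp (r * l)).sum := by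
  obtain ⟨V, hV1, hV2, hV⟩ := exists_orthogonal_diagonalization hB
  have hinv : V⁻¹ = Vᵀ := Matrix.inv_eq_right_inv hV2
  have hu : IsUnit V := (Matrix.isUnit_iff_isUnit_det _).mpr
    (Matrix.isUnit_det_of_right_inverse hV2)
  have h1 : r • B = V * Matrix.diagonal (fun i => r * hB.eigenvalues i) * V⁻¹ := by
    rw [hinv]
    conv_lhs => rw [hV]
    rw [← Matrix.smul_mul, ← Matrix.mul_smul, ← Matrix.diagonal_smul]
    rfl
  rw [h1, Matrix.exp_conj _ _ hu, Matrix.trace_mul_cycle, hinv, hV1, Matrix.one_mul,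
    Matrix.exp_diagonal, Matrix.trace_diagonal, hB.roots_charpoly_eq_eigenvalues,
    Multiset.map_map]
  simp only [Pi.coe_exp, ← Real.exp_eq_exp_ℝ]
  rfl

theorem continuous_trace_exp (r : ℝ) :
    Continuous fun B : Matrix (Fin m) (Fin m) ℝ => (NormedSpace.exp (r • B)).trace := by
  let _ : NormedRing (Matrix (Fin m) (Fin m) ℝ) := Matrix.linftyOpNormedRing
  let _ : NormedAlgebra ℝ (Matrix (Fin m) (Fin m) ℝ) := Matrix.linftyOpNormedAlgebra
  let _ : NormedAlgebra ℚ (Matrix (Fin m) (Fin m) ℝ) := .restrictScalars ℚ ℝ _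
  have h : Continuous (NormedSpace.exp : Matrix (Fin m) (Fin m) ℝ → _) :=
    NormedSpace.exp_continuous
  exact (h.comp (continuous_const_smul r)).matrix_trace

theorem measurable_trace_exp_symOf (r : ℝ) :
    Measurable fun x : SymIdx m → ℝ => (NormedSpace.exp (r • symOf x)).trace :=
  ((continuous_trace_exp r).comp continuous_symOf).measurable

theorem trace_exp_symOf_nonneg (r : ℝ) (x : SymIdx m → ℝ) :
    0 ≤ (NormedSpace.exp (r • symOf x)).trace := by
  rw [trace_exp_smul (symOf_isHermitian x)]
  refine Multiset.sum_nonneg fun a ha => ?_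
  obtain ⟨l, _, rfl⟩ := Multiset.mem_map.mp ha
  exact (Real.exp_pos _).le

theorem goeDensityUnit_nonneg (m : ℕ) (y : ℝ) : 0 ≤ goeDensityUnit (m + 1) y := by
  rw [goeDensityUnit_eq]
  exact mul_nonneg (mul_nonneg (goeCoeff_pos (Nat.succ_pos m)).le (Real.exp_pos _).le)
    (integral_nonneg fun _ => abs_nonneg _)

theorem lintegral_trace_exp (m : ℕ) (r : ℝ) :
    ∫⁻ x, ENNReal.ofReal (NormedSpace.exp (r • symOf x)).trace ∂goeMeasure (m + 1) =
      ∫⁻ l, ENNReal.ofReal (Real.exp (r * l) * goeDensityUnit (m + 1) l) := by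
  have hf : Measurable fun p : ℝ × ℝ × ℝ => Real.exp (r * p.1) := by fun_prop
  rw [lintegral_goe_sum_roots_ofReal (f := fun p => Real.exp (r * p.1)) hf
    (fun p => (Real.exp_pos _).le) 0 (measurable_trace_exp_symOf r) fun x hx => by
      rw [trace_exp_smul (symOf_isHermitian x), Finset.sum, Multiset.toFinset_val, hx.dedup],
    lintegral_prod _ (measurable_rest hf 0).ennreal_ofReal.aemeasurable,
    ← lintegral_const_mul' _ _ ENNReal.ofReal_ne_top]
  refine lintegral_congr fun l => ?_
  have hi : Integrable (fun β => Real.exp (-(l ^ 2 / 2)) *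
      (|(symOf β).charpoly.eval l| * Real.exp (r * l))) (goeMeasure m) :=
    ((integrable_eval_charpoly l).norm.mul_const _).const_mul _
  dsimp only
  rw [← ofReal_integral_eq_lintegral_ofReal hi (ae_of_all _ fun β => by positivity),
    ← ENNReal.ofReal_mul (goeCoeff_pos (Nat.succ_pos m)).le, integral_const_mul,
    integral_mul_const, goeDensityUnit_eq]
  congr 1
  ring

end TraceExp

/-! ### Integrability of the densities -/

/-- Half the integral of `sign (y - t) Hₖ(t) exp(-t²/2)`. -/
def hermEps (k : ℕ) (y : ℝ) : ℝ := (∫ t in Set.Iic y, hermPsi k t) - (∫ t, hermPsi k t) / 2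

theorem continuous_hermPsi (k : ℕ) : Continuous (hermPsi k) :=
  continuous_iff_continuousAt.mpr fun x => (hasDerivAt_hermPsi k x).continuousAt

theorem hermEps_eq (k : ℕ) (y : ℝ) :
    hermEps k y = hermEps k 0 + ∫ t in (0 : ℝ)..y, hermPsi k t := by
  have h := intervalIntegral.integral_Iic_sub_Iic (a := 0) (b := y) (integrable_hermPsi k).integrableOn
    (integrable_hermPsi k).integrableOn
  rw [hermEps, hermEps, ← h]
  ring

theorem hasDerivAt_hermEps (k : ℕ) (y : ℝ) : HasDerivAt (hermEps k) (hermPsi k y) y := by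
  rw [funext (hermEps_eq k)]
  exact (intervalIntegral.integral_hasDerivAt_right
    ((continuous_hermPsi k).intervalIntegrable _ _)
    (continuous_hermPsi k).stronglyMeasurable.stronglyMeasurableAtFilter
    (continuous_hermPsi k).continuousAt).const_add _

theorem continuous_hermEps (k : ℕ) : Continuous (hermEps k) :=
  continuous_iff_continuousAt.mpr fun x => (hasDerivAt_hermEps k x).continuousAt

theorem abs_hermEps_le (k : ℕ) (y : ℝ) : |hermEps k y| ≤ 2 * ∫ t, |hermPsi k t| := by
  have i := (integrable_hermPsi k)
  have h1 : |∫ t in Set.Iic y, hermPsi k t| ≤ ∫ t, |hermPsi k t| :=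
    (abs_integral_le_integral_abs).trans
      (setIntegral_le_integral i.norm (ae_of_all _ fun _ => abs_nonneg _))
  have h2 : |∫ t, hermPsi k t| ≤ ∫ t, |hermPsi k t| := abs_integral_le_integral_abs
  rw [hermEps]
  refine (abs_sub _ _).trans ?_
  rw [abs_div, abs_two]
  have := abs_nonneg (∫ t, hermPsi k t)
  linarith

theorem integrable_exp_mul_hermPsi_mul_hermPsi (j k : ℕ) (r : ℝ) :
    Integrable fun x => Real.exp (r * x) * (hermPsi j x * hermPsi k x) := by
  refine (integrable_polynomial_mul_exp ((hermitePoly j).map (Int.castRingHom ℝ) *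
    (hermitePoly k).map (Int.castRingHom ℝ)) r (c := 1) one_pos).congr (ae_of_all _ fun x => ?_)
  simp only [hermPsi, hermR_eq_eval, Polynomial.eval_mul]
  rw [show r * x - 1 * x ^ 2 = r * x + -(x ^ 2 / 2) + -(x ^ 2 / 2) by ring, Real.exp_add,
    Real.exp_add]
  ring

theorem integrable_exp_mul_hermPsi_mul_hermEps (j k : ℕ) (r : ℝ) :
    Integrable fun x => Real.exp (r * x) * (hermPsi j x * hermEps k x) := by
  have h := (integrable_exp_mul_hermPsi j r).mul_bdd (c := 2 * ∫ t, |hermPsi k t|)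
    (continuous_hermEps k).aestronglyMeasurable (ae_of_all _ fun y => abs_hermEps_le k y)
  simpa only [mul_assoc] using h

theorem tauFun_succ_eq (m : ℕ) (y : ℝ) :
    tauFun (m + 1) y = 1 / (2 * hermNorm m) * (hermPsi m y * hermEps (m + 1) y) := by
  rw [tauFun_succ, hermEps]
  ring

theorem alphaFun_succ_eq (m : ℕ) (y : ℝ) : alphaFun (m + 1) y =
    (if Even m then (∫ t, hermPsi m t)⁻¹ else 0) * hermPsi m y := by
  rw [alphaFun, Nat.add_sub_cancel]
  by_cases h : Even m
  · have h2 : √(hermNorm m) ≠ 0 := by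
      have := hermNorm_pos m
      positivity
    rw [if_pos h.add_one, if_pos h]
    simp only [hermitePhi_eq, integral_div]
    field_simp
  · rw [if_neg h, if_neg (by rw [Nat.not_odd_iff_even]; exact (Nat.not_even_iff_odd.mp h).add_one),
      zero_mul]

theorem hermitePhi_sq (k : ℕ) (x : ℝ) :
    hermitePhi k x ^ 2 = 1 / hermNorm k * (hermPsi k x * hermPsi k x) := by
  rw [hermitePhi_eq, div_pow, Real.sq_sqrt (hermNorm_pos k).le]
  ring

theorem integrable_exp_mul_sum_hermitePhi_sq (n : ℕ) (r : ℝ) :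
    Integrable fun x => Real.exp (r * x) * ∑ k ∈ Finset.range n, hermitePhi k x ^ 2 := by
  simp only [hermitePhi_sq, Finset.mul_sum]
  refine integrable_finsetSum _ fun k _ => ?_
  simp only [mul_left_comm (Real.exp _) (1 / hermNorm k)]
  exact (integrable_exp_mul_hermPsi_mul_hermPsi k k r).const_mul _

theorem integrable_exp_mul_tauFun (m : ℕ) (r : ℝ) :
    Integrable fun x => Real.exp (r * x) * tauFun (m + 1) x := by
  simp only [tauFun_succ_eq, mul_left_comm (Real.exp _) (1 / (2 * hermNorm m))]
  exact (integrable_exp_mul_hermPsi_mul_hermEps _ _ r).const_mul _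

theorem integrable_exp_mul_alphaFun (m : ℕ) (r : ℝ) :
    Integrable fun x => Real.exp (r * x) * alphaFun (m + 1) x := by
  simp only [alphaFun_succ_eq, mul_left_comm (Real.exp _)]
  exact (integrable_exp_mul_hermPsi _ r).const_mul _

theorem integrable_exp_mul_tauFun_add_alphaFun (m : ℕ) (r : ℝ) :
    Integrable fun x => Real.exp (r * x) * (tauFun (m + 1) x + alphaFun (m + 1) x) := by
  simp only [mul_add]
  exact (integrable_exp_mul_tauFun m r).add (integrable_exp_mul_alphaFun m r)

theorem integrable_exp_mul_goeDensityUnit (m : ℕ) (r : ℝ) :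
    Integrable fun x => Real.exp (r * x) * goeDensityUnit (m + 1) x := by
  simp only [goeDensityUnit, mul_add]
  exact (integrable_exp_mul_sum_hermitePhi_sq _ r).add
    ((integrable_exp_mul_tauFun m r).add (integrable_exp_mul_alphaFun m r))

/-- Both integrands are nonnegative, for the density because it is a mean absolute value.
Integrability of the trace is therefore inherited from the explicit Hermite side. -/
theorem integral_trace_exp_symOf (m : ℕ) (r : ℝ) :
    Integrable (fun x => (NormedSpace.exp (r • symOf x)).trace) (goeMeasure (m + 1)) ∧
    ∫ x, (NormedSpace.exp (r • symOf x)).trace ∂goeMeasure (m + 1) =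
      ∫ l, Real.exp (r * l) * goeDensityUnit (m + 1) l := by
  have key := lintegral_trace_exp m r
  have hnn : ∀ l, 0 ≤ Real.exp (r * l) * goeDensityUnit (m + 1) l := fun l =>
    mul_nonneg (Real.exp_pos _).le (goeDensityUnit_nonneg m l)
  have hT : ∀ x : SymIdx (m + 1) → ℝ, 0 ≤ (NormedSpace.exp (r • symOf x)).trace :=
    trace_exp_symOf_nonneg r
  rw [← ofReal_integral_eq_lintegral_ofReal (integrable_exp_mul_goeDensityUnit m r)
    (ae_of_all _ hnn)] at key
  have hI : Integrable (fun x => (NormedSpace.exp (r • symOf x)).trace) (goeMeasure (m + 1)) := by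
    refine ⟨(measurable_trace_exp_symOf r).aestronglyMeasurable, ?_⟩
    rw [hasFiniteIntegral_iff_ofReal (ae_of_all _ hT), key]
    exact ENNReal.ofReal_lt_top
  refine ⟨hI, ?_⟩
  rw [← ofReal_integral_eq_lintegral_ofReal hI (ae_of_all _ hT),
    ENNReal.ofReal_eq_ofReal_iff (integral_nonneg hT) (integral_nonneg hnn)] at key
  exact key

/-! ### Scaling -/

theorem integrable_exp_mul_scaled {f : ℝ → ℝ} {c : ℝ} (hc : 0 < c) (s : ℝ)
    (hf : Integrable fun y => Real.exp (c * s * y) * f y) :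
    Integrable fun x => Real.exp (s * x) * (1 / c * f (x / c)) := by
  have h := (integrable_comp_mul_left_iff (fun y => Real.exp (c * s * y) * f y)
    (inv_ne_zero hc.ne')).mpr hf
  refine (h.const_mul (1 / c)).congr (ae_of_all _ fun x => ?_)
  dsimp only
  rw [show c * s * (c⁻¹ * x) = s * x by field_simp, show c⁻¹ * x = x / c by ring]
  ring

theorem integral_exp_mul_scaled (f : ℝ → ℝ) {c : ℝ} (hc : 0 < c) (s : ℝ) :
    ∫ x, Real.exp (s * x) * (1 / c * f (x / c)) = ∫ y, Real.exp (c * s * y) * f y := by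
  have h := Measure.integral_comp_div (fun y => Real.exp (c * s * y) * f y) c
  rw [abs_of_pos hc, smul_eq_mul] at h
  have h2 : ∫ y, Real.exp (c * s * y) * f y =
      1 / c * ∫ x, Real.exp (c * s * (x / c)) * f (x / c) := by
    rw [h]; field_simp
  rw [h2, ← integral_const_mul]
  refine integral_congr_ae (ae_of_all _ fun x => ?_)
  dsimp only
  rw [show c * s * (x / c) = s * x by field_simp]
  ring

theorem goeDensity_eq (n : ℕ) (σ x : ℝ) :
    goeDensity n σ x = 1 / (σ * √2) * goeDensityUnit n (x / (σ * √2)) := by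
  rw [goeDensity, gueDensity, goeDensityUnit]
  ring

theorem laplaceTransform_goeDensity (n : ℕ) {σ : ℝ} (hσ : 0 < σ) (s : ℝ) :
    laplaceTransform (goeDensity n σ) s =
      ∫ y, Real.exp (σ * √2 * s * y) * goeDensityUnit n y := by
  simp only [laplaceTransform, goeDensity_eq]
  exact integral_exp_mul_scaled _ (by positivity) s

theorem laplaceTransform_gueDensity (n : ℕ) {σ : ℝ} (hσ : 0 < σ) (s : ℝ) :
    laplaceTransform (gueDensity n σ) s =
      ∫ y, Real.exp (σ * √2 * s * y) * ∑ k ∈ Finset.range n, hermitePhi k y ^ 2 := by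
  simp only [laplaceTransform, gueDensity]
  exact integral_exp_mul_scaled (fun y => ∑ k ∈ Finset.range n, hermitePhi k y ^ 2)
    (by positivity) s

/-! ### Transfer to an arbitrary GOE matrix. -/

theorem IsGOE.hasLaw_entry {Ω : Type*} [MeasurableSpace Ω] {P : Measure Ω} {n : ℕ} {σ : ℝ}
    (hσ : 0 < σ) {A : Ω → Matrix (Fin n) (Fin n) ℝ} (hA : IsGOE P σ A) (p : SymIdx n) :
    HasLaw (fun ω => A ω p.1.1 p.1.2 / (σ * √2)) (gaussianReal 0 (symVar p)) P := by
  obtain ⟨⟨i, j⟩, hij⟩ := p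
  have hsq : (σ * √2) ^ 2 = 2 * σ ^ 2 := by
    rw [mul_pow, Real.sq_sqrt (by norm_num)]
    ring
  rcases (show i ≤ j from hij).eq_or_lt with h | h
  · subst h
    have h1 := gaussianReal_div_const (hA.law_diag i) (σ * √2)
    rw [zero_div] at h1
    convert h1 using 2
    rw [symVar, if_pos rfl]
    refine NNReal.coe_injective ?_
    push_cast
    rw [Real.coe_toNNReal _ (sq_nonneg σ), hsq, div_self (by positivity)]
  · have h1 := gaussianReal_div_const (hA.law_offDiag i j h) (σ * √2)
    rw [zero_div] at h1
    convert h1 using 2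
    rw [symVar, if_neg h.ne]
    refine NNReal.coe_injective ?_
    push_cast
    rw [Real.coe_toNNReal _ (sq_nonneg σ), hsq]
    field_simp

theorem IsGOE.hasLaw_symCoords {Ω : Type*} [MeasurableSpace Ω] {P : Measure Ω}
    [IsProbabilityMeasure P] {n : ℕ} {σ : ℝ} (hσ : 0 < σ)
    {A : Ω → Matrix (Fin n) (Fin n) ℝ} (hA : IsGOE P σ A) :
    HasLaw (fun ω (p : SymIdx n) => A ω p.1.1 p.1.2 / (σ * √2)) (goeMeasure n) P := by
  have hm : ∀ p : SymIdx n, AEMeasurable (fun ω => A ω p.1.1 p.1.2 / (σ * √2)) P := fun p =>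
    (hA.hasLaw_entry hσ p).aemeasurable
  have hi : iIndepFun (fun (p : SymIdx n) ω => A ω p.1.1 p.1.2 / (σ * √2)) P :=
    hA.indep.comp (fun _ x => x / (σ * √2)) fun _ => by fun_prop
  refine ⟨aemeasurable_pi_lambda _ hm, ?_⟩
  rw [(iIndepFun_iff_map_fun_eq_pi_map hm).mp hi, goeMeasure]
  congr 1
  funext p
  exact (hA.hasLaw_entry hσ p).map_eq

theorem IsGOE.smul_eq {Ω : Type*} [MeasurableSpace Ω] {P : Measure Ω} {n : ℕ} {σ : ℝ} (hσ : 0 < σ)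
    {A : Ω → Matrix (Fin n) (Fin n) ℝ} (hA : IsGOE P σ A) (s : ℝ) (ω : Ω) :
    s • A ω = (σ * √2 * s) • symOf fun p => A ω p.1.1 p.1.2 / (σ * √2) := by
  ext i j
  have hc : σ * √2 ≠ 0 := by positivity
  by_cases h : i ≤ j
  · simp only [Matrix.smul_apply, smul_eq_mul, symOf_apply_of_le _ h]
    field_simp
  · simp only [Matrix.smul_apply, smul_eq_mul, symOf, Matrix.of_apply, h, dite_false]
    rw [(hA.isSymm ω).apply i j]
    field_simp

theorem IsGOE.integral_trace_exp {Ω : Type*} [MeasurableSpace Ω] {P : Measure Ω}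
    [IsProbabilityMeasure P] {m : ℕ} {σ : ℝ} (hσ : 0 < σ)
    {A : Ω → Matrix (Fin (m + 1)) (Fin (m + 1)) ℝ} (hA : IsGOE P σ A) (s : ℝ) :
    Integrable (fun ω => (NormedSpace.exp (s • A ω)).trace) P ∧
    ∫ ω, (NormedSpace.exp (s • A ω)).trace ∂P = laplaceTransform (goeDensity (m + 1) σ) s := by
  obtain ⟨h1, h2⟩ := integral_trace_exp_symOf m (σ * √2 * s)
  have hl := hA.hasLaw_symCoords hσ
  have hm := measurable_trace_exp_symOf (m := m + 1) (σ * √2 * s)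
  simp only [hA.smul_eq hσ s]
  rw [laplaceTransform_goeDensity _ hσ, ← h2, ← hl.map_eq]
  rw [← hl.map_eq] at h1
  refine ⟨(integrable_map_measure hm.aestronglyMeasurable hl.aemeasurable).mp h1, ?_⟩
  rw [integral_map hl.aemeasurable hm.aestronglyMeasurable]

/-! ### Hermite polynomials on the imaginary axis -/

/-- The polynomials `(-i)ᵏ Hₖ(i r)`. -/
def hermI : ℕ → ℝ → ℝ
  | 0, _ => 1
  | 1, r => 2 * r
  | k + 2, r => 2 * r * hermI (k + 1) r + 2 * (k + 1) * hermI k r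

theorem hermiteH_succ_succ (k : ℕ) (z : ℂ) :
    hermiteH (k + 2) z = 2 * z * hermiteH (k + 1) z - 2 * (k + 1) * hermiteH k z := by
  simp [hermiteH, hermitePoly_succ_succ, map_ofNat]

theorem ofReal_hermI (k : ℕ) (r : ℝ) :
    ((hermI k r : ℝ) : ℂ) = (-Complex.I) ^ k * hermiteH k (Complex.I * r) := by
  induction k using Nat.twoStepInduction with
  | zero => simp [hermI, hermiteH, hermitePoly]
  | one =>
    simp only [hermI, hermiteH, hermitePoly, map_sub, map_mul, map_one, Polynomial.aeval_X,
      map_ofNat, Polynomial.derivative_one, map_zero]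
    push_cast
    linear_combination (2 * (r : ℂ)) * Complex.I_mul_I
  | more k ih1 ih2 =>
    rw [hermI, hermiteH_succ_succ]
    push_cast
    rw [ih1, ih2, pow_succ, pow_succ]
    linear_combination (-2 * (r : ℂ) * (-Complex.I) ^ k * Complex.I * hermiteH (k + 1) (Complex.I * r)
      + 2 * ((k : ℂ) + 1) * (-Complex.I) ^ k * hermiteH k (Complex.I * r)) * Complex.I_mul_I

theorem ofReal_hermR (k : ℕ) (x : ℝ) : ((hermR k x : ℝ) : ℂ) = hermiteH k x := by
  rw [hermR, hermiteH, ← Complex.coe_algebraMap, Polynomial.aeval_algebraMap_apply]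

/-! ### Binomial convolution -/

/-- The binomial convolution of two sequences. -/
def binomConv (f g : ℕ → ℝ) (k : ℕ) : ℝ :=
  ∑ p ∈ Finset.HasAntidiagonal.antidiagonal k, (k.choose p.1 : ℝ) * (f p.1 * g p.2)

/-- In terms of exponential generating functions a shift is a derivative and the convolution a
product, so this is Leibniz's rule. -/
theorem binomConv_succ (f g : ℕ → ℝ) (k : ℕ) : binomConv f g (k + 1) =
    binomConv (fun i => f (i + 1)) g k + binomConv f (fun i => g (i + 1)) k := by
  rw [binomConv, Finset.sum_antidiagonal_choose_succ_mul (fun a b => f a * g b), add_comm]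
  congr 1
  refine Finset.sum_congr rfl fun p hp => ?_
  rw [← Finset.HasAntidiagonal.mem_antidiagonal.mp hp, Nat.choose_symm_add]

theorem binomConv_add_left (f₁ f₂ g : ℕ → ℝ) (k : ℕ) :
    binomConv (fun i => f₁ i + f₂ i) g k = binomConv f₁ g k + binomConv f₂ g k := by
  simp only [binomConv, ← Finset.sum_add_distrib]
  exact Finset.sum_congr rfl fun p _ => by ring

theorem binomConv_const_mul_left (c : ℝ) (f g : ℕ → ℝ) (k : ℕ) :
    binomConv (fun i => c * f i) g k = c * binomConv f g k := by
  simp only [binomConv, Finset.mul_sum]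
  exact Finset.sum_congr rfl fun p _ => by ring

theorem binomConv_comm (f g : ℕ → ℝ) (k : ℕ) : binomConv f g k = binomConv g f k := by
  rw [binomConv, ← Finset.Nat.sum_antidiagonal_swap]
  refine Finset.sum_congr rfl fun p hp => ?_
  rw [← Finset.HasAntidiagonal.mem_antidiagonal.mp hp, Prod.fst_swap, Prod.snd_swap, Nat.choose_symm_add]
  ring

/-- The operation i f(i - 1) multiplies the exponential generating function by its variable. At i =
0 the truncated index is harmless because the factor i vanishes. -/
theorem binomConv_shift (f g : ℕ → ℝ) (k : ℕ) :
    binomConv (fun i => i * f (i - 1)) g k = k * binomConv f g (k - 1) := by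
  cases k with
  | zero => simp [binomConv]
  | succ k =>
    rw [binomConv, Finset.Nat.sum_antidiagonal_succ, Nat.add_sub_cancel, binomConv, Finset.mul_sum]
    simp only [Nat.cast_zero, zero_mul, mul_zero, zero_add, Nat.add_sub_cancel]
    refine Finset.sum_congr rfl fun p _ => ?_
    have h : ((k + 1 : ℕ) : ℝ) * (k.choose p.1 : ℝ) =
        ((k + 1).choose (p.1 + 1) : ℝ) * ((p.1 + 1 : ℕ) : ℝ) := by
      exact_mod_cast Nat.add_one_mul_choose_eq k p.1
    linear_combination (-(f p.1 * g p.2)) * h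

theorem hermI_succ (k : ℕ) (r : ℝ) :
    hermI (k + 1) r = 2 * r * hermI k r + 2 * (k * hermI (k - 1) r) := by
  cases k with
  | zero => simp [hermI]
  | succ k => rw [hermI, Nat.add_sub_cancel]; push_cast; ring

theorem hermR_succ (k : ℕ) (x : ℝ) :
    hermR (k + 1) x = 2 * x * hermR k x + -2 * (k * hermR (k - 1) x) := by
  cases k with
  | zero => simp [hermR_one]
  | succ k => rw [hermR_succ_succ, Nat.add_sub_cancel]; push_cast; ring

theorem binomConv_hermI_succ (g : ℕ → ℝ) (r : ℝ) (k : ℕ) :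
    binomConv (fun i => hermI (i + 1) r) g k = 2 * r * binomConv (fun i => hermI i r) g k +
      2 * (k * binomConv (fun i => hermI i r) g (k - 1)) := by
  simp only [hermI_succ]
  rw [binomConv_add_left, binomConv_const_mul_left, binomConv_const_mul_left,
    binomConv_shift (fun i => hermI i r)]

/-- The generating functions exp(2rt + t²) and exp(2xt - t²) multiply to exp((2r + 2x)t); the
recursion below is the differentiated form. -/
theorem binomConv_hermI_hermR (r x : ℝ) (k : ℕ) :
    binomConv (fun i => hermI i r) (fun i => hermR i x) k = (2 * r + 2 * x) ^ k := by
  induction k with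
  | zero => simp [binomConv, hermI]
  | succ k ih =>
    rw [binomConv_succ, binomConv_hermI_succ, binomConv_comm _ (fun i => hermR (i + 1) x)]
    simp only [hermR_succ]
    rw [binomConv_add_left, binomConv_const_mul_left, binomConv_const_mul_left,
      binomConv_shift (fun i => hermR i x), binomConv_comm (fun i => hermR i x),
      binomConv_comm (fun i => hermR i x), ih]
    ring

/-- The polynomial part of `∫ exp(r x) Hₖ(x) exp(-x²/2) Φ(x) dx`, `Φ' = exp(-x²/2)`. -/
def hermT (k : ℕ) (r : ℝ) : ℝ :=
  binomConv (fun i => hermI i r) (fun i => if i = 0 then 0 else hermR (i - 1) (-(r / 2))) k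

theorem hermT_zero (r : ℝ) : hermT 0 r = 0 := by simp [hermT, binomConv]

/-- At x = -r/2 the convolution of the two Hermite sequences collapses to r^k. That is precisely the
source term in the recurrence for the error-function transform. -/
theorem hermT_succ (k : ℕ) (r : ℝ) :
    hermT (k + 1) r = 2 * r * hermT k r + 2 * (k * hermT (k - 1) r) + r ^ k := by
  rw [hermT, binomConv_succ, binomConv_hermI_succ]
  simp only [Nat.add_one_ne_zero, if_false, Nat.add_sub_cancel]
  rw [binomConv_hermI_hermR]
  simp only [hermT]
  ring

theorem hermT_eq_sum (k : ℕ) (r : ℝ) : hermT k r = ∑ j ∈ Finset.Icc 1 k,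
    (k.choose j : ℝ) * (hermI (k - j) r * hermR (j - 1) (-(r / 2))) := by
  rw [hermT, binomConv_comm, binomConv, Finset.Nat.sum_antidiagonal_eq_sum_range_succ_mk,
    Finset.sum_range_succ']
  simp only [if_true, zero_mul, mul_zero, add_zero, Nat.add_one_ne_zero, if_false,
    Nat.add_sub_cancel]
  rw [← Finset.sum_bij' (s := Finset.Icc 1 k) (t := Finset.range k)
    (f := fun j => (k.choose j : ℝ) * (hermI (k - j) r * hermR (j - 1) (-(r / 2))))
    (fun j _ => j - 1) (fun j _ => j + 1)]
  · intro j hj; simp only [Finset.mem_Icc, Finset.mem_range] at *; omega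
  · intro j hj; simp only [Finset.mem_Icc, Finset.mem_range] at *; omega
  · intro j hj; simp only [Finset.mem_Icc] at *; omega
  · intro j hj; simp
  · intro j hj
    rw [Nat.sub_add_cancel (Finset.mem_Icc.mp hj).1]
    ring

/-! ### Terminating confluent hypergeometric series -/

/-- The polynomial `₁F₁(-j; b; -x)`. -/
def hypPoly (j : ℕ) (b x : ℝ) : ℝ :=
  ∑ i ∈ Finset.range (j + 1), (j.choose i : ℝ) * (x ^ i / ∏ t ∈ Finset.range i, (b + t))

theorem prod_neg_add (j i : ℕ) :
    ∏ t ∈ Finset.range i, (-(j : ℂ) + t) = (-1) ^ i * i.factorial * j.choose i := by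
  induction i with
  | zero => simp
  | succ i ih =>
    rw [Finset.prod_range_succ, ih, Nat.factorial_succ, pow_succ]
    have h : ((j.choose (i + 1) : ℂ)) * (i + 1) = j.choose i * (j - i) := by
      rcases le_or_gt i j with hij | hij
      · have := Nat.choose_succ_right_eq j i
        rw [← Nat.cast_sub hij]
        exact_mod_cast this
      · rw [Nat.choose_eq_zero_of_lt hij, Nat.choose_eq_zero_of_lt (hij.trans (Nat.lt_succ_self i))]
        simp
    push_cast
    linear_combination ((-1) ^ i * (i.factorial : ℂ)) * h

/-- The rising factorial of -j divided by i! is (-1)^i times a binomial coefficient. It stops the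
series after i = j, and its sign cancels that of (-x)^i. -/
theorem hyp1F1_neg_nat (j : ℕ) (b x : ℝ) :
    hyp1F1 (-(j : ℂ)) b (-(x : ℂ)) = ((hypPoly j b x : ℝ) : ℂ) := by
  rw [hyp1F1, tsum_eq_sum (s := Finset.range (j + 1)), hypPoly]
  · push_cast
    refine Finset.sum_congr rfl fun i _ => ?_
    rw [prod_neg_add, neg_pow]
    have h1 : (i.factorial : ℂ) ≠ 0 := by exact_mod_cast i.factorial_ne_zero
    have h2 : ((-1 : ℂ) ^ i) * (-1) ^ i = 1 := by rw [← mul_pow]; simp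
    field_simp
    linear_combination ((j.choose i : ℂ) * (x : ℂ) ^ i / ∏ t ∈ Finset.range i, ((b : ℂ) + t)) * h2
  · intro i hi
    rw [prod_neg_add, Nat.choose_eq_zero_of_lt (by simpa using hi)]
    simp

theorem prod_range_add_succ (b : ℝ) (i : ℕ) : ∏ t ∈ Finset.range (i + 1), (b + t) =
    b * ∏ t ∈ Finset.range i, (b + 1 + t) := by
  rw [Finset.prod_range_succ']
  simp only [Nat.cast_zero, add_zero]
  rw [mul_comm]
  congr 1
  exact Finset.prod_congr rfl fun t _ => by push_cast; ring

theorem hypPoly_succ (j : ℕ) (b x : ℝ) :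
    hypPoly (j + 1) b x = hypPoly j b x + x / b * hypPoly j (b + 1) x := by
  have h1 : hypPoly j b x = ∑ i ∈ Finset.range (j + 1),
      (j.choose (i + 1) : ℝ) * (x ^ (i + 1) / ∏ t ∈ Finset.range (i + 1), (b + t)) + 1 := by
    have : hypPoly j b x = ∑ i ∈ Finset.range (j + 1 + 1),
        (j.choose i : ℝ) * (x ^ i / ∏ t ∈ Finset.range i, (b + t)) := by
      rw [Finset.sum_range_succ _ (j + 1), Nat.choose_succ_self]
      simp [hypPoly]
    rw [this, Finset.sum_range_succ']
    simp
  have h2 : x / b * hypPoly j (b + 1) x = ∑ i ∈ Finset.range (j + 1),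
      (j.choose i : ℝ) * (x ^ (i + 1) / ∏ t ∈ Finset.range (i + 1), (b + t)) := by
    rw [hypPoly, Finset.mul_sum]
    refine Finset.sum_congr rfl fun i _ => ?_
    rw [prod_range_add_succ, pow_succ, div_eq_mul_inv, div_eq_mul_inv, div_eq_mul_inv, mul_inv]
    ring
  rw [h1, h2, hypPoly, Finset.sum_range_succ', add_right_comm, ← Finset.sum_add_distrib]
  congr 1
  · refine Finset.sum_congr rfl fun i _ => ?_
    rw [Nat.choose_succ_succ]
    push_cast
    ring
  · simp

theorem hypPoly_contiguous (j : ℕ) {b : ℝ} (hb : 0 < b) (x : ℝ) :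
    b * hypPoly (j + 1) b x + (j + 1) * hypPoly j (b + 1) x =
      (b + (j + 1)) * hypPoly (j + 1) (b + 1) x := by
  have h1 : hypPoly j (b + 1) x = ∑ i ∈ Finset.range (j + 1 + 1),
      (j.choose i : ℝ) * (x ^ i / ∏ t ∈ Finset.range i, (b + 1 + t)) := by
    rw [Finset.sum_range_succ _ (j + 1), Nat.choose_succ_self]
    simp [hypPoly]
  rw [h1, hypPoly, hypPoly, Finset.mul_sum, Finset.mul_sum, Finset.mul_sum,
    ← Finset.sum_add_distrib]
  refine Finset.sum_congr rfl fun i hi => ?_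
  have hp : ∀ c : ℝ, 0 < c → 0 < ∏ t ∈ Finset.range i, (c + t) := fun c hc =>
    Finset.prod_pos fun t _ => by positivity
  have hq := prod_range_add_succ b i
  rw [Finset.prod_range_succ] at hq
  have h2 : b / ∏ t ∈ Finset.range i, (b + t) =
      (b + i) / ∏ t ∈ Finset.range i, (b + 1 + t) := by
    rw [div_eq_div_iff (hp b hb).ne' (hp (b + 1) (by linarith)).ne']
    linarith
  have h3 : ((j : ℝ) + 1) * (j.choose i : ℝ) = ((j + 1).choose i : ℝ) * (j + 1 - i) := by
    have hij : i ≤ j + 1 := by simpa [Nat.lt_succ_iff] using hi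
    have := Nat.choose_mul_succ_eq j i
    have h4 : ((j + 1 - i : ℕ) : ℝ) = (j : ℝ) + 1 - i := by rw [Nat.cast_sub hij]; push_cast; ring
    rw [← h4, mul_comm]
    exact_mod_cast this
  have e : b * (((j + 1).choose i : ℝ) * (x ^ i / ∏ t ∈ Finset.range i, (b + t))) =
      ((j + 1).choose i : ℝ) * x ^ i * (b / ∏ t ∈ Finset.range i, (b + t)) := by ring
  rw [e, h2]
  linear_combination (x ^ i / ∏ t ∈ Finset.range i, (b + 1 + t)) * h3

/-- Both parities are proved together because the three-term recurrence mixes them. The even step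
uses Pascal's rule `hypPoly_succ`, the odd step the contiguous relation between parameters 1/2 and
3/2. -/
theorem hermI_eq_hypPoly (j : ℕ) (r : ℝ) :
    hermI (2 * j) r = (2 * j).factorial / j.factorial * hypPoly j (1 / 2) (r ^ 2) ∧
    hermI (2 * j + 1) r =
      (2 * j + 1).factorial / j.factorial * (2 * r) * hypPoly j (3 / 2) (r ^ 2) := by
  induction j with
  | zero => simp [hermI, hypPoly]
  | succ j ih =>
    obtain ⟨ih1, ih2⟩ := ih
    have hj : (j.factorial : ℝ) ≠ 0 := by positivity
    have e1 : hermI (2 * (j + 1)) r = (2 * (j + 1)).factorial / (j + 1).factorial *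
        hypPoly (j + 1) (1 / 2) (r ^ 2) := by
      rw [show 2 * (j + 1) = 2 * j + 2 by ring, hermI, ih1, ih2, hypPoly_succ,
        Nat.factorial_succ (2 * j + 1), Nat.factorial_succ (2 * j), Nat.factorial_succ j,
        show (1 / 2 + 1 : ℝ) = 3 / 2 by norm_num]
      push_cast
      field_simp
      ring
    refine ⟨e1, ?_⟩
    have hc := hypPoly_contiguous j (b := 1 / 2) (by norm_num) (r ^ 2)
    rw [show (1 / 2 + 1 : ℝ) = 3 / 2 by norm_num] at hc
    have hr : hermI (2 * (j + 1) + 1) r =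
        2 * r * hermI (2 * (j + 1)) r + 2 * (2 * j + 2) * hermI (2 * j + 1) r := by
      rw [show 2 * (j + 1) + 1 = (2 * j + 1) + 2 by ring, hermI]
      push_cast
      ring_nf
    have hP : hypPoly (j + 1) (1 / 2) (r ^ 2) = (2 * j + 3) * hypPoly (j + 1) (3 / 2) (r ^ 2)
        - 2 * (j + 1) * hypPoly j (3 / 2) (r ^ 2) := by linear_combination 2 * hc
    rw [hr, e1, ih2, hP, show 2 * (j + 1) = 2 * j + 1 + 1 by ring,
      Nat.factorial_succ (2 * j + 1 + 1), Nat.factorial_succ (2 * j + 1), Nat.factorial_succ j]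
    push_cast
    field_simp
    ring

/-! ### Laplace transforms of Hermite functions -/

theorem integral_exp_mul_sub_sq {c : ℝ} (hc : 0 < c) (r : ℝ) :
    ∫ x, Real.exp (r * x - c * x ^ 2) = √(Real.pi / c) * Real.exp (r ^ 2 / (4 * c)) := by
  have h := integral_sub_right_eq_self (fun x => Real.exp (-c * x ^ 2)) (r / (2 * c)) (μ := volume)
  rw [integral_gaussian] at h
  rw [← h, ← integral_mul_const]
  refine integral_congr_ae (ae_of_all _ fun x => ?_)
  dsimp only
  rw [← Real.exp_add]
  congr 1
  field_simp
  ring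

theorem hasDerivAt_exp_mul (r x : ℝ) :
    HasDerivAt (fun x => Real.exp (r * x)) (Real.exp (r * x) * r) x := by
  simpa using ((hasDerivAt_id x).const_mul r).exp

theorem integral_exp_mul_hermPsi_succ (k : ℕ) (r : ℝ) :
    ∫ x, Real.exp (r * x) * hermPsi (k + 2) x =
      2 * r * (∫ x, Real.exp (r * x) * hermPsi (k + 1) x) +
        2 * (k + 1) * ∫ x, Real.exp (r * x) * hermPsi k x := by
  have i0 := (integrable_exp_mul_hermPsi k r).const_mul ((k : ℝ) + 1)
  have i1 := (integrable_exp_mul_hermPsi (k + 1) r).const_mul r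
  have i2 := (integrable_exp_mul_hermPsi (k + 2) r).div_const 2
  have h := integral_eq_zero_of_hasDerivAt_of_integrable
    (f := fun x => Real.exp (r * x) * hermPsi (k + 1) x)
    (f' := fun x => r * (Real.exp (r * x) * hermPsi (k + 1) x) +
      ((k + 1) * (Real.exp (r * x) * hermPsi k x) - Real.exp (r * x) * hermPsi (k + 2) x / 2))
    (fun x => ((hasDerivAt_exp_mul r x).mul (hasDerivAt_hermPsi_succ k x)).congr_deriv (by ring))
    (i1.add (i0.sub i2)) (integrable_exp_mul_hermPsi (k + 1) r)
  have i3 : Integrable fun x => (k + 1) * (Real.exp (r * x) * hermPsi k x) -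
    Real.exp (r * x) * hermPsi (k + 2) x / 2 := i0.sub i2
  rw [integral_add i1 i3, integral_sub i0 i2, integral_const_mul, integral_const_mul,
    integral_div] at h
  linarith

theorem integral_exp_mul_hermPsi_zero (r : ℝ) :
    ∫ x, Real.exp (r * x) * hermPsi 0 x = √2 * √Real.pi * Real.exp (r ^ 2 / 2) := by
  have h := integral_exp_mul_sub_sq (c := 1 / 2) (by norm_num) r
  rw [show Real.pi / (1 / 2) = 2 * Real.pi by ring, Real.sqrt_mul (by norm_num),
    show r ^ 2 / (4 * (1 / 2)) = r ^ 2 / 2 by ring] at h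
  rw [← h]
  refine integral_congr_ae (ae_of_all _ fun x => ?_)
  simp only [hermPsi, hermR_zero, one_mul]
  rw [← Real.exp_add]
  congr 1
  ring

theorem integral_exp_mul_hermPsi (k : ℕ) (r : ℝ) :
    ∫ x, Real.exp (r * x) * hermPsi k x =
      √2 * √Real.pi * Real.exp (r ^ 2 / 2) * hermI k r := by
  induction k using Nat.twoStepInduction with
  | zero => rw [integral_exp_mul_hermPsi_zero, hermI, mul_one]
  | one =>
    have i0 := (integrable_exp_mul_hermPsi 0 r).const_mul r
    have i1 := (integrable_exp_mul_hermPsi 1 r).div_const 2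
    have h := integral_eq_zero_of_hasDerivAt_of_integrable
      (f := fun x => Real.exp (r * x) * hermPsi 0 x)
      (f' := fun x => r * (Real.exp (r * x) * hermPsi 0 x) - Real.exp (r * x) * hermPsi 1 x / 2)
      (fun x => ((hasDerivAt_exp_mul r x).mul (hasDerivAt_hermPsi_zero x)).congr_deriv (by ring))
      (i0.sub i1) (integrable_exp_mul_hermPsi 0 r)
    rw [integral_sub i0 i1, integral_const_mul, integral_div, integral_exp_mul_hermPsi_zero] at h
    rw [hermI]
    linarith
  | more k ih1 ih2 =>
    rw [integral_exp_mul_hermPsi_succ, ih1, ih2, hermI]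
    ring

/-- The Laplace transform of a product of two Hermite functions. -/
def psiLaplace (j k : ℕ) (r : ℝ) : ℝ := ∫ x, Real.exp (r * x) * (hermPsi j x * hermPsi k x)

theorem psiLaplace_comm (j k : ℕ) (r : ℝ) : psiLaplace j k r = psiLaplace k j r := by
  simp only [psiLaplace, mul_comm (hermPsi j _)]

theorem hasDerivAt_hermPsi_add (j : ℕ) (x : ℝ) :
    HasDerivAt (hermPsi j) (2 * j * hermPsi (j - 1) x - x * hermPsi j x) x := by
  refine (hasDerivAt_hermPsi j x).congr_deriv ?_
  simp only [hermPsi]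
  rw [hermR_succ]
  ring

/-- Integration by parts with two different forms of the derivative, one lowering j and one raising
k, chosen so that the terms multiplied by x cancel. -/
theorem psiLaplace_succ (j k : ℕ) (r : ℝ) :
    psiLaplace j (k + 1) r = r * psiLaplace j k r + 2 * j * psiLaplace (j - 1) k r := by
  have i0 := (integrable_exp_mul_hermPsi_mul_hermPsi j k r).const_mul r
  have i1 := (integrable_exp_mul_hermPsi_mul_hermPsi (j - 1) k r).const_mul (2 * (j : ℝ))
  have i2 := integrable_exp_mul_hermPsi_mul_hermPsi j (k + 1) r
  have i3 : Integrable fun x => 2 * (j : ℝ) * (Real.exp (r * x) * (hermPsi (j - 1) x * hermPsi k x))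
      - Real.exp (r * x) * (hermPsi j x * hermPsi (k + 1) x) := i1.sub i2
  have h := integral_eq_zero_of_hasDerivAt_of_integrable
    (f := fun x => Real.exp (r * x) * (hermPsi j x * hermPsi k x))
    (f' := fun x => r * (Real.exp (r * x) * (hermPsi j x * hermPsi k x)) +
      (2 * (j : ℝ) * (Real.exp (r * x) * (hermPsi (j - 1) x * hermPsi k x))
      - Real.exp (r * x) * (hermPsi j x * hermPsi (k + 1) x)))
    (fun x => ((hasDerivAt_exp_mul r x).mul ((hasDerivAt_hermPsi_add j x).fun_mul
      (hasDerivAt_hermPsi k x))).congr_deriv (by ring))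
    (i0.add i3) (integrable_exp_mul_hermPsi_mul_hermPsi j k r)
  rw [integral_add i0 i3, integral_sub i1 i2, integral_const_mul, integral_const_mul] at h
  simp only [psiLaplace]
  linarith

theorem psiLaplace_zero (k : ℕ) (r : ℝ) :
    psiLaplace k 0 r = √Real.pi * Real.exp (r ^ 2 / 4) * r ^ k := by
  rw [psiLaplace_comm]
  induction k with
  | zero =>
    have h := integral_exp_mul_sub_sq one_pos r
    rw [div_one, mul_one] at h
    rw [pow_zero, mul_one, ← h]
    refine integral_congr_ae (ae_of_all _ fun x => ?_)
    simp only [hermPsi, hermR_zero, one_mul]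
    rw [← Real.exp_add, ← Real.exp_add]
    congr 1
    ring
  | succ k ih =>
    rw [psiLaplace_succ, ih]
    simp
    ring

/-- The index difference a is kept free: raising k calls on the formula for both a and a + 1, and
Pascal's rule for the hypergeometric polynomial joins them. -/
theorem psiLaplace_add (a k : ℕ) (r : ℝ) :
    psiLaplace (k + a) k r = √Real.pi * Real.exp (r ^ 2 / 4) *
    (2 ^ k * (k + a).factorial / a.factorial * r ^ a * hypPoly k (1 + a) (r ^ 2 / 2)) := by
  induction k generalizing a with
  | zero =>
    have : (a.factorial : ℝ) ≠ 0 := by positivity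
    rw [zero_add, psiLaplace_zero]
    simp [hypPoly, this]
  | succ k ih =>
    have ha : (a.factorial : ℝ) ≠ 0 := by positivity
    rw [psiLaplace_succ, show k + 1 + a - 1 = k + a by omega, ih a,
      show k + 1 + a = k + (a + 1) by ring, ih (a + 1), hypPoly_succ, ← add_assoc,
      Nat.factorial_succ (k + a), Nat.factorial_succ a]
    push_cast
    rw [show (1 : ℝ) + (a + 1) = 1 + a + 1 by ring]
    field_simp
    ring

/-! ### The functions `hermEps` -/

theorem hermEps_one (y : ℝ) : hermEps 1 y = -2 * hermPsi 0 y := by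
  rw [hermEps, integral_Iic_hermPsi_one, integral_hermPsi_one]
  ring

theorem hermEps_succ_succ (k : ℕ) (y : ℝ) :
    hermEps (k + 2) y = -2 * hermPsi (k + 1) y + 2 * (k + 1) * hermEps k y := by
  have i1 := (integrable_hermPsi k).const_mul ((k : ℝ) + 1)
  have i2 := (integrable_hermPsi (k + 2)).div_const 2
  have h := integral_Iic_of_hasDerivAt_of_tendsto' (a := y)
    (fun x _ => hasDerivAt_hermPsi_succ k x) (i1.sub i2).integrableOn (tendsto_hermPsi_atBot (k + 1))
  rw [integral_sub i1.integrableOn i2.integrableOn, integral_const_mul, integral_div] at h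
  rw [hermEps, hermEps, integral_hermPsi_succ_succ]
  linarith

theorem hermEps_zero_zero : hermEps 0 0 = 0 := by
  have h1 : ∫ t in Set.Iic (0 : ℝ), hermPsi 0 t = ∫ t in Set.Ioi (0 : ℝ), hermPsi 0 t := by
    have h := integral_comp_neg_Iic (0 : ℝ) (hermPsi 0)
    rw [neg_zero] at h
    rw [← h]
    simp [hermPsi]
  have h2 := intervalIntegral.integral_Iic_add_Ioi (b := (0 : ℝ))
    (integrable_hermPsi 0).integrableOn (integrable_hermPsi 0).integrableOn
  rw [hermEps, ← h2, ← h1]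
  ring

theorem hermEps_zero (y : ℝ) : hermEps 0 y = ∫ t in (0 : ℝ)..y, Real.exp (-(t ^ 2 / 2)) := by
  rw [hermEps_eq, hermEps_zero_zero, zero_add]
  simp [hermPsi]

/-- Unfolding the two-step recursion lowers the index to 1 or 0. Index 1 is a multiple of a Hermite
function; index 0, reached for odd m, is the error function. -/
theorem hermEps_succ_eq_sum (m : ℕ) (y : ℝ) : hermEps (m + 1) y =
    -2 * (∑ i ∈ Finset.range (m / 2 + 1),
      2 ^ i * (m.doubleFactorial : ℝ) / ((m - 2 * i).doubleFactorial : ℝ) * hermPsi (m - 2 * i) y) +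
    (if Odd m then 2 ^ ((m + 1) / 2) * (m.doubleFactorial : ℝ) else 0) * hermEps 0 y := by
  induction m using Nat.twoStepInduction with
  | zero => simp [hermEps_one]
  | one => simp [hermEps_succ_succ]
  | more m ih _ =>
    rw [hermEps_succ_succ, ih, show (m + 2) / 2 + 1 = (m / 2 + 1) + 1 by omega,
      Finset.sum_range_succ' _ (m / 2 + 1), show (m + 2 + 1) / 2 = (m + 1) / 2 + 1 by omega]
    have h1 : ∀ i, m + 2 - 2 * (i + 1) = m - 2 * i := fun i => by omega
    have h2 : ((m + 2).doubleFactorial : ℝ) ≠ 0 := by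
      exact_mod_cast (Nat.doubleFactorial_pos (m + 2)).ne'
    have h3 : ∑ i ∈ Finset.range (m / 2 + 1), 2 ^ (i + 1) * ((m + 2).doubleFactorial : ℝ) /
        ((m + 2 - 2 * (i + 1)).doubleFactorial : ℝ) * hermPsi (m + 2 - 2 * (i + 1)) y =
        2 * (m + 2) * ∑ i ∈ Finset.range (m / 2 + 1),
      2 ^ i * (m.doubleFactorial : ℝ) / ((m - 2 * i).doubleFactorial : ℝ) *
        hermPsi (m - 2 * i) y := by
      rw [Finset.mul_sum]
      refine Finset.sum_congr rfl fun i _ => ?_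
      rw [h1, Nat.doubleFactorial_add_two, pow_succ]
      push_cast
      ring
    rw [h3]
    have h4 : (2 : ℝ) ^ 0 * ((m + 2).doubleFactorial : ℝ) /
        ((m + 2 - 2 * 0).doubleFactorial : ℝ) * hermPsi (m + 2 - 2 * 0) y = hermPsi (m + 2) y := by
      rw [mul_zero, Nat.sub_zero, pow_zero, one_mul, div_self h2, one_mul]
    rw [h4]
    have h5 : Odd (m + 2) ↔ Odd m := by simp [Nat.odd_add, parity_simps]
    simp only [h5, Nat.doubleFactorial_add_two, pow_succ]
    push_cast
    split_ifs <;> ring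

/-! ### The integrals with the error function -/

/-- The Laplace transform of a Hermite function times the error function. -/
def epsLaplace (k : ℕ) (r : ℝ) : ℝ := ∫ x, Real.exp (r * x) * (hermPsi k x * hermEps 0 x)

/-- Integration by parts reproduces the recurrence of the Hermite transform, with a source term
because the error function has derivative exp(-x²/2). -/
theorem epsLaplace_succ (k : ℕ) (r : ℝ) : epsLaplace (k + 1) r = 2 * r * epsLaplace k r +
    2 * (k * epsLaplace (k - 1) r) + 2 * (√Real.pi * Real.exp (r ^ 2 / 4) * r ^ k) := by
  have hd : ∀ x, HasDerivAt (hermPsi k) (k * hermPsi (k - 1) x - hermPsi (k + 1) x / 2) x := by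
    intro x
    cases k with
    | zero => simpa using hasDerivAt_hermPsi_zero x
    | succ k => simpa using hasDerivAt_hermPsi_succ k x
  have i0 := (integrable_exp_mul_hermPsi_mul_hermEps k 0 r).const_mul r
  have i1 := (integrable_exp_mul_hermPsi_mul_hermEps (k - 1) 0 r).const_mul (k : ℝ)
  have i2 := (integrable_exp_mul_hermPsi_mul_hermEps (k + 1) 0 r).div_const 2
  have i3 := integrable_exp_mul_hermPsi_mul_hermPsi k 0 r
  have i12 : Integrable fun x => (k : ℝ) * (Real.exp (r * x) * (hermPsi (k - 1) x * hermEps 0 x)) -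
    Real.exp (r * x) * (hermPsi (k + 1) x * hermEps 0 x) / 2 := i1.sub i2
  have i03 : Integrable fun x => r * (Real.exp (r * x) * (hermPsi k x * hermEps 0 x)) +
    Real.exp (r * x) * (hermPsi k x * hermPsi 0 x) := i0.add i3
  have h := integral_eq_zero_of_hasDerivAt_of_integrable
    (f := fun x => Real.exp (r * x) * (hermPsi k x * hermEps 0 x))
    (f' := fun x => (r * (Real.exp (r * x) * (hermPsi k x * hermEps 0 x)) +
      Real.exp (r * x) * (hermPsi k x * hermPsi 0 x)) +
      ((k : ℝ) * (Real.exp (r * x) * (hermPsi (k - 1) x * hermEps 0 x)) -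
      Real.exp (r * x) * (hermPsi (k + 1) x * hermEps 0 x) / 2))
    (fun x => ((hasDerivAt_exp_mul r x).mul ((hd x).fun_mul
      (hasDerivAt_hermEps 0 x))).congr_deriv (by ring))
    (i03.add i12) (integrable_exp_mul_hermPsi_mul_hermEps k 0 r)
  rw [integral_add i03 i12, integral_add i0 i3, integral_sub i1 i2, integral_const_mul,
    integral_const_mul, integral_div] at h
  have h0 := psiLaplace_zero k r
  rw [psiLaplace] at h0
  simp only [epsLaplace]
  linarith

theorem hermEps_zero_neg (y : ℝ) : hermEps 0 (-y) = -hermEps 0 y := by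
  have h := intervalIntegral.integral_comp_neg (a := 0) (b := y)
    fun t : ℝ => Real.exp (-(t ^ 2 / 2))
  simp only [neg_sq, neg_zero] at h
  rw [hermEps_zero, hermEps_zero, h, intervalIntegral.integral_symm]

theorem hermPsi_zero (x : ℝ) : hermPsi 0 x = Real.exp (-(x ^ 2 / 2)) := by simp [hermPsi]

theorem integral_hermPsi_zero_mul_shift (r : ℝ) :
    ∫ x, hermPsi 0 x * hermPsi 0 (x + r) = √Real.pi * Real.exp (-(r ^ 2 / 4)) := by
  have h := integral_exp_mul_sub_sq one_pos (-r)
  rw [div_one, mul_one, neg_sq] at h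
  have h2 : ∀ x, hermPsi 0 x * hermPsi 0 (x + r) =
      Real.exp (-r * x - 1 * x ^ 2) * Real.exp (-(r ^ 2 / 2)) := by
    intro x
    rw [hermPsi_zero, hermPsi_zero, ← Real.exp_add, ← Real.exp_add]
    congr 1
    ring
  simp only [h2]
  rw [integral_mul_const, h, mul_assoc, ← Real.exp_add]
  congr 2
  ring

/-- Differentiation under the integral, dominated by the unshifted Gaussian since the shifted one is
at most 1. -/
theorem hasDerivAt_integral_hermPsi_mul_hermEps_shift (r : ℝ) :
    HasDerivAt (fun r => ∫ x, hermPsi 0 x * hermEps 0 (x + r))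
      (√Real.pi * Real.exp (-(r ^ 2 / 4))) r := by
  rw [← integral_hermPsi_zero_mul_shift]
  have hc : ∀ r : ℝ, Continuous fun x => hermEps 0 (x + r) := fun r =>
    (continuous_hermEps 0).comp (continuous_id.add continuous_const)
  have hm : ∀ r : ℝ, AEStronglyMeasurable (fun x => hermPsi 0 x * hermEps 0 (x + r)) :=
    fun r => ((continuous_hermPsi 0).mul (hc r)).aestronglyMeasurable
  refine (hasDerivAt_integral_of_dominated_loc_of_deriv_le (bound := hermPsi 0)
    (F' := fun r x => hermPsi 0 x * hermPsi 0 (x + r)) Filter.univ_mem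
    (Filter.Eventually.of_forall hm) ?_ ?_ ?_ (integrable_hermPsi 0) ?_).2
  · exact (integrable_hermPsi 0).mul_bdd (c := 2 * ∫ t, |hermPsi 0 t|)
      (hc r).aestronglyMeasurable (ae_of_all _ fun y => abs_hermEps_le 0 _)
  · exact ((continuous_hermPsi 0).mul ((continuous_hermPsi 0).comp
      (continuous_id.add continuous_const))).aestronglyMeasurable
  · refine ae_of_all _ fun x r _ => ?_
    rw [hermPsi_zero, hermPsi_zero, Real.norm_of_nonneg (by positivity)]
    refine mul_le_of_le_one_right (Real.exp_pos _).le (Real.exp_le_one_iff.mpr ?_)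
    have := sq_nonneg (x + r)
    linarith
  · refine ae_of_all _ fun x r _ => ?_
    exact ((hasDerivAt_hermEps 0 (x + r)).comp_const_add x r).const_mul _

/-- The value at shift 0 vanishes by oddness, and the derivative in the shift is a Gaussian. The
substitution t/√2 brings it to the variance of the statement. -/
theorem integral_hermPsi_mul_hermEps_shift (r : ℝ) : ∫ x, hermPsi 0 x * hermEps 0 (x + r) =
    √2 * √Real.pi * ∫ t in (0 : ℝ)..(r / √2), Real.exp (-(t ^ 2 / 2)) := by
  have h0 : ∫ x, hermPsi 0 x * hermEps 0 (x + 0) = 0 := by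
    have h := integral_neg_eq_self (fun x => hermPsi 0 x * hermEps 0 (x + 0)) volume
    simp only [add_zero, hermEps_zero_neg, hermPsi_zero, neg_sq, mul_neg, integral_neg] at h ⊢
    linarith
  have h1 := intervalIntegral.integral_eq_sub_of_hasDerivAt (a := 0) (b := r)
    (fun x _ => hasDerivAt_integral_hermPsi_mul_hermEps_shift x)
    (Continuous.intervalIntegrable (by fun_prop) _ _)
  rw [h0, sub_zero, intervalIntegral.integral_const_mul] at h1
  rw [← h1]
  have h2 := intervalIntegral.integral_comp_div (a := 0) (b := r)
    (fun t : ℝ => Real.exp (-(t ^ 2 / 2))) (c := √2) (by positivity)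
  rw [zero_div, smul_eq_mul] at h2
  rw [mul_comm √2, mul_assoc, ← h2]
  congr 1
  refine intervalIntegral.integral_congr fun t _ => ?_
  rw [div_pow, Real.sq_sqrt (by norm_num)]
  congr 1
  ring

/-- Translating the variable by r completes the square and moves the shift into the error function.
-/
theorem epsLaplace_zero (r : ℝ) : epsLaplace 0 r = √2 * √Real.pi * Real.exp (r ^ 2 / 2) *
    ∫ t in (0 : ℝ)..(r / √2), Real.exp (-(t ^ 2 / 2)) := by
  have h := integral_add_right_eq_self (fun x => Real.exp (r * x) * (hermPsi 0 x * hermEps 0 x)) r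
    (μ := volume)
  have h2 : ∀ x, Real.exp (r * (x + r)) * (hermPsi 0 (x + r) * hermEps 0 (x + r)) =
      Real.exp (r ^ 2 / 2) * (hermPsi 0 x * hermEps 0 (x + r)) := by
    intro x
    rw [← mul_assoc, ← mul_assoc, hermPsi_zero, hermPsi_zero, ← Real.exp_add, ← Real.exp_add]
    congr 2
    ring
  rw [epsLaplace, ← h]
  simp only [h2]
  rw [integral_const_mul, integral_hermPsi_mul_hermEps_shift]
  ring

/-- `hermI` solves the homogeneous recurrence with the correct initial value, and `hermT` absorbs
the source terms starting from zero. -/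
theorem epsLaplace_eq (k : ℕ) (r : ℝ) : epsLaplace k r =
    √2 * √Real.pi * Real.exp (r ^ 2 / 2) * hermI k r *
      (∫ t in (0 : ℝ)..(r / √2), Real.exp (-(t ^ 2 / 2))) +
    2 * √Real.pi * Real.exp (r ^ 2 / 4) * hermT k r := by
  induction k using Nat.twoStepInduction with
  | zero => rw [epsLaplace_zero, hermT_zero, hermI]; ring
  | one =>
    rw [epsLaplace_succ, epsLaplace_zero, hermT_succ, hermT_zero, hermI]
    simp
    ring
  | more k ih1 ih2 =>
    rw [epsLaplace_succ, ih2, Nat.add_sub_cancel, ih1, hermT_succ (k + 1), hermI_succ (k + 1),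
      Nat.add_sub_cancel]
    ring

/-! ### The Laplace transform of the difference of the densities -/

theorem integral_exp_mul_tauFun (m : ℕ) (r : ℝ) :
    ∫ y, Real.exp (r * y) * tauFun (m + 1) y = 1 / (2 * hermNorm m) *
      (-2 * (∑ i ∈ Finset.range (m / 2 + 1), 2 ^ i * (m.doubleFactorial : ℝ) /
        ((m - 2 * i).doubleFactorial : ℝ) * psiLaplace m (m - 2 * i) r) +
      (if Odd m then 2 ^ ((m + 1) / 2) * (m.doubleFactorial : ℝ) else 0) * epsLaplace m r) := by
  have h : ∀ y, Real.exp (r * y) * tauFun (m + 1) y = 1 / (2 * hermNorm m) *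
      (-2 * (∑ i ∈ Finset.range (m / 2 + 1), 2 ^ i * (m.doubleFactorial : ℝ) /
        ((m - 2 * i).doubleFactorial : ℝ) *
          (Real.exp (r * y) * (hermPsi m y * hermPsi (m - 2 * i) y))) +
      (if Odd m then 2 ^ ((m + 1) / 2) * (m.doubleFactorial : ℝ) else 0) *
        (Real.exp (r * y) * (hermPsi m y * hermEps 0 y))) := by
    intro y
    rw [tauFun_succ_eq, hermEps_succ_eq_sum]
    have h2 : ∑ i ∈ Finset.range (m / 2 + 1), 2 ^ i * (m.doubleFactorial : ℝ) /
        ((m - 2 * i).doubleFactorial : ℝ) *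
          (Real.exp (r * y) * (hermPsi m y * hermPsi (m - 2 * i) y)) =
        Real.exp (r * y) * hermPsi m y * ∑ i ∈ Finset.range (m / 2 + 1),
          2 ^ i * (m.doubleFactorial : ℝ) / ((m - 2 * i).doubleFactorial : ℝ) *
            hermPsi (m - 2 * i) y := by
      rw [Finset.mul_sum]
      exact Finset.sum_congr rfl fun i _ => by ring
    rw [h2]
    ring
  have i1 : ∀ i, Integrable fun y => 2 ^ i * (m.doubleFactorial : ℝ) /
        ((m - 2 * i).doubleFactorial : ℝ) *
          (Real.exp (r * y) * (hermPsi m y * hermPsi (m - 2 * i) y)) := fun i =>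
    (integrable_exp_mul_hermPsi_mul_hermPsi m (m - 2 * i) r).const_mul _
  have i2 := (integrable_exp_mul_hermPsi_mul_hermEps m 0 r).const_mul
    (if Odd m then 2 ^ ((m + 1) / 2) * (m.doubleFactorial : ℝ) else 0)
  simp only [h]
  rw [integral_const_mul, integral_add ((integrable_finsetSum _ fun i _ => i1 i).const_mul _) i2,
    integral_const_mul, integral_const_mul, integral_finsetSum _ fun i _ => i1 i]
  simp only [integral_const_mul]
  rfl

theorem integral_exp_mul_alphaFun (m : ℕ) (r : ℝ) :
    ∫ y, Real.exp (r * y) * alphaFun (m + 1) y =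
      if Even m then Real.exp (r ^ 2 / 2) * hypPoly (m / 2) (1 / 2) (r ^ 2) else 0 := by
  simp only [alphaFun_succ_eq, mul_left_comm (Real.exp _)]
  rw [integral_const_mul, integral_exp_mul_hermPsi]
  split_ifs with hm
  · obtain ⟨j, rfl⟩ := hm
    -- The normalising integral in α is the same transform at r = 0, where the hypergeometric
    -- polynomial equals 1.
    have h0 := integral_exp_mul_hermPsi (j + j) 0
    simp only [zero_mul, Real.exp_zero, one_mul] at h0
    rw [h0, ← two_mul, (hermI_eq_hypPoly j r).1, (hermI_eq_hypPoly j 0).1,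
      Nat.mul_div_cancel_left _ two_pos]
    have h1 : hypPoly j (1 / 2) (0 ^ 2) = 1 := by
      rw [hypPoly, Finset.sum_range_succ']
      simp
    rw [h1]
    have h3 : (√Real.pi) ≠ 0 := (Real.sqrt_pos.mpr Real.pi_pos).ne'
    have h4 : (j.factorial : ℝ) ≠ 0 := by positivity
    have h5 : ((2 * j).factorial : ℝ) ≠ 0 := by positivity
    have h6 : √2 ≠ 0 := by positivity
    simp only [ne_eq, OfNat.ofNat_ne_zero, not_false_eq_true, zero_pow, zero_div, Real.exp_zero]
    field_simp
  · simp

theorem integral_exp_mul_correction (m : ℕ) (z : ℝ) :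
    ∫ y, Real.exp (√2 * z * y) * (tauFun (m + 1) y + alphaFun (m + 1) y) =
      (if Even m then Real.exp (z ^ 2) * hypPoly (m / 2) (1 / 2) (2 * z ^ 2) else 0)
      - Real.exp (z ^ 2 / 2) * (∑ i ∈ Finset.range (m / 2 + 1),
          z ^ (2 * i) * (m.doubleFactorial : ℝ) /
            ((2 * i).factorial * (m - 2 * i).doubleFactorial) *
            hypPoly (m - 2 * i) (1 + 2 * i) (z ^ 2))
      + (if Odd m then (m.doubleFactorial : ℝ) / (2 ^ ((m + 1) / 2) * m.factorial) *
          (2 * √2 * z * (m.factorial / ((m - 1) / 2).factorial) *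
            hypPoly ((m - 1) / 2) (3 / 2) (2 * z ^ 2) * Real.exp (z ^ 2) * √2 *
            (∫ t in (0 : ℝ)..z, Real.exp (-(t ^ 2 / 2))) +
          2 * Real.exp (z ^ 2 / 2) * hermT m (√2 * z)) else 0) := by
  have hs2 : √2 * √2 = 2 := Real.mul_self_sqrt (by norm_num)
  have hr2 : (√2 * z) ^ 2 = 2 * z ^ 2 := by rw [mul_pow, pow_two √2, hs2]
  have h3 : (√Real.pi) ≠ 0 := (Real.sqrt_pos.mpr Real.pi_pos).ne'
  have h4 : (m.factorial : ℝ) ≠ 0 := by positivity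
  conv_lhs => simp only [mul_add]
  rw [integral_add (integrable_exp_mul_tauFun m _) (integrable_exp_mul_alphaFun m _),
    integral_exp_mul_tauFun, integral_exp_mul_alphaFun, hr2,
    show 2 * z ^ 2 / 2 = z ^ 2 by ring]
  have hB : 1 / (2 * hermNorm m) * (-2 * ∑ i ∈ Finset.range (m / 2 + 1),
      2 ^ i * (m.doubleFactorial : ℝ) / ((m - 2 * i).doubleFactorial : ℝ) *
        psiLaplace m (m - 2 * i) (√2 * z)) =
      -(Real.exp (z ^ 2 / 2) * (∑ i ∈ Finset.range (m / 2 + 1),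
          z ^ (2 * i) * (m.doubleFactorial : ℝ) /
            ((2 * i).factorial * (m - 2 * i).doubleFactorial) *
            hypPoly (m - 2 * i) (1 + 2 * i) (z ^ 2))) := by
    rw [Finset.mul_sum, Finset.mul_sum, Finset.mul_sum, ← Finset.sum_neg_distrib]
    refine Finset.sum_congr rfl fun i hi => ?_
    have hi' : m - 2 * i + 2 * i = m := by
      have := Finset.mem_range.mp hi
      omega
    have hp := psiLaplace_add (2 * i) (m - 2 * i) (√2 * z)
    rw [hi', hr2, show 2 * z ^ 2 / 4 = z ^ 2 / 2 by ring, show 2 * z ^ 2 / 2 = z ^ 2 by ring,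
      pow_mul, hr2, mul_pow] at hp
    -- The powers come from the unfolding coefficient, the Laplace transform and (√2 z)^(2i).
    -- Together they cancel the 2^m of the Hermite norm.
    have hpow : (2 : ℝ) ^ i * 2 ^ (m - 2 * i) * 2 ^ i = 2 ^ m := by
      rw [← pow_add, ← pow_add]
      congr 1
      omega
    have h5 : ((m - 2 * i).doubleFactorial : ℝ) ≠ 0 := by
      exact_mod_cast (Nat.doubleFactorial_pos _).ne'
    have h6 : ((2 * i).factorial : ℝ) ≠ 0 := by positivity
    rw [hp, hermNorm, ← hpow, pow_mul]
    push_cast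
    field_simp
  rw [mul_add, hB]
  rcases Nat.even_or_odd m with hm | hm
  · have ho : ¬Odd m := Nat.not_odd_iff_even.mpr hm
    rw [if_neg ho, if_neg ho, if_pos hm]
    ring
  · have he : ¬Even m := Nat.not_even_iff_odd.mpr hm
    rw [if_pos hm, if_pos hm, if_neg he, epsLaplace_eq, hr2,
      show 2 * z ^ 2 / 4 = z ^ 2 / 2 by ring, show 2 * z ^ 2 / 2 = z ^ 2 by ring,
      mul_div_cancel_left₀ _ (by positivity : √2 ≠ 0)]
    obtain ⟨q, rfl⟩ := hm
    rw [(hermI_eq_hypPoly q _).2, hr2, show (2 * q + 1 + 1) / 2 = q + 1 by omega,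
      show (2 * q + 1 - 1) / 2 = q by omega, hermNorm]
    have h7 : (q.factorial : ℝ) ≠ 0 := by positivity
    have hpow : (2 : ℝ) ^ (2 * q + 1) * 2 = 2 ^ (q + 1) * 2 ^ (q + 1) := by
      rw [← pow_succ, ← pow_add]
      congr 1
      omega
    have hw : 1 / (2 * (2 ^ (2 * q + 1) * ((2 * q + 1).factorial : ℝ) * √Real.pi)) *
        (2 ^ (q + 1) * ((2 * q + 1).doubleFactorial : ℝ)) =
        ((2 * q + 1).doubleFactorial : ℝ) / (2 ^ (q + 1) * (2 * q + 1).factorial) *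
          (1 / √Real.pi) := by
      rw [show 2 * (2 ^ (2 * q + 1) * ((2 * q + 1).factorial : ℝ) * √Real.pi) =
        2 ^ (2 * q + 1) * 2 * (((2 * q + 1).factorial : ℝ) * √Real.pi) by ring, hpow]
      field_simp
    rw [← mul_assoc (1 / _) (2 ^ (q + 1) * _), hw]
    have h8 : ((2 * q + 1).factorial : ℝ) ≠ 0 := by positivity
    field_simp
    ring_nf

end

/-! ### Assembly for general σ and passage to complex notation. -/

theorem mainTheorem6 {Ω : Type*} [MeasurableSpace Ω] (P : Measure Ω) [IsProbabilityMeasure P]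
    (n : ℕ) (hn : 1 ≤ n) (σ : ℝ) (hσ : 0 < σ)
    (A : Ω → Matrix (Fin n) (Fin n) ℝ) (hA : IsGOE P σ A) (s : ℝ) :
    Integrable (fun x : ℝ => Real.exp (s * x) * gueDensity n σ x) ∧
    Integrable (fun x : ℝ => Real.exp (s * x) * goeDensity n σ x) ∧
    Integrable (fun ω => (NormedSpace.exp (s • A ω)).trace) P ∧
    laplaceTransform (goeDensity n σ) s = ∫ ω, (NormedSpace.exp (s • A ω)).trace ∂P ∧
    ((laplaceTransform (goeDensity n σ) s : ℝ) : ℂ) =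
      ((laplaceTransform (gueDensity n σ) s : ℝ) : ℂ)
      + (if Odd n then
          Complex.exp ((σ : ℂ) ^ 2 * (s : ℂ) ^ 2) *
            hyp1F1 (-(((n : ℂ) - 1) / 2)) (1 / 2) (-2 * (σ : ℂ) ^ 2 * (s : ℂ) ^ 2)
        else 0)
      - Complex.exp ((σ : ℂ) ^ 2 * (s : ℂ) ^ 2 / 2) *
          ∑ i ∈ Finset.range ((n - 1) / 2 + 1),
            (σ : ℂ) ^ (2 * i) * (s : ℂ) ^ (2 * i) * (Nat.doubleFactorial (n - 1) : ℂ) /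
              ((Nat.factorial (2 * i) : ℂ) * (Nat.doubleFactorial (n - 1 - 2 * i) : ℂ)) *
            hyp1F1 (-((n : ℂ) - 1 - 2 * (i : ℂ))) (1 + 2 * (i : ℂ))
              (-((σ : ℂ) ^ 2 * (s : ℂ) ^ 2))
      + (if Even n then
          (Nat.doubleFactorial (n - 1) : ℂ) /
              ((2 : ℂ) ^ (n / 2) * (Nat.factorial (n - 1) : ℂ)) *
            (2 * ((Real.sqrt 2 : ℝ) : ℂ) * (σ : ℂ) * (s : ℂ) *
                ((Nat.factorial (n - 1) : ℂ) / (Nat.factorial ((n - 2) / 2) : ℂ)) *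
                hyp1F1 (-(((n : ℂ) - 2) / 2)) (3 / 2) (-2 * (σ : ℂ) ^ 2 * (s : ℂ) ^ 2) *
                Complex.exp ((σ : ℂ) ^ 2 * (s : ℂ) ^ 2) *
                ((Real.sqrt 2 : ℝ) : ℂ) *
                ((∫ t in (0 : ℝ)..(σ * s), Real.exp (-t ^ 2 / 2) : ℝ) : ℂ)
              + 2 * Complex.exp ((σ : ℂ) ^ 2 * (s : ℂ) ^ 2 / 2) *
                ∑ j ∈ Finset.Icc 1 (n - 1),
                  (Nat.choose (n - 1) j : ℂ) * (-Complex.I) ^ (n - 1 - j) *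
                    hermiteH (n - 1 - j) (Complex.I * (σ : ℂ) * ((Real.sqrt 2 : ℝ) : ℂ) * (s : ℂ)) *
                    hermiteH (j - 1) (-((σ : ℂ) * (s : ℂ)) / ((Real.sqrt 2 : ℝ) : ℂ)))
        else 0) := by
  obtain ⟨m, rfl⟩ : ∃ m, n = m + 1 := ⟨n - 1, by omega⟩
  have hc : 0 < σ * √2 := by positivity
  obtain ⟨ht1, ht2⟩ := hA.integral_trace_exp hσ s
  refine ⟨?_, ?_, ht1, ht2.symm, ?_⟩
  · simp only [gueDensity]
    exact integrable_exp_mul_scaled hc s (integrable_exp_mul_sum_hermitePhi_sq _ _)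
  · simp only [goeDensity_eq]
    exact integrable_exp_mul_scaled hc s (integrable_exp_mul_goeDensityUnit m _)
  have hsum : laplaceTransform (goeDensity (m + 1) σ) s = laplaceTransform (gueDensity (m + 1) σ) s +
      ∫ y, Real.exp (√2 * (σ * s) * y) * (tauFun (m + 1) y + alphaFun (m + 1) y) := by
    rw [laplaceTransform_goeDensity _ hσ, laplaceTransform_gueDensity _ hσ,
      show √2 * (σ * s) = σ * √2 * s by ring, ← integral_add
        (integrable_exp_mul_sum_hermitePhi_sq _ _) (integrable_exp_mul_tauFun_add_alphaFun m _)]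
    refine integral_congr_ae (ae_of_all _ fun y => ?_)
    simp only [goeDensityUnit]
    ring
  have hcast : ((2 * (σ * s) ^ 2 : ℝ) : ℂ) = 2 * (σ : ℂ) ^ 2 * (s : ℂ) ^ 2 := by push_cast; ring
  have hcast' : (((σ * s) ^ 2 : ℝ) : ℂ) = (σ : ℂ) ^ 2 * (s : ℂ) ^ 2 := by push_cast; ring
  have h1 : ((if Even m then Real.exp ((σ * s) ^ 2) * hypPoly (m / 2) (1 / 2) (2 * (σ * s) ^ 2)
      else 0 : ℝ) : ℂ) = if Odd (m + 1) then Complex.exp ((σ : ℂ) ^ 2 * (s : ℂ) ^ 2) *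
        hyp1F1 (-((((m + 1 : ℕ) : ℂ) - 1) / 2)) (1 / 2) (-2 * (σ : ℂ) ^ 2 * (s : ℂ) ^ 2) else 0 := by
    by_cases hm : Even m
    · rw [if_pos hm, if_pos hm.add_one]
      obtain ⟨j, rfl⟩ := hm
      have h := hyp1F1_neg_nat j (1 / 2) (2 * (σ * s) ^ 2)
      rw [hcast] at h
      rw [← two_mul, Nat.mul_div_cancel_left _ two_pos, Complex.ofReal_mul, ← h, Complex.ofReal_exp,
        hcast']
      congr 2
      · push_cast; ring
      · push_cast; ring
      · ring
    · rw [if_neg hm, if_neg (by rw [Nat.not_odd_iff_even]; exact (Nat.not_even_iff_odd.mp hm).add_one)]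
      simp
  have h2 : ((Real.exp ((σ * s) ^ 2 / 2) * (∑ i ∈ Finset.range (m / 2 + 1),
          (σ * s) ^ (2 * i) * (m.doubleFactorial : ℝ) /
            ((2 * i).factorial * (m - 2 * i).doubleFactorial) *
            hypPoly (m - 2 * i) (1 + 2 * i) ((σ * s) ^ 2)) : ℝ) : ℂ) =
      Complex.exp ((σ : ℂ) ^ 2 * (s : ℂ) ^ 2 / 2) *
          ∑ i ∈ Finset.range ((m + 1 - 1) / 2 + 1),
            (σ : ℂ) ^ (2 * i) * (s : ℂ) ^ (2 * i) * (Nat.doubleFactorial (m + 1 - 1) : ℂ) /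
              ((Nat.factorial (2 * i) : ℂ) * (Nat.doubleFactorial (m + 1 - 1 - 2 * i) : ℂ)) *
            hyp1F1 (-(((m + 1 : ℕ) : ℂ) - 1 - 2 * (i : ℂ))) (1 + 2 * (i : ℂ))
              (-((σ : ℂ) ^ 2 * (s : ℂ) ^ 2)) := by
    rw [Nat.add_sub_cancel, Complex.ofReal_mul, Complex.ofReal_exp, Complex.ofReal_div, hcast',
      Complex.ofReal_sum]
    congr 1
    refine Finset.sum_congr rfl fun i hi => ?_
    -- The summation range ensures that the truncated difference m - 2i is the true one appearing as
    -- a complex parameter.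
    have hi' : 2 * i ≤ m := by
      have := Finset.mem_range.mp hi
      omega
    have h := hyp1F1_neg_nat (m - 2 * i) (1 + 2 * i) ((σ * s) ^ 2)
    rw [hcast', Nat.cast_sub hi'] at h
    rw [Complex.ofReal_mul, ← h]
    push_cast
    congr 2
    · rw [mul_pow]
    · ring
  have h3 : ((if Odd m then (m.doubleFactorial : ℝ) / (2 ^ ((m + 1) / 2) * m.factorial) *
          (2 * √2 * (σ * s) * (m.factorial / ((m - 1) / 2).factorial) *
            hypPoly ((m - 1) / 2) (3 / 2) (2 * (σ * s) ^ 2) * Real.exp ((σ * s) ^ 2) * √2 *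
            (∫ t in (0 : ℝ)..(σ * s), Real.exp (-(t ^ 2 / 2))) +
          2 * Real.exp ((σ * s) ^ 2 / 2) * hermT m (√2 * (σ * s))) else 0 : ℝ) : ℂ) =
      if Even (m + 1) then
          (Nat.doubleFactorial (m + 1 - 1) : ℂ) /
              ((2 : ℂ) ^ ((m + 1) / 2) * (Nat.factorial (m + 1 - 1) : ℂ)) *
            (2 * ((Real.sqrt 2 : ℝ) : ℂ) * (σ : ℂ) * (s : ℂ) *
                ((Nat.factorial (m + 1 - 1) : ℂ) / (Nat.factorial ((m + 1 - 2) / 2) : ℂ)) *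
                hyp1F1 (-((((m + 1 : ℕ) : ℂ) - 2) / 2)) (3 / 2) (-2 * (σ : ℂ) ^ 2 * (s : ℂ) ^ 2) *
                Complex.exp ((σ : ℂ) ^ 2 * (s : ℂ) ^ 2) *
                ((Real.sqrt 2 : ℝ) : ℂ) *
                ((∫ t in (0 : ℝ)..(σ * s), Real.exp (-t ^ 2 / 2) : ℝ) : ℂ)
              + 2 * Complex.exp ((σ : ℂ) ^ 2 * (s : ℂ) ^ 2 / 2) *
                ∑ j ∈ Finset.Icc 1 (m + 1 - 1),
                  (Nat.choose (m + 1 - 1) j : ℂ) * (-Complex.I) ^ (m + 1 - 1 - j) *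
                    hermiteH (m + 1 - 1 - j)
                      (Complex.I * (σ : ℂ) * ((Real.sqrt 2 : ℝ) : ℂ) * (s : ℂ)) *
                    hermiteH (j - 1) (-((σ : ℂ) * (s : ℂ)) / ((Real.sqrt 2 : ℝ) : ℂ)))
        else 0 := by
    by_cases hm : Odd m
    · rw [if_pos hm, if_pos hm.add_one]
      obtain ⟨q, rfl⟩ := hm
      have h := hyp1F1_neg_nat q (3 / 2) (2 * (σ * s) ^ 2)
      rw [hcast] at h
      have hF : hyp1F1 (-((((2 * q + 1 + 1 : ℕ) : ℂ) - 2) / 2)) (3 / 2)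
          (-2 * (σ : ℂ) ^ 2 * (s : ℂ) ^ 2) = ((hypPoly q (3 / 2) (2 * (σ * s) ^ 2) : ℝ) : ℂ) := by
        rw [← h]
        congr 1
        · push_cast; ring
        · push_cast; ring
        · ring
      have hs2 : ((√2 : ℝ) : ℂ) * ((√2 : ℝ) : ℂ) = 2 := by
        rw [← Complex.ofReal_mul, Real.mul_self_sqrt (by norm_num)]
        simp
      have hs0 : ((√2 : ℝ) : ℂ) ≠ 0 := by
        intro h0
        rw [h0] at hs2
        norm_num at hs2
      have hT : ((hermT (2 * q + 1) (√2 * (σ * s)) : ℝ) : ℂ) =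
          ∑ j ∈ Finset.Icc 1 (2 * q + 1), (Nat.choose (2 * q + 1) j : ℂ) *
            (-Complex.I) ^ (2 * q + 1 - j) * hermiteH (2 * q + 1 - j)
              (Complex.I * (σ : ℂ) * ((Real.sqrt 2 : ℝ) : ℂ) * (s : ℂ)) *
            hermiteH (j - 1) (-((σ : ℂ) * (s : ℂ)) / ((Real.sqrt 2 : ℝ) : ℂ)) := by
        rw [hermT_eq_sum, Complex.ofReal_sum]
        refine Finset.sum_congr rfl fun j _ => ?_
        have e1 : Complex.I * (σ : ℂ) * ((Real.sqrt 2 : ℝ) : ℂ) * (s : ℂ) =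
            Complex.I * ((√2 * (σ * s) : ℝ) : ℂ) := by push_cast; ring
        have e2 : -((σ : ℂ) * (s : ℂ)) / ((Real.sqrt 2 : ℝ) : ℂ) =
            ((-(√2 * (σ * s) / 2) : ℝ) : ℂ) := by
          rw [div_eq_iff hs0]
          push_cast
          linear_combination ((σ : ℂ) * s / 2) * hs2
        rw [Complex.ofReal_mul, Complex.ofReal_mul, ofReal_hermI, ofReal_hermR, e1, e2]
        push_cast
        ring
      have hint : ∀ t : ℝ, Real.exp (-t ^ 2 / 2) = Real.exp (-(t ^ 2 / 2)) := fun t => by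
        rw [neg_div]
      simp only [Nat.add_sub_cancel, hint]
      rw [hF, ← hT, show 2 * q / 2 = q by omega, show (2 * q + 1 + 1 - 2) / 2 = q by omega,
        ← hcast']
      push_cast
      ring
    · rw [if_neg hm, if_neg (by rw [Nat.not_even_iff_odd]; exact (Nat.not_odd_iff_even.mp hm).add_one)]
      simp
  rw [hsum, Complex.ofReal_add, integral_exp_mul_correction, Complex.ofReal_add, Complex.ofReal_sub,
    h1, h2, h3]
  ring
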